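/- Let $\mathrm{ZFC}^-$ denote $\mathrm{ZFC}$ without the power set axiom, with the collection scheme in place of replacement and the well-ordering principle in place of choice. For an infinite cardinal $\kappa$: - $\kappa$ is \emph{Ramsey} if every colouring $c:[\kappa]^{<\omega}\to 2$ has a homogeneous set $H\subseteq\kappa$ of size $\kappa$ (that is, $c$ is constant on $[H]^n$ for each $n$). - A \emph{weak $\kappa$-model} is a transitive set $M\models\mathrm{ZFC}^-$ of size $\kappa$ with $\kappa\in M$. - A weak $\kappa$-model $M$ is \emph{$\omega$-special} if $M=\bigcup_{n<\omega}X_n$ for an elementary chain $\langle X_n\mid n<\omega\rangle$ of (not necessarily transitive) submodels such that each $X_n$ is an element of $M$ that has size $\kappa$ in $M$, and every sequence of length less than $\kappa$ of elements of $X_{n+1}$ that belongs to $M$ belongs to $X_{n+1}$. - An \emph{$M$-ultrafilter} on $\kappa$ is a set $U\subseteq P(\kappa)\cap M$ such that $\langle M,\in,U\rangle$ satisfies that $U$ is a normal ultrafilter on $\kappa$ containing all tail sets $\kappa\setminus\alpha$, $\alpha<\kappa$. It is \emph{weakly amenable} if $U\cap X\in M$ for every $X\in M$ that has size $\kappa$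 in $M$, and \emph{$\omega_1$-intersecting} if any countably many members of $U$ have non-empty intersection. - The \emph{ultrapower map} $j:M\to N$ by $U$ is the canonical elementary embedding of $M$ into the transitive collapse $N$ of the (well-founded) ultrapower of $M$ by $U$ formed from the functions $f:\kappa\to M$ with $f\in M$; it sends $x$ to the class of the constant function with value $x$. Statement. If $\kappa$ is Ramsey, then for every $A\subseteq\kappa$ there are an $\omega$-special weak $\kappa$-model $M$ with $A\in M$ and a weakly amenable $\omega_1$-intersecting $M$-ultrafilter $U$ on $\kappa$ whose ultrapower is well-founded and whose ultrapower map $j:M\to N$ satisfies $M=V_{j(\kappa)}^N$. Moreover $M\models\mathrm{ZFC}$ and $M\in N$. -/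

import Mathlib

open FirstOrder FirstOrder.Language Cardinal Ordinal
open scoped FirstOrder Cardinal

universe u

noncomputable section

namespace SetModels

/-! ### The first-order language of set theory and its structures on sets -/

/-- The only symbol of the language of set theory: the binary relation symbol for membership. -/
inductive SetRel : ℕ → Type
  | mem : SetRel 2

/-- The first-order language of set theory. -/
def LSet : Language := ⟨fun _ => Empty, SetRel⟩

/-- The membership symbol. -/
def memSym : LSet.Relations 2 := SetRel.mem

/-- The atomic formula saying that one variable belongs to another. -/
infix:88 " ∊ " => Relations.boundedFormula₂ memSym

/-- Every set `M` is an `LSet`-structure with the true membership relation. -/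
instance instStructure (M : ZFSet.{u}) : LSet.Structure M where
  funMap := fun f => f.elim
  RelMap | .mem => fun x => (x 0 : ZFSet.{u}) ∈ (x 1 : ZFSet.{u})

/-! ### The theories ZFC and ZFC without power set

`&i` is the variable bound by the quantifier of depth `i` (counted from the outside, from `0`). -/

/-- Two sets with the same elements are equal. -/
def extensionality : LSet.Sentence :=
  ∀' (∀' ((∀' ((&2 ∊ &0) ⇔ (&2 ∊ &1))) ⟹ (&0 =' &1)))

/-- Every nonempty set has an element disjoint from it. -/
def foundation : LSet.Sentence :=
  ∀' ((∃' (&1 ∊ &0)) ⟹ (∃' ((&1 ∊ &0) ⊓ (∀' ((&2 ∊ &1) ⟹ ∼(&2 ∊ &0))))))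

/-- For all `x`, `y` there is a set with exactly the elements `x` and `y`. -/
def pairing : LSet.Sentence :=
  ∀' (∀' (∃' (∀' ((&3 ∊ &2) ⇔ ((&3 =' &0) ⊔ (&3 =' &1))))))

/-- The union of a set exists. -/
def union : LSet.Sentence :=
  ∀' (∃' (∀' ((&2 ∊ &1) ⇔ (∃' ((&3 ∊ &0) ⊓ (&2 ∊ &3))))))

/-- There is a set that contains an empty set and with each `x` also `x ∪ {x}`. -/
def infinity : LSet.Sentence :=
  ∃' ((∃' ((&1 ∊ &0) ⊓ (∀' (∼(&2 ∊ &1))))) ⊓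
    (∀' ((&1 ∊ &0) ⟹
      (∃' ((&2 ∊ &0) ⊓ (∀' ((&3 ∊ &2) ⇔ ((&3 ∊ &1) ⊔ (&3 =' &1)))))))))

/-- The power set of a set exists. -/
def powerSet : LSet.Sentence :=
  ∀' (∃' (∀' ((&2 ∊ &1) ⇔ (∀' ((&3 ∊ &2) ⟹ (&3 ∊ &0))))))

/-- The universal closure of a formula with free variables `p 0, …, p (n - 1)`. -/
def closure {n : ℕ} (φ : LSet.Formula (Fin n)) : LSet.Sentence :=
  Formula.iAlls (Fin n) (φ.relabel (Sum.inr : Fin n → Empty ⊕ Fin n))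

/-- Substitute the bound variables `&(v 0), …, &(v (k - 1))` for the last `k` free variables of `φ`,
leaving the parameters `p 0, …, p (n - 1)` alone. -/
def sub {n k m : ℕ} (φ : LSet.Formula (Fin n ⊕ Fin k)) (v : Fin k → Fin m) :
    LSet.BoundedFormula (Fin n) m :=
  BoundedFormula.relabel (k := 0) (Sum.map id v) φ

/-- Separation for `φ(p, x)`: for every `a`, the set `{x ∈ a | φ(p, x)}` exists. -/
def separation {n : ℕ} (φ : LSet.Formula (Fin n ⊕ Fin 1)) : LSet.Sentence :=
  closure (∀' (∃' (∀' ((&2 ∊ &1) ⇔ ((&2 ∊ &0) ⊓ sub φ ![2])))))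

/-- Collection for `φ(p, x, y)`: if for each `x ∈ a` there is `y` with `φ(p, x, y)`, then there is
`b` such that for each `x ∈ a` there is `y ∈ b` with `φ(p, x, y)`. -/
def collection {n : ℕ} (φ : LSet.Formula (Fin n ⊕ Fin 2)) : LSet.Sentence :=
  closure (∀' ((∀' ((&1 ∊ &0) ⟹ (∃' (sub φ ![1, 2])))) ⟹
    (∃' (∀' ((&2 ∊ &0) ⟹ (∃' ((&3 ∊ &1) ⊓ sub φ ![2, 3])))))))

/-- Replacement for `φ(p, x, y)`: if for each `x ∈ a` there is at most one `y` with `φ(p, x, y)`,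
then the set of all `y` with `φ(p, x, y)` for some `x ∈ a` exists. -/
def replacement {n : ℕ} (φ : LSet.Formula (Fin n ⊕ Fin 2)) : LSet.Sentence :=
  closure (∀' ((∀' ((&1 ∊ &0) ⟹
      (∀' (∀' ((sub φ ![1, 2] ⊓ sub φ ![1, 3]) ⟹ (&2 =' &3)))))) ⟹
    (∃' (∀' ((&2 ∊ &1) ⇔ (∃' ((&3 ∊ &0) ⊓ sub φ ![3, 2])))))))

/-- Choice: for every set `a` of nonempty pairwise disjoint sets there is a set that has exactly one
element in common with each member of `a`. -/
def choice : LSet.Sentence :=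
  ∀' (((∀' ((&1 ∊ &0) ⟹ (∃' (&2 ∊ &1)))) ⊓
      (∀' (∀' (((&1 ∊ &0) ⊓ (&2 ∊ &0) ⊓ (∃' ((&3 ∊ &1) ⊓ (&3 ∊ &2)))) ⟹ (&1 =' &2))))) ⟹
    (∃' (∀' ((&2 ∊ &0) ⟹ (∃' (∀' (((&4 ∊ &2) ⊓ (&4 ∊ &1)) ⇔ (&4 =' &3))))))))

/-- The formula `(x, y) ∈ r`, for the Kuratowski pair `(x, y) = {{x}, {x, y}}`, where `r`, `x`, `y`
are the free variables `0`, `1`, `2`. -/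
def pairMem : LSet.Formula (Fin 3) :=
  let r : ∀ {m}, LSet.Term (Fin 3 ⊕ Fin m) := Term.var (Sum.inl 0)
  let x : ∀ {m}, LSet.Term (Fin 3 ⊕ Fin m) := Term.var (Sum.inl 1)
  let y : ∀ {m}, LSet.Term (Fin 3 ⊕ Fin m) := Term.var (Sum.inl 2)
  ∃' ((&0 ∊ r) ⊓ (∀' ((&1 ∊ &0) ⇔
    ((∀' ((&2 ∊ &1) ⇔ (&2 =' x))) ⊔ (∀' ((&2 ∊ &1) ⇔ ((&2 =' x) ⊔ (&2 =' y))))))))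

/-- The formula `(&x, &y) ∈ &r`. -/
def pairIn {m : ℕ} (r x y : Fin m) : LSet.BoundedFormula Empty m :=
  BoundedFormula.relabel (k := 0) (fun i => Sum.inr (![r, x, y] i)) pairMem

/-- The well-ordering principle: for every set `a` there is `r` that is a strict linear order of `a`
(irreflexive, transitive, total) for which every nonempty subset of `a` has a least element. -/
def wellOrdering : LSet.Sentence :=
  ∀' (∃' (
    (∀' ((&2 ∊ &0) ⟹ ∼(pairIn 1 2 2))) ⊓
    (∀' (∀' (∀' (((&2 ∊ &0) ⊓ (&3 ∊ &0) ⊓ (&4 ∊ &0) ⊓ pairIn 1 2 3 ⊓ pairIn 1 3 4) ⟹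
      pairIn 1 2 4)))) ⊓
    (∀' (∀' (((&2 ∊ &0) ⊓ (&3 ∊ &0)) ⟹ (pairIn 1 2 3 ⊔ (&2 =' &3) ⊔ pairIn 1 3 2)))) ⊓
    (∀' (((∃' (&3 ∊ &2)) ⊓ (∀' ((&3 ∊ &2) ⟹ (&3 ∊ &0)))) ⟹
      (∃' ((&3 ∊ &2) ⊓ (∀' ((&4 ∊ &2) ⟹ ((&4 =' &3) ⊔ pairIn 1 3 4)))))))))

/-- The axioms common to both theories: extensionality, foundation, pairing, union, infinity and the
separation scheme. -/
def baseAxioms : LSet.Theory :=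
  {extensionality, foundation, pairing, union, infinity} ∪
    {σ | ∃ (n : ℕ) (φ : LSet.Formula (Fin n ⊕ Fin 1)), σ = separation φ}

/-- `ZFC⁻`: ZFC without power set, with the collection scheme in place of replacement and the
well-ordering principle in place of choice. -/
def ZFCMinus : LSet.Theory :=
  baseAxioms ∪ {wellOrdering} ∪
    {σ | ∃ (n : ℕ) (φ : LSet.Formula (Fin n ⊕ Fin 2)), σ = collection φ}

/-- `ZFC`. -/
def ZFC : LSet.Theory :=
  baseAxioms ∪ {powerSet, choice} ∪
    {σ | ∃ (n : ℕ) (φ : LSet.Formula (Fin n ⊕ Fin 2)), σ = replacement φ}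

/-! ### Ramsey cardinals and weak `κ`-models -/

/-- `κ` is a Ramsey cardinal: every colouring `c : [κ]^{<ω} → 2` has a homogeneous set `H` of size
`κ`, i.e. `c` is constant on `[H]^n` for each `n`. -/
def IsRamsey (κ : Cardinal.{u}) : Prop :=
  ℵ₀ ≤ κ ∧ ∀ c : Finset κ.ord.ToType → Fin 2, ∃ H : Set κ.ord.ToType, #H = κ ∧
    ∀ s t : Finset κ.ord.ToType, (s : Set κ.ord.ToType) ⊆ H → (t : Set κ.ord.ToType) ⊆ H →
      s.card = t.card → c s = c t

/-- The cardinal `κ` as a von Neumann (initial) ordinal. -/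
def kset (κ : Cardinal.{u}) : ZFSet.{u} := κ.ord.toZFSet

/-- `M` is a weak `κ`-model: a transitive model of `ZFC⁻` of size `κ` with `κ ∈ M`. -/
structure IsWeakModel (κ : Cardinal.{u}) (M : ZFSet.{u}) : Prop where
  transitive : M.IsTransitive
  card_eq : M.card = κ
  kset_mem : kset κ ∈ M
  models : M ⊨ ZFCMinus

/-- `X ≺ Y`: `X` is an elementary submodel of `Y`. -/
def ElemSub (X Y : ZFSet.{u}) : Prop :=
  ∃ e : X ↪ₑ[LSet] Y, ∀ x : X, (e x : ZFSet.{u}) = x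

/-- `X` has size `κ` in `M`: some `f ∈ M` is a bijection from `κ` onto `X`. -/
def HasSizeIn (M : ZFSet.{u}) (κ : Cardinal.{u}) (X : ZFSet.{u}) : Prop :=
  ∃ f ∈ M, ZFSet.IsFunc (kset κ) X f ∧ ∀ y ∈ X, ∃! x, ZFSet.pair x y ∈ f

/-- `X^{<κ} ⊆ X` in `M`: every sequence of elements of `X` of length less than `κ` that belongs to
`M` belongs to `X`. -/
def ClosedIn (M : ZFSet.{u}) (κ : Cardinal.{u}) (X : ZFSet.{u}) : Prop :=
  ∀ δ ∈ kset κ, ∀ f ∈ M, ZFSet.IsFunc δ X f → f ∈ X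

/-- The weak `κ`-model `M` is `α`-special: `M` is the union of a continuous elementary chain
`⟨X ξ | ξ < α⟩` of submodels, each an element of `M` of size `κ` in `M`, with `X (ξ + 1)` closed
in `M` under sequences of length less than `κ`. -/
def IsSpecial (α : Ordinal.{u}) (κ : Cardinal.{u}) (M : ZFSet.{u}) : Prop :=
  ∃ X : Ordinal.{u} → ZFSet.{u},
    (∀ x, x ∈ M ↔ ∃ ξ < α, x ∈ X ξ) ∧
    (∀ ξ η, ξ ≤ η → η < α → ElemSub (X ξ) (X η)) ∧
    (∀ ξ < α, Order.IsSuccLimit ξ → ∀ x, x ∈ X ξ ↔ ∃ η < ξ, x ∈ X η) ∧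
    (∀ ξ < α, X ξ ∈ M ∧ HasSizeIn M κ (X ξ)) ∧
    (∀ ξ, ξ + 1 < α → ClosedIn M κ (X (ξ + 1)))

/-! ### `M`-ultrafilters and their ultrapowers -/

/-- The diagonal intersection `{ξ < κ | ξ ∈ f(α) for all α < ξ}` of a sequence `f` of length `κ`. -/
def diagInter (κ : Cardinal.{u}) (f : ZFSet.{u}) : ZFSet.{u} :=
  (kset κ).sep fun ξ => ∀ α ∈ ξ, ∀ B, ZFSet.pair α B ∈ f → ξ ∈ B

/-- `U` is an `M`-ultrafilter on `κ`: a family of subsets of `κ` in `M` such that `⟨M, ∈, U⟩`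
satisfies that `U` is a normal ultrafilter on `κ` that contains the tail sets. -/
structure IsMUltrafilter (M : ZFSet.{u}) (κ : Cardinal.{u}) (U : ZFSet.{u}) : Prop where
  mem_model : ∀ B ∈ U, B ∈ M ∧ B ⊆ kset κ
  empty_notMem : ∅ ∉ U
  upward : ∀ B ∈ U, ∀ C ∈ M, B ⊆ C → C ⊆ kset κ → C ∈ U
  inter : ∀ B ∈ U, ∀ C ∈ U, B ∩ C ∈ U
  ultra : ∀ B ∈ M, B ⊆ kset κ → B ∈ U ∨ kset κ \ B ∈ U
  tail : ∀ α ∈ kset κ, kset κ \ α ∈ U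
  normal : ∀ f ∈ M, ZFSet.IsFunc (kset κ) U f → diagInter κ f ∈ U

/-- `U` is weakly amenable to `M`: its intersection with any set of size `κ` in `M` is in `M`. -/
def WeaklyAmenable (M : ZFSet.{u}) (κ : Cardinal.{u}) (U : ZFSet.{u}) : Prop :=
  ∀ X ∈ M, HasSizeIn M κ X → U ∩ X ∈ M

/-- `U` is `ω₁`-intersecting: any countably many members of `U` have a common element. -/
def OmegaOneIntersecting (U : ZFSet.{u}) : Prop :=
  ∀ B : ℕ → ZFSet.{u}, (∀ n, B n ∈ U) → ∃ x, ∀ n, x ∈ B n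

/-- The functions `f : κ → M` that are elements of `M`. -/
def UltFun (M : ZFSet.{u}) (κ : Cardinal.{u}) : Type (u + 1) :=
  {f : ZFSet.{u} // f ∈ M ∧ ZFSet.IsFunc (kset κ) M f}

/-- `{ξ < κ | R (f ξ) (g ξ)}`. -/
def agreeSet (κ : Cardinal.{u}) (R : ZFSet.{u} → ZFSet.{u} → Prop) (f g : ZFSet.{u}) : ZFSet.{u} :=
  (kset κ).sep fun ξ => ∃ y z, ZFSet.pair ξ y ∈ f ∧ ZFSet.pair ξ z ∈ g ∧ R y z

/-- `j : M → N` is the ultrapower map of `M` by `U`: `N` is the transitive collapse of the ultrapower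
of `M` by `U`, formed from the functions `f : κ → M` in `M`, with `π f ∈ N` the collapse of the class
`[f]`, and `j` sends `x` to the class of the constant function with value `x`. -/
def IsUltrapowerMap (M : ZFSet.{u}) (κ : Cardinal.{u}) (U N : ZFSet.{u}) (j : M → N) : Prop :=
  N.IsTransitive ∧ ∃ π : UltFun M κ → N, Function.Surjective π ∧
    (∀ f g, π f = π g ↔ agreeSet κ (· = ·) f.1 g.1 ∈ U) ∧
    (∀ f g, (π f : ZFSet.{u}) ∈ (π g : ZFSet.{u}) ↔ agreeSet κ (· ∈ ·) f.1 g.1 ∈ U) ∧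
    (∀ x : M, ∃ f : UltFun M κ, f.1 = ZFSet.prod (kset κ) {(x : ZFSet.{u})} ∧ j x = π f)

/-- `V_α^N` for an ordinal `α` of a transitive model `N`: the elements of `N` of rank less than `α`
(the rank function is absolute for transitive models of `ZFC⁻`). -/
def rankInitial (N α : ZFSet.{u}) : ZFSet.{u} := N.sep fun x => x.rank < α.rank

end SetModels

end

/-! The model is a collapse of functions of indiscernibles. By the Ramsey property, countably many
finitary regressive functions are simultaneously constant on one unbounded subset of `κ`
(`exists_homogeneous_regressive_nat`). This makes `κ` inaccessible, and it gives an unbounded set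
`H` of good indiscernibles: the truth of countably many relations at an increasing sequence `γ` from
`H` does not depend on `γ`, even with two parameters below `γ 0` (`exists_indiscernible`).

Apply this to functions from sequences into `V_κ`, arranged in countably many levels. A level has
only `κ` many functions, since inaccessibility bounds the number of terms that build them, and the
parameters serve as indices of functions. So membership and equality between any two functions are
decided on all sequences from `H` that start high enough. Calling this "eventually", the functions
modulo eventual equality form a well-founded extensional structure, with collapse `col` and a Łoś
theorem (`los_aux`). Functions regressive at `γ 0` are eventually constant (`exists_ev_eq_oz`), so
sets in `V_κ` collapse to themselves and the first indiscernible collapses to `κ` (`col_vr_zero`).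

Let `Mod i` be the collapse of `V_(γ i)`. Then `Mod 0 = V_κ`, and dropping the first indiscernible
induces elementary embeddings `Mod i → Mod (i + 1)`, so each `Mod i` is a model of ZFC. Take `M =
Mod 1`, `N = Mod 2`, `j` the shift, and `U = {B | κ ∈ j(B)}`. As `j(κ)` is the collapse of the
second indiscernible and ranks are compared pointwise, `M` is `V_{j(κ)}^N`. An element `W(γ 0, γ 1,
…)` of `N` is `j(f)(κ)` for `f(ξ) = W(ξ, γ 0, …)`, so `N` is the ultrapower of `M` by `U`
(`isUltrapowerMap_of_emb`).

The levels are what makes `M` `ω`-special: the elements of `M` given by functions of one level form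
an elementary submodel, closed under short sequences because the level is, and itself an element of
`M` because the next level enumerates it (`mem_col_chainFn`, `closedIn_chain`). Countably many
members of `U` have a common element because a single high indiscernible belongs to all of them. -/

noncomputable section

namespace SetModels

/-! ### Homogeneous sets for finitary predicates on sequences -/

/-- `γ` is a strictly increasing sequence of elements of `I`. -/
def SeqIn {O : Type*} [LinearOrder O] (I : Set O) (γ : ℕ → O) : Prop :=
  StrictMono γ ∧ ∀ i, γ i ∈ I

/-- The first `n` entries of `γ`, followed by `γ'`. -/
def seqAppend {O : Type*} (n : ℕ) (γ γ' : ℕ → O) : ℕ → O :=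
  fun i => if i < n then γ i else γ' (i - n)

theorem seqAppend_of_lt {O : Type*} {γ γ' : ℕ → O} {n i : ℕ} (h : i < n) : seqAppend n γ γ' i = γ i := if_pos h

theorem seqAppend_add {O : Type*} {γ γ' : ℕ → O} (n : ℕ) : (fun i => seqAppend n γ γ' (n + i)) = γ' := by
  funext i
  simp [seqAppend]

section Seq

variable {O : Type*} [LinearOrder O] {I : Set O} {γ γ' : ℕ → O}

theorem SeqIn.shift (h : SeqIn I γ) (n : ℕ) : SeqIn I fun i => γ (n + i) :=
  ⟨fun _ _ hij => h.1 (by omega), fun i => h.2 _⟩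

theorem SeqIn.mono {J : Set O} (h : SeqIn I γ) (hIJ : I ⊆ J) : SeqIn J γ :=
  ⟨h.1, fun i => hIJ (h.2 i)⟩

theorem SeqIn.append {n : ℕ} (h : SeqIn I γ) (h' : SeqIn I γ') (hn : ∀ i < n, γ i < γ' 0) :
    SeqIn I (seqAppend n γ γ') := by
  refine ⟨strictMono_nat_of_lt_succ fun i => ?_, fun i => ?_⟩
  · unfold seqAppend
    split_ifs with h1 h2 h2
    · exact h.1 (Nat.lt_succ_self i)
    · have : i + 1 - n = 0 := by omega
      rw [this]
      exact hn i h1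
    · omega
    · exact h'.1 (by omega)
  · unfold seqAppend
    split_ifs
    · exact h.2 _
    · exact h'.2 _

theorem exists_seqIn (hI : ∀ x, ∃ y ∈ I, x < y) (x : O) : ∃ γ, SeqIn I γ ∧ x < γ 0 := by
  choose g hg hlt using hI
  refine ⟨fun n => g (g^[n] x), ⟨strictMono_nat_of_lt_succ fun n => ?_, fun i => hg _⟩, hlt _⟩
  rw [Function.iterate_succ_apply']
  exact hlt _

end Seq

theorem exists_gt_of_mk_eq {κ : Cardinal.{u}} (hκ : ℵ₀ ≤ κ) {I : Set κ.ord.ToType} (hI : #I = κ)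
    (x : κ.ord.ToType) : ∃ y ∈ I, x < y := by
  by_contra! h
  have h1 : I ⊆ Set.Iic x := h
  have h2 : #(Set.Iic x) < κ := by
    have h3 : Set.Iic x = insert x (Set.Iio x) := by
      ext y; simp [le_iff_lt_or_eq, or_comm]
    rw [h3]
    refine (mk_insert_le).trans_lt (add_lt_of_lt hκ ?_ (one_lt_aleph0.trans_le hκ))
    simpa using mk_Iio_lt x
  exact ((mk_le_mk_of_subset h1).trans_lt h2).ne hI

/-- A Ramsey cardinal has sets that are homogeneous for countably many finitary predicates. -/
theorem IsRamsey.exists_homogeneous {κ : Cardinal.{u}} (hκ : IsRamsey κ) {ι : Type*} [Countable ι]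
    (P : ι → (ℕ → κ.ord.ToType) → Prop) (hP : ∀ k, ∃ d, DependsOn (P k) (Set.Iio d)) :
    ∃ I : Set κ.ord.ToType, #I = κ ∧
      ∀ k γ γ', SeqIn I γ → SeqIn I γ' → (P k γ ↔ P k γ') := by
  classical
  obtain ⟨e, he⟩ := exists_injective_nat ι
  choose d hd using hP
  have hne : Nonempty κ.ord.ToType := by
    rw [← mk_ne_zero_iff, mk_toType, card_ord]
    exact (aleph0_pos.trans_le hκ.1).ne'
  let en : Finset κ.ord.ToType → ℕ → κ.ord.ToType := fun s i =>
    if h : i < s.card then s.orderEmbOfFin rfl ⟨i, h⟩ else hne.some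
  -- One colouring serves all predicates: the size `Nat.pair (e k) (d k)` of a finite set names the
  -- predicate `P k` to be tested on its increasing enumeration, and this size is at least `d k`, so
  -- the default values of `en` are not read.
  let c : Finset κ.ord.ToType → Fin 2 := fun s =>
    if ∃ k, e k = (Nat.unpair s.card).1 ∧ P k (en s) then 1 else 0
  obtain ⟨I, hI, hc⟩ := hκ.2 c
  refine ⟨I, hI, ?_⟩
  have key : ∀ k γ, SeqIn I γ →
      (P k γ ↔ c ((Finset.range (Nat.pair (e k) (d k))).image γ) = 1) := by
    intro k γ hγ
    set N := Nat.pair (e k) (d k)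
    set s := (Finset.range N).image γ with hs
    have hcard : s.card = N := by
      rw [hs, Finset.card_image_of_injective _ hγ.1.injective, Finset.card_range]
    have hen : ∀ i < N, en s i = γ i := by
      have h1 : (fun i : Fin s.card => γ i) = s.orderEmbOfFin rfl := by
        apply Finset.orderEmbOfFin_unique
        · intro i
          exact Finset.mem_image_of_mem γ (Finset.mem_range.2 (hcard ▸ i.2))
        · exact fun i j hij => hγ.1 hij
      intro i hi
      have hi' : i < s.card := hcard ▸ hi
      simp only [en, hi', dif_pos]
      exact (congrFun h1 ⟨i, hi'⟩).symm
    have h2 : P k (en s) = P k γ :=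
      hd k fun i hi => hen i (lt_of_lt_of_le hi (Nat.right_le_pair _ _))
    have h3 : (Nat.unpair s.card).1 = e k := by rw [hcard, Nat.unpair_pair]
    simp only [c, h3]
    rw [← h2]
    split_ifs with h
    · obtain ⟨k', hk', hP'⟩ := h
      simpa [he hk'] using he hk' ▸ hP'
    · simpa using fun hp => h ⟨k, rfl, hp⟩
  intro k γ γ' h h'
  rw [key k γ h, key k γ' h']
  have : ∀ γ, SeqIn I γ →
      ((((Finset.range (Nat.pair (e k) (d k))).image γ : Finset _) : Set _) ⊆ I) := by
    intro γ h x hx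
    obtain ⟨i, -, rfl⟩ := by simpa using hx
    exact h.2 _
  rw [hc _ _ (this γ h) (this γ' h')
    (by rw [Finset.card_image_of_injective _ h.1.injective,
      Finset.card_image_of_injective _ h'.1.injective])]

/-- If `κ` were `ℵ₀`, each point would have a finite number of predecessors. Homogeneity for all the
bounds `k` on that number would keep it from growing along a sequence, but it grows strictly. -/
theorem IsRamsey.aleph0_lt {κ : Cardinal.{u}} (hκ : IsRamsey κ) : ℵ₀ < κ := by
  refine lt_of_le_of_ne hκ.1 fun h => ?_
  have hfin : ∀ x : κ.ord.ToType, (Set.Iio x).Finite := fun x => by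
    rw [← lt_aleph0_iff_set_finite, h]
    simpa using mk_Iio_lt x
  obtain ⟨I, hI, hom⟩ := hκ.exists_homogeneous (fun k γ => (Set.Iio (γ 0)).ncard ≤ k)
    fun k => ⟨1, fun γ γ' h => by simp [h 0 (by simp)]⟩
  have hun := exists_gt_of_mk_eq hκ.1 hI
  have hne : Nonempty κ.ord.ToType := by
    rw [← mk_ne_zero_iff, mk_toType, card_ord]
    exact (aleph0_pos.trans_le hκ.1).ne'
  obtain ⟨γ, hγ, -⟩ := exists_seqIn hun hne.some
  obtain ⟨γ', hγ', -⟩ := exists_seqIn hun hne.some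
  have key : ∀ n, (Set.Iio (γ n)).ncard ≤ (Set.Iio (γ 0)).ncard := by
    intro n
    have := hom (Set.Iio (γ 0)).ncard γ (fun i => γ (n + i)) hγ (hγ.shift n)
    simpa using this.1 le_rfl
  have h1 := key 1
  have : Set.Iio (γ 0) ⊂ Set.Iio (γ 1) :=
    Set.Iio_ssubset_Iio (hγ.1 Nat.zero_lt_one)
  exact absurd (Set.ncard_lt_ncard this (hfin _)) (by omega)

/-! ### Regressive functions on Ramsey cardinals -/

section Blocks

variable {O : Type*} (f : ℕ → (ℕ → O) → O) (d : ℕ → ℕ)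

/-- The arity of `blockTerm f d l`. -/
def blockArity : List ℕ → ℕ
  | [] => 1
  | m :: l => blockArity l * (d m + 1)

/-- Iterated composition of the functions `f m`, each applied to the values of the previous
composition on consecutive blocks. -/
def blockTerm : List ℕ → (ℕ → O) → O
  | [], γ => γ 0
  | m :: l, γ => f m fun j => blockTerm l fun i => γ (blockArity d l * j + i)

theorem blockArity_pos (l : List ℕ) : 0 < blockArity d l := by
  induction l with
  | nil => exact Nat.one_pos
  | cons m l ih => exact Nat.mul_pos ih (Nat.succ_pos _)

variable {f d}

theorem dependsOn_blockTerm (hf : ∀ m, DependsOn (f m) (Set.Iio (d m))) (l : List ℕ) :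
    DependsOn (blockTerm f d l) (Set.Iio (blockArity d l)) := by
  induction l with
  | nil => intro γ γ' h; exact h 0 Nat.one_pos
  | cons m l ih =>
    intro γ γ' h
    refine hf m fun j hj => ih fun i hi => h _ ?_
    simp only [Set.mem_Iio, blockArity] at *
    calc blockArity d l * j + i < blockArity d l * j + blockArity d l := by omega
      _ = blockArity d l * (j + 1) := by ring
      _ ≤ blockArity d l * (d m + 1) := Nat.mul_le_mul_left _ (by omega)

end Blocks

/-- `κ` copies of `ω` embed, in lexicographic order, into each set of size `κ`. -/
theorem exists_lex_embedding {κ : Cardinal.{u}} (hκ : ℵ₀ < κ) {I : Set κ.ord.ToType} (hI : #I = κ) :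
    ∃ e : κ.ord.ToType → ℕ → κ.ord.ToType, (∀ α i, e α i ∈ I) ∧
      (∀ α, StrictMono (e α)) ∧ ∀ α β i j, α < β → e α i < e β j := by
  -- An uncountable initial ordinal absorbs `ω` on the left, so the lexicographic product still has
  -- order type `κ`.
  have h1 : (ω : Ordinal.{u}) * κ.ord = κ.ord := by
    refine (isPrincipal_mul_iff_mul_left_eq.1 (isPrincipal_mul_ord hκ.le)) ω omega0_pos ?_
    rwa [lt_ord, card_omega0]
  have h2 : type (α := ULift.{u} ℕ) (· < ·) = ω := by simp
  have h3 : type (Prod.Lex (α := κ.ord.ToType) (β := ULift.{u} ℕ) (· < ·) (· < ·)) = κ.ord := by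
    rw [type_prod_lex, h2, type_toType, h1]
  have h4 : κ.ord ≤ type (α := I) (· < ·) := by
    rw [ord_le, card_type, hI]
  obtain ⟨e⟩ := type_le_iff'.1 (h3.le.trans h4)
  refine ⟨fun α i => (e (α, ⟨i⟩)).1, fun α i => (e _).2, fun α i j hij => ?_,
    fun α β i j h => ?_⟩
  · exact e.map_rel_iff.2 (Prod.Lex.right _ (show ULift.up.{u} i < ULift.up j from hij))
  · exact e.map_rel_iff.2 (Prod.Lex.left _ _ h)

/-- On a Ramsey cardinal, countably many finitary regressive functions are constant on a common
unbounded set. -/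
theorem IsRamsey.exists_homogeneous_regressive_nat {κ : Cardinal.{u}} (hκ : IsRamsey κ)
    (f : ℕ → (ℕ → κ.ord.ToType) → κ.ord.ToType) (d : ℕ → ℕ)
    (hd : ∀ m, DependsOn (f m) (Set.Iio (d m)))
    (hf : ∀ m γ, StrictMono γ → f m γ < γ 0 ∨ ∀ x, f m γ ≤ x) :
    ∃ H : Set κ.ord.ToType, (∀ x, ∃ y ∈ H, x < y) ∧
      ∀ m γ γ', SeqIn H γ → SeqIn H γ' → f m γ = f m γ' := by
  set t := blockTerm f d with ht
  set n := blockArity d with hn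
  have hdt : ∀ l, DependsOn (t l) (Set.Iio (n l)) := dependsOn_blockTerm hd
  have hnpos : ∀ l, 0 < n l := blockArity_pos d
  have hdsh : ∀ l, ∃ N, ∀ γ γ' : ℕ → κ.ord.ToType, (∀ i < N, γ i = γ' i) →
      t l γ = t l γ' ∧ t l (fun i => γ (n l + i)) = t l (fun i => γ' (n l + i)) := by
    intro l
    refine ⟨n l + n l, fun γ γ' h => ⟨hdt l fun i hi => h i ?_, hdt l fun i hi => h _ ?_⟩⟩
    · simp only [Set.mem_Iio] at hi; omega
    · simp only [Set.mem_Iio] at hi; omega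
  -- Homogeneity is imposed on all iterated compositions at once, comparing the values on two
  -- consecutive blocks of arguments.
  obtain ⟨I, hI, hom⟩ := hκ.exists_homogeneous
    (fun (p : List ℕ × Fin 3) γ => match p.2 with
      | 0 => t p.1 γ < t p.1 fun i => γ (n p.1 + i)
      | 1 => t p.1 γ = t p.1 fun i => γ (n p.1 + i)
      | 2 => ∀ x, t p.1 γ ≤ x) (by
    rintro ⟨l, k⟩
    obtain ⟨N, hN⟩ := hdsh l
    refine ⟨N, fun γ γ' h => ?_⟩
    obtain ⟨h1, h2⟩ := hN γ γ' h
    fin_cases k <;> simp [h1, h2])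
  have hlt : ∀ l γ γ', SeqIn I γ → SeqIn I γ' → ((t l γ < t l fun i => γ (n l + i)) ↔
    t l γ' < t l fun i => γ' (n l + i)) := fun l => hom (l, 0)
  have heq : ∀ l γ γ', SeqIn I γ → SeqIn I γ' → ((t l γ = t l fun i => γ (n l + i)) ↔
    t l γ' = t l fun i => γ' (n l + i)) := fun l => hom (l, 1)
  have hbot : ∀ l γ γ', SeqIn I γ → SeqIn I γ' → ((∀ x, t l γ ≤ x) ↔ ∀ x, t l γ' ≤ x) :=
    fun l => hom (l, 2)
  have hun := exists_gt_of_mk_eq hκ.1 hI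
  have hne : Nonempty κ.ord.ToType := by
    rw [← mk_ne_zero_iff, mk_toType, card_ord]
    exact (aleph0_pos.trans_le hκ.1).ne'
  obtain ⟨γ₀, hγ₀, -⟩ := exists_seqIn hun hne.some
  set Inc : List ℕ → Prop := fun l => ∀ γ, SeqIn I γ → t l γ < t l fun i => γ (n l + i)
  have hblock : ∀ l, Inc l → ∀ γ, SeqIn I γ → StrictMono fun j => t l fun i => γ (n l * j + i) := by
    intro l hl γ hγ
    refine strictMono_nat_of_lt_succ fun j => ?_
    have := hl _ (hγ.shift (n l * j))
    convert this using 4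
    ring
  -- A composition that decreased from block to block would yield an infinite descending sequence,
  -- so one that does not increase is constant on consecutive blocks.
  have hdich : ∀ l, ¬ Inc l → ∀ γ, SeqIn I γ → t l γ = t l fun i => γ (n l + i) := by
    intro l hl γ hγ
    by_contra hne
    have h1 : ∀ γ', SeqIn I γ' → (t l fun i => γ' (n l + i)) < t l γ' := by
      intro γ' hγ'
      rcases lt_trichotomy (t l γ') (t l fun i => γ' (n l + i)) with h | h | h
      · exact absurd (fun γ hγ => (hlt l γ' γ hγ' hγ).1 h) hl
      · exact absurd ((heq l γ' γ hγ' hγ).1 h) hne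
      · exact h
    have h2 : StrictAnti fun j => t l fun i => γ (n l * j + i) := by
      refine strictAnti_nat_of_succ_lt fun j => ?_
      have := h1 _ (hγ.shift (n l * j))
      convert this using 4
      ring
    exact not_strictAnti_of_wellFoundedLT _ h2
  have hnil : Inc [] := fun γ hγ => hγ.1 (show 0 < n [] + 0 from hnpos [])
  -- If every increasing composition had an increasing extension, iterating would give a descent: a
  -- regressive function applied to the increasing block values falls below the first of them. It
  -- cannot take the least value of `κ` instead, since it would do so on the next block too and not
  -- increase.
  have hmin : ∃ l, Inc l ∧ ∀ m, ¬ Inc (m :: l) := by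
    by_contra! hcon
    choose! g hg using hcon
    let L : ℕ → List ℕ := fun k => Nat.rec [] (fun _ l => g l :: l) k
    have hL : ∀ k, Inc (L k) := by
      intro k
      induction k with
      | zero => exact hnil
      | succ k ih => exact hg _ ih
    refine not_strictAnti_of_wellFoundedLT (fun k => t (L k) γ₀)
      (strictAnti_nat_of_succ_lt fun k => ?_)
    have h1 := hf (g (L k)) _ (hblock (L k) (hL k) γ₀ hγ₀)
    rcases h1 with h1 | h1
    · simp only [mul_zero, zero_add] at h1
      exact h1
    · exfalso
      have h2 := (hbot (L (k + 1)) γ₀ _ hγ₀ (hγ₀.shift (n (L (k + 1))))).1 h1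
      exact (hL (k + 1) γ₀ hγ₀).not_ge (h2 _)
  obtain ⟨l, hl, hlm⟩ := hmin
  -- Equality on consecutive blocks becomes equality on any two sequences by comparing both with a
  -- third that starts beyond their blocks.
  have hconst : ∀ m γ γ', SeqIn I γ → SeqIn I γ' → t (m :: l) γ = t (m :: l) γ' := by
    intro m γ γ' hγ hγ'
    set N := n (m :: l)
    obtain ⟨γ'', hγ'', hgt⟩ := exists_seqIn hun (max (γ N) (γ' N))
    have aux : ∀ δ, SeqIn I δ → δ N < γ'' 0 → t (m :: l) δ = t (m :: l) γ'' := by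
      intro δ hδ hlt
      have h1 : SeqIn I (seqAppend N δ γ'') :=
        hδ.append hγ'' fun i hi => (hδ.1 hi).trans hlt
      have h2 := hdich _ (hlm m) _ h1
      rw [seqAppend_add] at h2
      rw [← h2]
      exact hdt _ fun i hi => (seqAppend_of_lt hi).symm
    rw [aux γ hγ ((le_max_left _ _).trans_lt hgt), aux γ' hγ' ((le_max_right _ _).trans_lt hgt)]
  obtain ⟨e, heI, hemono, helt⟩ := exists_lex_embedding hκ.aleph0_lt hI
  have hseq : ∀ α, SeqIn I (e α) := fun α => ⟨hemono α, heI α⟩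
  -- The required set consists of values of the maximal increasing composition, one for each of `κ`
  -- successive copies of `ω` inside `I`.
  set g : κ.ord.ToType → κ.ord.ToType := fun α => t l (e α)
  have hg : StrictMono g := by
    intro α β hαβ
    have h1 := hl _ ((hseq α).append (n := n l) (hseq β) fun i _ => helt _ _ _ _ hαβ)
    rw [seqAppend_add] at h1
    exact (hdt l fun i hi => (seqAppend_of_lt hi).symm).trans_lt h1
  -- Concatenating the first `n l` terms of the copies involved gives one sequence of `I` whose
  -- block values are the given points, so `f m` is evaluated as the constant composition `m :: l`.
  have hgm : ∀ m γ, SeqIn (Set.range g) γ → ∃ δ, SeqIn I δ ∧ f m γ = t (m :: l) δ := by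
    intro m γ hγ
    choose a ha using hγ.2
    have hamono : StrictMono a := fun i j hij => by
      rw [← hg.lt_iff_lt, ha, ha]; exact hγ.1 hij
    refine ⟨fun i => e (a (i / n l)) (i % n l), ⟨strictMono_nat_of_lt_succ fun i => ?_,
      fun i => heI _ _⟩, ?_⟩
    · have hq : i / n l ≤ (i + 1) / n l := Nat.div_le_div_right (Nat.le_succ i)
      rcases hq.eq_or_lt with hq | hq
      · rw [hq]
        apply hemono
        have h1 := Nat.div_add_mod i (n l)
        have h2 := Nat.div_add_mod (i + 1) (n l)
        rw [← hq] at h2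
        omega
      · exact helt _ _ _ _ (hamono hq)
    · change f m γ = f m _
      congr 1
      funext j
      rw [← ha j]
      refine hdt l fun i hi => ?_
      have hi' : i < n l := hi
      have h1 : (n l * j + i) / n l = j := by
        rw [Nat.mul_add_div (hnpos l), Nat.div_eq_of_lt hi', add_zero]
      have h2 : (n l * j + i) % n l = i := by
        rw [Nat.mul_add_mod, Nat.mod_eq_of_lt hi']
      change e (a j) i = e (a ((n l * j + i) / n l)) ((n l * j + i) % n l)
      rw [h1, h2]
  refine ⟨Set.range g, fun x => ?_, fun m γ γ' hγ hγ' => ?_⟩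
  · obtain ⟨y, -, hy⟩ := hun x
    exact ⟨g y, ⟨y, rfl⟩, hy.trans_le (hg.le_apply)⟩
  · obtain ⟨δ, hδ, h1⟩ := hgm m γ hγ
    obtain ⟨δ', hδ', h2⟩ := hgm m γ' hγ'
    rw [h1, h2, hconst m δ δ' hδ hδ']

theorem IsRamsey.exists_homogeneous_regressive {κ : Cardinal.{u}} (hκ : IsRamsey κ) {ι : Type*}
    [Countable ι] (f : ι → (ℕ → κ.ord.ToType) → κ.ord.ToType)
    (hd : ∀ m, ∃ d, DependsOn (f m) (Set.Iio d))
    (hf : ∀ m γ, StrictMono γ → f m γ < γ 0 ∨ ∀ x, f m γ ≤ x) :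
    ∃ H : Set κ.ord.ToType, (∀ x, ∃ y ∈ H, x < y) ∧
      ∀ m γ γ', SeqIn H γ → SeqIn H γ' → f m γ = f m γ' := by
  rcases isEmpty_or_nonempty ι with h | h
  · refine ⟨Set.univ, fun x => ?_, fun m => isEmptyElim m⟩
    simpa using exists_gt_of_mk_eq hκ.1 (I := Set.univ) (by simp) x
  · obtain ⟨e, he⟩ := exists_surjective_nat ι
    choose d hd using hd
    obtain ⟨H, h1, h2⟩ := hκ.exists_homogeneous_regressive_nat (fun k => f (e k)) (fun k => d (e k))
      (fun k => hd _) fun k => hf _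
    refine ⟨H, h1, fun m => ?_⟩
    obtain ⟨k, rfl⟩ := he m
    exact h2 k

/-! ### Ramsey cardinals are inaccessible -/

/-- The least element of a set, or the least element of the type if the set is empty. -/
def leastOf {O : Type*} [LinearOrder O] [WellFoundedLT O] [Nonempty O] (s : Set O) : O :=
  open Classical in
  if h : s.Nonempty then wellFounded_lt.min s h else
    wellFounded_lt.min (Set.univ : Set O) Set.univ_nonempty

section Least

variable {O : Type*} [LinearOrder O] [WellFoundedLT O] [Nonempty O] {s : Set O}

theorem leastOf_mem (h : s.Nonempty) : leastOf s ∈ s := by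
  rw [leastOf, dif_pos h]
  exact WellFounded.min_mem _ _ h

theorem leastOf_empty_le (h : ¬ s.Nonempty) (x : O) : leastOf s ≤ x := by
  rw [leastOf, dif_neg h]
  exact not_lt.1 (WellFounded.not_lt_min wellFounded_lt (s := Set.univ) (Set.mem_univ x))

/-- The default for an empty set is the least point; this is why regressive functions are allowed to
take the least value as well as values below `γ 0`. -/
theorem leastOf_regressive {a : O} (h : ∀ x ∈ s, x < a) : leastOf s < a ∨ ∀ x, leastOf s ≤ x := by
  by_cases hs : s.Nonempty
  · exact Or.inl (h _ (leastOf_mem hs))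
  · exact Or.inr (leastOf_empty_le hs)

end Least

theorem IsRamsey.nonempty {κ : Cardinal.{u}} (hκ : IsRamsey κ) : Nonempty κ.ord.ToType := by
  rw [← mk_ne_zero_iff, mk_toType, card_ord]
  exact (aleph0_pos.trans_le hκ.1).ne'

theorem exists_mk_Iio_eq {κ : Cardinal.{u}} {c : Cardinal.{u}} (h : c < κ) :
    ∃ l : κ.ord.ToType, #(Set.Iio l) = c := by
  have h1 : c.ord < type (α := κ.ord.ToType) (· < ·) := by rwa [type_toType, ord_lt_ord]
  refine ⟨enum (α := κ.ord.ToType) (· < ·) ⟨c.ord, h1⟩, ?_⟩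
  have h2 := typein_enum (α := κ.ord.ToType) (· < ·) h1
  have h3 : (typein (α := κ.ord.ToType) (· < ·) (enum (α := κ.ord.ToType) (· < ·)
    ⟨c.ord, h1⟩)).card = c := by rw [h2, card_ord]
  exact Eq.trans rfl h3

/-- From a cofinal set indexed by `l < κ`, send a point above `l` to the least index of a member
bounding it. This is regressive, and where it is constant a single member bounds an unbounded set.
-/
theorem IsRamsey.isRegular {κ : Cardinal.{u}} (hκ : IsRamsey κ) : κ.IsRegular := by
  refine ⟨hκ.1, ?_⟩
  by_contra! hcof
  have := hκ.nonempty
  obtain ⟨s, hs, hsc⟩ := Order.exists_cof_eq (α := κ.ord.ToType)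
  rw [cof_toType] at hsc
  obtain ⟨l, hl⟩ := exists_mk_Iio_eq hcof
  obtain ⟨e⟩ := Cardinal.eq.1 (hl.trans hsc.symm)
  obtain ⟨H, hH, hom⟩ := hκ.exists_homogeneous_regressive (ι := Unit)
    (fun _ γ => leastOf {x | ∃ h : x < l, l ≤ γ 0 ∧ γ 0 ≤ e ⟨x, h⟩})
    (fun _ => ⟨1, fun γ γ' h => by simp [h 0 (by simp)]⟩)
    (fun _ γ _ => leastOf_regressive fun x ⟨h, h1, _⟩ => h.trans_le h1)
  have key : ∀ γ, SeqIn H γ → l < γ 0 →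
      ∃ h : leastOf {x | ∃ h : x < l, l ≤ γ 0 ∧ γ 0 ≤ e ⟨x, h⟩} < l,
        γ 0 ≤ e ⟨_, h⟩ := by
    intro γ hγ h
    obtain ⟨y, hy, hle⟩ := hs (γ 0)
    have h1 := leastOf_mem (s := {x | ∃ h : x < l, l ≤ γ 0 ∧ γ 0 ≤ e ⟨x, h⟩})
      ⟨e.symm ⟨y, hy⟩, (e.symm ⟨y, hy⟩).2, h.le, by simpa using hle⟩
    obtain ⟨h1, -, h2⟩ := h1
    exact ⟨h1, h2⟩
  obtain ⟨γ, hγ, hlt⟩ := exists_seqIn hH l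
  obtain ⟨h1, h2⟩ := key γ hγ hlt
  obtain ⟨γ', hγ', hlt'⟩ := exists_seqIn hH (max l (e ⟨_, h1⟩).1)
  obtain ⟨h3, h4⟩ := key γ' hγ' ((le_max_left _ _).trans_lt hlt')
  have h5 := hom () γ' γ hγ' hγ
  simp only [h5] at h4
  exact absurd ((le_max_right _ _).trans_lt hlt') (not_lt.2 h4)

/-- If the strong limit property failed, there would be `κ` distinct subsets of some `l < κ`. The
least place where two of them differ is regressive in the pair, hence constant on an unbounded set;
but three subsets cannot pairwise differ at the same place. -/
theorem IsRamsey.isInaccessible {κ : Cardinal.{u}} (hκ : IsRamsey κ) : κ.IsInaccessible := by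
  refine isInaccessible_def.2 ⟨hκ.aleph0_lt, hκ.isRegular, (aleph0_pos.trans_le hκ.1).ne', ?_⟩
  intro c hc
  by_contra! hle
  have := hκ.nonempty
  obtain ⟨l, hl⟩ := exists_mk_Iio_eq hc
  rw [← hl, ← mk_set] at hle
  have hle' : #κ.ord.ToType ≤ #(Set (Set.Iio l)) := by simpa using hle
  obtain ⟨x⟩ := hle'
  set D : (ℕ → κ.ord.ToType) → Set κ.ord.ToType := fun γ =>
    {i | ∃ h : i < l, l ≤ γ 0 ∧ ¬ (⟨i, h⟩ ∈ x (γ 0) ↔ ⟨i, h⟩ ∈ x (γ 1))} with hD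
  obtain ⟨H, hH, hom⟩ := hκ.exists_homogeneous_regressive (ι := Unit)
    (fun _ γ => leastOf (D γ))
    (fun _ => ⟨2, fun γ γ' h => by simp [hD, h 0 (by simp), h 1 (by simp)]⟩)
    (fun _ γ _ => leastOf_regressive fun x ⟨h, h1, _⟩ => h.trans_le h1)
  obtain ⟨γ, hγ, hlt⟩ := exists_seqIn hH l
  have key : ∀ γ, SeqIn H γ → l < γ 0 → leastOf (D γ) ∈ D γ := by
    intro γ hγ h
    refine leastOf_mem ?_
    by_contra hne
    have h1 : x (γ 0) = x (γ 1) := by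
      ext ⟨i, hi⟩
      by_contra h2
      exact hne ⟨i, hi, h.le, h2⟩
    exact (hγ.1 Nat.zero_lt_one).ne (x.injective h1)
  -- This sequence starts with the first and third terms of `γ`; the pairs `γ 0, γ 1` and `γ 1, γ 2`
  -- come from `γ` and its shift.
  set γ' : ℕ → κ.ord.ToType := seqAppend 1 γ fun i => γ (2 + i)
  have hγ' : SeqIn H γ' := hγ.append (hγ.shift 2) fun i hi => hγ.1 (by omega)
  have h1 := key γ hγ hlt
  have h2 := key _ (hγ.shift 1) (hlt.trans (hγ.1 (by omega)))
  have h3 := key γ' hγ' hlt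
  rw [hom () γ' γ hγ' hγ] at h3
  rw [hom () _ γ (hγ.shift 1) hγ] at h2
  obtain ⟨h, -, h1⟩ := h1
  obtain ⟨_, -, h2⟩ := h2
  obtain ⟨_, -, h3⟩ := h3
  have e0 : γ' 0 = γ 0 := rfl
  have e1 : γ' 1 = γ 2 := rfl
  rw [e0, e1] at h3
  simp only [add_zero, Nat.reduceAdd] at h2
  tauto

/-! ### Good indiscernibles -/

/-- On a Ramsey cardinal there is an unbounded set `H` of indiscernibles for countably many
relations of sequences, allowing two parameters below the least term of the sequence. -/
theorem IsRamsey.exists_indiscernible {κ : Cardinal.{u}} (hκ : IsRamsey κ) {ι : Type*} [Countable ι]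
    (R : ι → κ.ord.ToType → κ.ord.ToType → (ℕ → κ.ord.ToType) → Prop)
    (hR : ∀ k, ∃ d, ∀ ξ ζ, DependsOn (R k ξ ζ) (Set.Iio d)) :
    ∃ H : Set κ.ord.ToType, (∀ x, ∃ y ∈ H, x < y) ∧
      ∀ k ξ ζ γ γ', SeqIn H γ → SeqIn H γ' → ξ < γ 0 → ζ < γ 0 → ξ < γ' 0 → ζ < γ' 0 →
        (R k ξ ζ γ ↔ R k ξ ζ γ') := by
  have := hκ.nonempty
  -- A second point of `κ` is needed as a positive answer that differs from the default value of
  -- `leastOf`.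
  obtain ⟨one, -, hone⟩ := exists_gt_of_mk_eq hκ.1 (I := Set.univ) (by simp) (leastOf ∅)
  choose d hd using hR
  -- A bad pair of parameters tells the sequence from the one starting `d k` places later. The
  -- regressive functions built from it record whether a bad pair exists, its least first parameter,
  -- and then its least second one.
  set bad : ι → (ℕ → κ.ord.ToType) → κ.ord.ToType → κ.ord.ToType → Prop := fun k γ ξ ζ =>
    ξ < γ 0 ∧ ζ < γ 0 ∧ ¬ (R k ξ ζ γ ↔ R k ξ ζ fun i => γ (d k + i)) with hbad
  set F : ι × Fin 3 → (ℕ → κ.ord.ToType) → Set κ.ord.ToType := fun p γ => match p.2 with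
    | 0 => {x | x = one ∧ one < γ 0 ∧ ∃ ξ ζ, bad p.1 γ ξ ζ}
    | 1 => {ξ | ∃ ζ, bad p.1 γ ξ ζ}
    | 2 => {ζ | bad p.1 γ (leastOf {ξ | ∃ ζ, bad p.1 γ ξ ζ}) ζ} with hF
  have hbd : ∀ k γ γ', (∀ i < 2 * d k + 1, γ i = γ' i) → bad k γ = bad k γ' := by
    intro k γ γ' h
    have h1 : ∀ ξ ζ, R k ξ ζ γ = R k ξ ζ γ' := fun ξ ζ => hd k ξ ζ fun i hi =>
      h i (by simp only [Set.mem_Iio] at hi; omega)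
    have h2 : ∀ ξ ζ, (R k ξ ζ fun i => γ (d k + i)) = R k ξ ζ fun i => γ' (d k + i) :=
      fun ξ ζ => hd k ξ ζ fun i hi => h _ (by simp only [Set.mem_Iio] at hi; omega)
    funext ξ ζ
    simp only [hbad, h1, h2, h 0 (by omega)]
  obtain ⟨H, hH, hom⟩ := hκ.exists_homogeneous_regressive (fun p γ => leastOf (F p γ)) (by
      rintro ⟨k, j⟩
      refine ⟨2 * d k + 1, fun γ γ' h => ?_⟩
      fin_cases j <;> simp only [hF, hbd k γ γ' h, h 0 (by simp)]) (by
      rintro ⟨k, j⟩ γ -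
      refine leastOf_regressive ?_
      fin_cases j
      · rintro x ⟨rfl, h, -⟩; exact h
      · rintro x ⟨ζ, h, -⟩; exact h
      · rintro x ⟨-, h, -⟩; exact h)
  -- If a bad pair occurs, homogeneity makes one pair bad for all sequences. Then the truth values
  -- on three consecutive blocks of length `d k` would differ pairwise, the first and third being
  -- made adjacent in `γ'`.
  have hno : ∀ k γ, SeqIn H γ → one < γ 0 → ∀ ξ ζ, ¬ bad k γ ξ ζ := by
    intro k γ hγ h1 ξ₀ ζ₀ hb₀
    have hex : ∀ γ', SeqIn H γ' → one < γ' 0 → ∃ ξ ζ, bad k γ' ξ ζ := by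
      intro γ' hγ' _
      by_contra hcon
      have h2 := hom (k, 0) γ γ' hγ hγ'
      have h3 := leastOf_mem (s := F (k, 0) γ) ⟨one, rfl, h1, ξ₀, ζ₀, hb₀⟩
      rw [h2] at h3
      have h4 := leastOf_empty_le (s := F (k, 0) γ') (fun ⟨x, _, _, h⟩ => hcon h) (leastOf ∅)
      rw [h3.1] at h4
      exact absurd hone (not_lt.2 h4)
    have hbadl : ∀ γ', SeqIn H γ' → one < γ' 0 →
        bad k γ' (leastOf (F (k, 1) γ)) (leastOf (F (k, 2) γ)) := by
      intro γ' hγ' h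
      obtain ⟨ξ, ζ, hb⟩ := hex γ' hγ' h
      have h2 := leastOf_mem (s := F (k, 1) γ') ⟨ξ, ζ, hb⟩
      obtain ⟨ζ', h3⟩ := h2
      have h4 : leastOf (F (k, 2) γ') ∈ F (k, 2) γ' := leastOf_mem ⟨ζ', h3⟩
      rw [hom (k, 1) γ γ' hγ hγ', hom (k, 2) γ γ' hγ hγ']
      exact h4
    set ξ := leastOf (F (k, 1) γ)
    set ζ := leastOf (F (k, 2) γ)
    set γ' : ℕ → κ.ord.ToType := seqAppend (d k) γ fun i => γ (d k + d k + i)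
    have hγ' : SeqIn H γ' := hγ.append (hγ.shift _) fun i hi => hγ.1 (by omega)
    have hγ'0 : γ 0 ≤ γ' 0 := by
      simp only [γ', seqAppend]
      split_ifs
      · exact le_rfl
      · exact hγ.1.monotone (by omega)
    have b1 := (hbadl γ hγ h1).2.2
    have b2 := (hbadl _ (hγ.shift (d k)) (h1.trans_le (hγ.1.monotone (by omega)))).2.2
    have b3 := (hbadl γ' hγ' (h1.trans_le hγ'0)).2.2
    rw [seqAppend_add] at b3
    have e1 : R k ξ ζ γ' = R k ξ ζ γ := hd k ξ ζ fun i hi => seqAppend_of_lt hi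
    simp only [← add_assoc] at b2
    rw [e1] at b3
    tauto
  refine ⟨H ∩ Set.Ioi one, fun x => ?_, ?_⟩
  · obtain ⟨y, hy, hlt⟩ := hH (max x one)
    exact ⟨y, ⟨hy, (le_max_right _ _).trans_lt hlt⟩, (le_max_left _ _).trans_lt hlt⟩
  · intro k ξ ζ γ γ' hγ hγ' h1 h2 h1' h2'
    -- Agreement with a far away third sequence, appended after the first `d k` terms, transfers
    -- truth between arbitrary sequences.
    obtain ⟨γ'', hγ'', hgt⟩ := exists_seqIn hH (max (γ (d k)) (γ' (d k)))
    have aux : ∀ δ, SeqIn (H ∩ Set.Ioi one) δ → ξ < δ 0 → ζ < δ 0 → δ (d k) < γ'' 0 →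
        (R k ξ ζ δ ↔ R k ξ ζ γ'') := by
      intro δ hδ hξ hζ hlt
      set ε := seqAppend (d k) δ γ'' with hε
      have h3 : SeqIn H ε := (hδ.mono Set.inter_subset_left).append hγ'' fun i hi =>
        (hδ.1 hi).trans hlt
      have h4 : δ 0 ≤ ε 0 := by
        simp only [hε, seqAppend]
        split_ifs with h
        · exact le_rfl
        · rw [Nat.zero_sub]
          exact (hδ.1.monotone (Nat.zero_le (d k))).trans hlt.le
      have h5 := hno k ε h3 ((hδ.2 0).2.trans_le h4) ξ ζ
      have e1 : R k ξ ζ ε = R k ξ ζ δ := hd k ξ ζ fun i hi => seqAppend_of_lt hi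
      simp only [hbad, hε, seqAppend_add] at h5
      rw [← hε, e1] at h5
      by_contra h6
      exact h5 ⟨hξ.trans_le h4, hζ.trans_le h4, h6⟩
    exact (aux γ hγ h1 h2 ((le_max_left _ _).trans_lt hgt)).trans
      (aux γ' hγ' h1' h2' ((le_max_right _ _).trans_lt hgt)).symm

/-! ### Cardinal arithmetic below an inaccessible cardinal -/

/-- The graph of a function from a set of size `c` is a subset of size less than `κ` of a set of
size `κ`, and a regular strong limit has only `κ` such subsets. -/
theorem power_le_of_isInaccessible {κ : Cardinal.{u}} (hκ : κ.IsInaccessible) {c : Cardinal.{u}}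
    (hc : c < κ) : κ ^ c ≤ κ := by
  induction c using Cardinal.inductionOn with | mk ι => ?_
  have h0 : #(ι × κ.ord.ToType) ≤ κ := by
    rw [mk_prod, Cardinal.lift_id, Cardinal.lift_id, mk_toType, card_ord]
    exact mul_le_of_le hκ.aleph0_lt.le hc.le le_rfl
  rcases isEmpty_or_nonempty ι with he | he
  · simpa using one_lt_aleph0.le.trans hκ.aleph0_lt.le
  have h1 : #(ι × κ.ord.ToType) = κ := h0.antisymm <| by
    rw [mk_prod, Cardinal.lift_id, Cardinal.lift_id, mk_toType, card_ord]
    exact Cardinal.le_mul_left (mk_ne_zero ι)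
  have h2 := mk_subset_mk_lt_cof (α := ι × κ.ord.ToType) (by
    rw [h1]; exact hκ.isStrongLimit.isStrongPrelimit)
  rw [h1] at h2
  have h3 : κ ^ #ι = #(ι → κ.ord.ToType) := by simp
  rw [h3]
  refine le_trans ?_ h2.le
  refine mk_le_of_injective (f := fun f => ⟨Set.range fun i => (i, f i), ?_⟩) ?_
  · rw [hκ.isRegular.cof_ord]
    exact mk_range_le.trans_lt hc
  · intro f g hfg
    have h4 : (Set.range fun i => (i, f i)) = Set.range fun i => (i, g i) := congrArg Subtype.val hfg
    funext i
    have h5 : (i, f i) ∈ Set.range fun i => (i, g i) := h4 ▸ ⟨i, rfl⟩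
    obtain ⟨j, hj⟩ := h5
    simp only [Prod.mk.injEq] at hj
    rw [← hj.2, hj.1]

theorem card_lt_of_rank_lt {κ : Cardinal.{u}} (hκ : κ.IsInaccessible) {x : ZFSet.{u}}
    (hx : x.rank < κ.ord) : x.card < κ := by
  have h1 : x.card ≤ preBeth x.rank := by
    rw [← ZFSet.card_vonNeumann]
    exact ZFSet.card_mono (ZFSet.subset_vonNeumann_self x)
  have h2 := preBeth_strictMono hx
  rw [hκ.preBeth_ord] at h2
  exact h1.trans_lt h2

theorem rank_range_lt {κ : Cardinal.{u}} (hκ : κ.IsRegular) {ι : Type u} (hι : #ι < κ)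
    {f : ι → ZFSet.{u}} (hf : ∀ i, (f i).rank < κ.ord) : (ZFSet.range f).rank < κ.ord := by
  rw [ZFSet.rank_range]
  refine Ordinal.iSup_lt_of_lt_cof (by rwa [hκ.cof_ord]) fun i => ?_
  exact (isSuccLimit_ord hκ.1).succ_lt (hf i)

theorem rank_pair_lt {o : Ordinal.{u}} (ho : Order.IsSuccLimit o) {x y : ZFSet.{u}}
    (hx : x.rank < o) (hy : y.rank < o) : (ZFSet.pair x y).rank < o := by
  simp only [ZFSet.pair, ZFSet.rank_pair, ZFSet.rank_singleton, max_lt_iff]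
  exact ⟨ho.succ_lt (ho.succ_lt hx), ho.succ_lt (max_lt (ho.succ_lt hx) (ho.succ_lt hy))⟩

theorem exists_range_eq {κ : Cardinal.{u}} {x : ZFSet.{u}} (hx : x.card < κ) :
    ∃ (l : κ.ord.ToType) (g : Set.Iio l → ZFSet.{u}), ZFSet.range g = x := by
  obtain ⟨l, hl⟩ := exists_mk_Iio_eq hx
  obtain ⟨e⟩ := Cardinal.eq.1 hl
  refine ⟨l, fun i => ((equivShrink x).symm (e i)).1, ?_⟩
  ext y
  rw [ZFSet.mem_range]
  constructor
  · rintro ⟨i, rfl⟩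
    exact ((equivShrink x).symm (e i)).2
  · intro hy
    exact ⟨e.symm (equivShrink x ⟨y, hy⟩), by simp⟩

/-! ### Definable functions of indiscernibles -/

/-- The ordinal below `κ` with index `ξ`, as a set. -/
def oz {κ : Cardinal.{u}} (ξ : κ.ord.ToType) : ZFSet.{u} :=
  ((ToType.mk.symm ξ : Set.Iio κ.ord) : Ordinal.{u}).toZFSet

/-- The sequence `ξ, γ 0, γ 1, …`. -/
def seqCons {O : Type*} (ξ : O) (γ : ℕ → O) : ℕ → O := seqAppend 1 (fun _ => ξ) γ

/-- The operations from which the functions of indiscernibles of one level are built. -/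
inductive Sym (O : Type u) : Type u
  | prev (ζ : O)
  | shift (ζ : O)
  | lam (ζ : O)
  | graph
  | var
  | op (k : ℕ) (b : Bool)
  | set (l : O)

/-- The index type of the arguments of an operation. -/
def Sym.Args {O : Type u} [LT O] : Sym O → Type u
  | .op _ _ => ULift ℕ
  | .set l => {x : O // x < l}
  | _ => PEmpty

theorem mk_sym_le {κ : Cardinal.{u}} (hκ : ℵ₀ ≤ κ) [Nonempty κ.ord.ToType] :
    #(Sym κ.ord.ToType) ≤ κ := by
  have z := (inferInstance : Nonempty κ.ord.ToType).some
  have h : #(ULift.{u} (ℕ × ℕ) × κ.ord.ToType) ≤ κ := by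
    rw [mk_prod, Cardinal.lift_id, Cardinal.lift_id, mk_toType, card_ord]
    refine mul_le_of_le hκ ?_ le_rfl
    exact (mk_le_aleph0 (α := ULift.{u} (ℕ × ℕ))).trans hκ
  refine le_trans (mk_le_of_injective (f := fun s : Sym κ.ord.ToType => match s with
    | .prev ζ => ((⟨(0, 0)⟩, ζ) : ULift.{u} (ℕ × ℕ) × κ.ord.ToType)
    | .shift ζ => (⟨(1, 0)⟩, ζ)
    | .lam ζ => (⟨(2, 0)⟩, ζ)
    | .graph => (⟨(3, 0)⟩, z)
    | .var => (⟨(4, 0)⟩, z)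
    | .op k false => (⟨(5, k)⟩, z)
    | .op k true => (⟨(6, k)⟩, z)
    | .set l => (⟨(7, 0)⟩, l)) ?_) h
  intro s t hst
  rcases s with _ | _ | _ | _ | _ | ⟨_, _ | _⟩ | _ <;>
    rcases t with _ | _ | _ | _ | _ | ⟨_, _ | _⟩ | _ <;> simp_all

/-- Terms are well-founded trees with `κ` many labels and fewer than `κ` children at each node, so
`κ ^ c ≤ κ` for `c < κ` bounds their number. This keeps each level at size `κ` despite its closure
under short sequences. -/
theorem mk_wtype_sym_le {κ : Cardinal.{u}} (hκ : κ.IsInaccessible) [Nonempty κ.ord.ToType] :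
    #(WType (Sym.Args (O := κ.ord.ToType))) ≤ κ := by
  refine WType.cardinalMk_le_of_le ?_
  have h : ∀ a : Sym κ.ord.ToType, κ ^ #a.Args ≤ κ := by
    intro a
    refine power_le_of_isInaccessible hκ ?_
    cases a with
    | op k b => simpa [Sym.Args] using hκ.aleph0_lt
    | set l => simpa [Sym.Args] using! mk_Iio_lt l
    | _ => simpa [Sym.Args] using hκ.pos
  refine (sum_le_sum _ (fun _ => κ) h).trans ?_
  rw [sum_const']
  exact mul_le_of_le hκ.aleph0_lt.le (mk_sym_le hκ.aleph0_lt.le) le_rfl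

section Eval

/-- The set of all `f ξ` with `ξ < a`. -/
def rangeBelow {O : Type u} [LT O] (a : O) (f : {ξ : O // ξ < a} → ZFSet.{u}) : ZFSet.{u} :=
  ZFSet.range f

open Classical in
/-- A set in `V_κ` with the property `P`, or else the answer `{∅}` or `∅` to the question whether
there is one. -/
def skolemValue (κ : Cardinal.{u}) (b : Bool) (P : ZFSet.{u} → Prop) : ZFSet.{u} :=
  if h : ∃ w : ZFSet.{u}, w.rank < κ.ord ∧ P w then bif b then h.choose else {∅} else ∅

theorem skolemValue_spec {κ : Cardinal.{u}} {P : ZFSet.{u} → Prop}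
    (h : ∃ w : ZFSet.{u}, w.rank < κ.ord ∧ P w) : P (skolemValue κ true P) := by
  rw [skolemValue, dif_pos h]
  exact h.choose_spec.2

theorem skolemValue_false {κ : Cardinal.{u}} {P : ZFSet.{u} → Prop} :
    (∃ w : ZFSet.{u}, w.rank < κ.ord ∧ P w) ↔ skolemValue κ false P = {∅} := by
  rw [skolemValue]
  split_ifs with h
  · exact iff_of_true h rfl
  · refine iff_of_false h fun h' => ?_
    have h2 : (∅ : ZFSet.{u}) ∈ ({∅} : ZFSet.{u}) := ZFSet.mem_singleton.2 rfl
    rw [← h'] at h2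
    exact ZFSet.notMem_empty _ h2

theorem rank_skolemValue_lt {κ : Cardinal.{u}} (hκ : κ.IsRegular) (b : Bool)
    (P : ZFSet.{u} → Prop) : (skolemValue κ b P).rank < κ.ord := by
  rw [skolemValue]
  have h1 : (1 : Ordinal) < κ.ord := by
    simpa using (isSuccLimit_ord hκ.1).succ_lt hκ.ord_pos
  split_ifs with h
  · cases b
    · simpa using h1
    · exact h.choose_spec.1
  · simpa using hκ.ord_pos

variable {κ : Cardinal.{u}} (P : ℕ → ZFSet.{u} → (ℕ → ZFSet.{u}) → Prop)

/-- The value of the operation `a` on given arguments, over the functions `T` of the previous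
level. -/
def Sym.eval (T : κ.ord.ToType → (ℕ → κ.ord.ToType) → ZFSet.{u}) :
    (a : Sym κ.ord.ToType) → (a.Args → (ℕ → κ.ord.ToType) → ZFSet.{u}) →
      (ℕ → κ.ord.ToType) → ZFSet.{u}
  | .prev ζ, _ => T ζ
  | .shift ζ, _ => fun γ => T ζ fun i => γ (1 + i)
  | .lam ζ, _ => fun γ => rangeBelow (γ 0) fun ξ => ZFSet.pair (oz ξ.1) (T ζ (seqCons ξ.1 γ))
  | .graph, _ => fun γ => rangeBelow (γ 0) fun ξ => ZFSet.pair (oz ξ.1) (T ξ γ)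
  | .var, _ => fun γ => oz (γ 0)
  | .op k b, g => fun γ => skolemValue κ b fun w => P k w fun i => g ⟨i⟩ γ
  | .set l, g => fun γ => rangeBelow l fun i => g i γ

/-- The functions of level `n`, enumerated by means of an enumeration `dec` of all terms. -/
def levelFun (dec : κ.ord.ToType → WType (Sym.Args (O := κ.ord.ToType))) :
    ℕ → κ.ord.ToType → (ℕ → κ.ord.ToType) → ZFSet.{u}
  -- Level zero consists of the ordinal constants, each with itself as index, so indiscernibility
  -- against this level is indiscernibility with ordinal parameters.
  | 0, ξ => fun _ => oz ξ
  | n + 1, ξ => WType.elim _ (fun s => Sym.eval P (levelFun dec n) s.1 s.2) (dec ξ)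

variable {P}

theorem rank_oz_lt (ξ : κ.ord.ToType) : (oz ξ).rank < κ.ord := by
  rw [oz, rank_toZFSet]
  exact (ToType.mk.symm ξ).2

theorem mk_Iio_lt_of_ord (l : κ.ord.ToType) : #(Set.Iio l) < κ := by
  simpa using mk_Iio_lt l

theorem rank_eval_lt (hκ : κ.IsRegular) {T : κ.ord.ToType → (ℕ → κ.ord.ToType) → ZFSet.{u}}
    (hT : ∀ ξ γ, (T ξ γ).rank < κ.ord) (a : Sym κ.ord.ToType)
    (g : a.Args → (ℕ → κ.ord.ToType) → ZFSet.{u}) (γ : ℕ → κ.ord.ToType)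
    (hg : ∀ b, (g b γ).rank < κ.ord) : (Sym.eval P T a g γ).rank < κ.ord := by
  have hlim := isSuccLimit_ord hκ.1
  cases a with
  | prev ζ => exact hT _ _
  | shift ζ => exact hT _ _
  | lam ζ =>
    exact rank_range_lt hκ (mk_Iio_lt_of_ord _) fun i => rank_pair_lt hlim (rank_oz_lt _) (hT _ _)
  | graph =>
    exact rank_range_lt hκ (mk_Iio_lt_of_ord _) fun i => rank_pair_lt hlim (rank_oz_lt _) (hT _ _)
  | var => exact rank_oz_lt _
  | op k b => exact rank_skolemValue_lt hκ _ _
  | set l => exact rank_range_lt hκ (mk_Iio_lt_of_ord _) fun i => hg i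

/-- Only the shift and the reading of `γ 0` can require an additional argument, while operations
with arguments from the same level require none. So the arity grows by one per level, however deep
the terms. -/
theorem eval_congr {n : ℕ} {T : κ.ord.ToType → (ℕ → κ.ord.ToType) → ZFSet.{u}}
    (hT : ∀ ξ, DependsOn (T ξ) (Set.Iio n)) (a : Sym κ.ord.ToType)
    (g : a.Args → (ℕ → κ.ord.ToType) → ZFSet.{u}) {γ γ' : ℕ → κ.ord.ToType}
    (h : ∀ i < n + 1, γ i = γ' i) (hg : ∀ b, g b γ = g b γ') :
    Sym.eval P T a g γ = Sym.eval P T a g γ' := by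
  have h0 : γ 0 = γ' 0 := h 0 (Nat.succ_pos n)
  have hn : ∀ ξ, T ξ γ = T ξ γ' := fun ξ => hT ξ fun i hi => h i (Nat.lt_succ_of_lt hi)
  cases a with
  | prev ζ => exact hn ζ
  | shift ζ =>
    refine hT ζ fun i hi => h _ ?_
    simp only [Set.mem_Iio] at hi
    omega
  | lam ζ =>
    have h1 : ∀ ξ, T ζ (seqCons ξ γ) = T ζ (seqCons ξ γ') := by
      intro ξ
      refine hT ζ fun i hi => ?_
      simp only [Set.mem_Iio] at hi
      simp only [seqCons, seqAppend]
      split_ifs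
      · rfl
      · exact h _ (by omega)
    simp only [Sym.eval, h1]
    rw [h0]
  | graph =>
    simp only [Sym.eval, hn]
    rw [h0]
  | var => simp only [Sym.eval, h0]
  | op k b =>
    have h1 : (fun i : ℕ => g ⟨i⟩ γ) = fun i => g ⟨i⟩ γ' := funext fun i => hg _
    simp only [Sym.eval]
    rw [h1]
  | set l =>
    have h1 : (fun i : {x // x < l} => g i γ) = fun i => g i γ' := funext fun i => hg _
    exact congrArg (rangeBelow l) h1

theorem rank_levelFun_lt (hκ : κ.IsRegular)
    (dec : κ.ord.ToType → WType (Sym.Args (O := κ.ord.ToType))) (n : ℕ) (ξ : κ.ord.ToType)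
    (γ : ℕ → κ.ord.ToType) : (levelFun P dec n ξ γ).rank < κ.ord := by
  induction n generalizing ξ γ with
  | zero => exact rank_oz_lt ξ
  | succ n ih =>
    rw [levelFun]
    generalize dec ξ = t
    induction t generalizing γ with
    | mk a g iht => exact rank_eval_lt hκ ih a _ γ fun b => iht b γ

theorem dependsOn_levelFun (dec : κ.ord.ToType → WType (Sym.Args (O := κ.ord.ToType))) (n : ℕ)
    (ξ : κ.ord.ToType) : DependsOn (levelFun P dec n ξ) (Set.Iio n) := by
  induction n generalizing ξ with
  | zero => intro γ γ' _; rfl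
  | succ n ih =>
    rw [levelFun]
    generalize dec ξ = t
    induction t with
    | mk a g iht =>
      intro γ γ' h
      exact eval_congr ih a _ h fun b => iht b h

end Eval

/-! ### Systems of functions of indiscernibles -/

/-- A system of functions of indiscernibles: an unbounded set `H ⊆ κ` and, for each level `n`, a
family `T n` of `κ` many functions from sequences to `V_κ` that has the listed closure properties,
so that the elements of `H` are indiscernible for these functions. -/
structure System (κ : Cardinal.{u}) (Q : Set (ZFSet.{u} → (ℕ → ZFSet.{u}) → Prop)) where
  H : Set κ.ord.ToType
  T : ℕ → κ.ord.ToType → (ℕ → κ.ord.ToType) → ZFSet.{u}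
  unbounded : ∀ x, ∃ y ∈ H, x < y
  rank_lt : ∀ n ξ γ, (T n ξ γ).rank < κ.ord
  zero : ∀ ξ γ, T 0 ξ γ = oz ξ
  prev : ∀ n ζ, ∃ ξ, T (n + 1) ξ = T n ζ
  shift : ∀ n ζ, ∃ ξ, T (n + 1) ξ = fun γ => T n ζ fun i => γ (1 + i)
  -- Abstracting the first argument produces the functions on `κ` that represent the elements of the
  -- ultrapower.
  lam : ∀ n ζ, ∃ ξ, T (n + 1) ξ = fun γ => rangeBelow (γ 0) fun ξ =>
    ZFSet.pair (oz ξ.1) (T n ζ (seqCons ξ.1 γ))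
  -- A level enumerates the previous one up to `γ 0`, which is what makes the members of the
  -- elementary chain elements of the model.
  graph : ∀ n, ∃ ξ, T (n + 1) ξ = fun γ => rangeBelow (γ 0) fun ξ =>
    ZFSet.pair (oz ξ.1) (T n ξ γ)
  var : ∀ n, ∃ ξ, T (n + 1) ξ = fun γ => oz (γ 0)
  skolem : ∀ n, ∀ P ∈ Q, ∀ g : ℕ → κ.ord.ToType, ∃ ξ, ∀ γ,
    (∃ w : ZFSet.{u}, w.rank < κ.ord ∧ P w fun i => T (n + 1) (g i) γ) →
      P (T (n + 1) ξ γ) fun i => T (n + 1) (g i) γ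
  test : ∀ n, ∀ P ∈ Q, ∀ g : ℕ → κ.ord.ToType, ∃ ξ, ∀ γ,
    ((∃ w : ZFSet.{u}, w.rank < κ.ord ∧ P w fun i => T (n + 1) (g i) γ) ↔ T (n + 1) ξ γ = {∅})
  set : ∀ n (l : κ.ord.ToType) (g : {x // x < l} → κ.ord.ToType), ∃ ξ,
    T (n + 1) ξ = fun γ => rangeBelow l fun i => T (n + 1) (g i) γ
  indisc_mem : ∀ n m ξ ζ γ γ', SeqIn H γ → SeqIn H γ' → ξ < γ 0 → ζ < γ 0 → ξ < γ' 0 → ζ < γ' 0 →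
    (T n ξ γ ∈ T m ζ γ ↔ T n ξ γ' ∈ T m ζ γ')
  indisc_eq : ∀ n m ξ ζ γ γ', SeqIn H γ → SeqIn H γ' → ξ < γ 0 → ζ < γ 0 → ξ < γ' 0 → ζ < γ' 0 →
    (T n ξ γ = T m ζ γ ↔ T n ξ γ' = T m ζ γ')

/-- Indiscernibility is needed for `κ` many functions, but only pairs of levels are treated as
relations, and there are countably many; the functions enter through their indices as parameters
below the first indiscernible. -/
theorem IsRamsey.exists_system {κ : Cardinal.{u}} (hκ : IsRamsey κ)
    (Q : Set (ZFSet.{u} → (ℕ → ZFSet.{u}) → Prop)) (hQ : Q.Countable) : Nonempty (System κ Q) := by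
  have := hκ.nonempty
  have hin := hκ.isInaccessible
  obtain ⟨P, hP⟩ : ∃ P : ℕ → ZFSet.{u} → (ℕ → ZFSet.{u}) → Prop, Q ⊆ Set.range P := by
    rcases Q.eq_empty_or_nonempty with rfl | hne
    · exact ⟨fun _ _ _ => True, Set.empty_subset _⟩
    · obtain ⟨P, hP⟩ := hQ.exists_eq_range hne
      exact ⟨P, hP.le⟩
  obtain ⟨dec, hdec⟩ : ∃ dec : κ.ord.ToType → WType (Sym.Args (O := κ.ord.ToType)),
      Function.Surjective dec := by
    have h1 : #(WType (Sym.Args (O := κ.ord.ToType))) ≤ #κ.ord.ToType := by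
      simpa using mk_wtype_sym_le hin
    obtain ⟨e⟩ := h1
    have : Nonempty (WType (Sym.Args (O := κ.ord.ToType))) := ⟨⟨.var, fun b => PEmpty.elim b⟩⟩
    exact ⟨_, Function.invFun_surjective e.injective⟩
  set T := levelFun P dec with hT
  have hnode : ∀ n (a : Sym κ.ord.ToType) (g : a.Args → κ.ord.ToType), ∃ ξ,
      T (n + 1) ξ = Sym.eval P (T n) a fun b => T (n + 1) (g b) := by
    intro n a g
    obtain ⟨ξ, hξ⟩ := hdec ⟨a, fun b => dec (g b)⟩
    exact ⟨ξ, by simp only [hT, levelFun, hξ]; rfl⟩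
  have hno : ∀ n (a : Sym κ.ord.ToType) (_ : IsEmpty a.Args),
      ∃ ξ, T (n + 1) ξ = Sym.eval P (T n) a isEmptyElim := by
    intro n a _
    obtain ⟨ξ, hξ⟩ := hnode n a isEmptyElim
    exact ⟨ξ, hξ.trans (congrArg _ (Subsingleton.elim _ _))⟩
  obtain ⟨H, hH, hind⟩ := hκ.exists_indiscernible (ι := (ℕ × ℕ) × Bool)
    (fun k ξ ζ γ => if k.2 then T k.1.1 ξ γ ∈ T k.1.2 ζ γ else T k.1.1 ξ γ = T k.1.2 ζ γ) (by
      rintro ⟨⟨n, m⟩, b⟩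
      refine ⟨max n m, fun ξ ζ γ γ' h => ?_⟩
      have h1 : T n ξ γ = T n ξ γ' := dependsOn_levelFun dec n ξ fun i hi =>
        h i (lt_of_lt_of_le (Set.mem_Iio.1 hi) (le_max_left n m))
      have h2 : T m ζ γ = T m ζ γ' := dependsOn_levelFun dec m ζ fun i hi =>
        h i (lt_of_lt_of_le (Set.mem_Iio.1 hi) (le_max_right n m))
      simp only [h1, h2])
  have hpe : IsEmpty PEmpty.{u + 1} := inferInstance
  exact ⟨{
    H := H
    T := T
    unbounded := hH
    rank_lt := rank_levelFun_lt hin.isRegular dec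
    zero := fun _ _ => rfl
    prev := fun n ζ => hno n (.prev ζ) hpe
    shift := fun n ζ => hno n (.shift ζ) hpe
    lam := fun n ζ => hno n (.lam ζ) hpe
    graph := fun n => hno n .graph hpe
    var := fun n => hno n .var hpe
    skolem := by
      intro n p hp g
      obtain ⟨k, rfl⟩ := hP hp
      obtain ⟨ξ, hξ⟩ := hnode n (.op k true) fun b => g b.down
      refine ⟨ξ, fun γ h => ?_⟩
      rw [hξ]
      exact skolemValue_spec h
    test := by
      intro n p hp g
      obtain ⟨k, rfl⟩ := hP hp
      obtain ⟨ξ, hξ⟩ := hnode n (.op k false) fun b => g b.down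
      refine ⟨ξ, fun γ => ?_⟩
      rw [hξ]
      exact skolemValue_false
    set := fun n l g => hnode n (.set l) g
    indisc_mem := fun n m => hind ((n, m), true)
    indisc_eq := fun n m => hind ((n, m), false) }⟩

open Filter

set_option linter.unusedSectionVars false

/-! ### The indices of ordinals below `κ` -/

section Oz

variable {κ : Cardinal.{u}}

theorem oz_mem_oz {ξ ζ : κ.ord.ToType} : oz ξ ∈ oz ζ ↔ ξ < ζ := by
  rw [oz, oz, toZFSet_mem_toZFSet_iff, Subtype.coe_lt_coe, OrderIso.lt_iff_lt]

theorem oz_injective : Function.Injective (oz (κ := κ)) := by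
  intro ξ ζ h
  exact ToType.mk.symm.injective (Subtype.ext (toZFSet_injective h))

theorem mem_kset {x : ZFSet.{u}} : x ∈ kset κ ↔ ∃ ξ : κ.ord.ToType, oz ξ = x := by
  rw [kset, mem_toZFSet_iff]
  constructor
  · rintro ⟨a, ha, rfl⟩
    exact ⟨ToType.mk ⟨a, ha⟩, by simp [oz]⟩
  · rintro ⟨ξ, rfl⟩
    exact ⟨_, (ToType.mk.symm ξ).2, rfl⟩

theorem mem_oz {x : ZFSet.{u}} {ζ : κ.ord.ToType} : x ∈ oz ζ ↔ ∃ ξ < ζ, oz ξ = x := by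
  constructor
  · intro h
    obtain ⟨a, ha, rfl⟩ := mem_toZFSet_iff.1 h
    obtain ⟨ξ, hξ⟩ := mem_kset.1 (mem_toZFSet_iff.2 ⟨a, ha.trans (ToType.mk.symm ζ).2, rfl⟩)
    exact ⟨ξ, by rw [← oz_mem_oz, hξ]; exact h, hξ⟩
  · rintro ⟨ξ, h, rfl⟩
    exact oz_mem_oz.2 h

theorem rank_oz_lt_rank_oz {ξ ζ : κ.ord.ToType} : (oz ξ).rank < (oz ζ).rank ↔ ξ < ζ := by
  rw [← oz_mem_oz, oz, oz, rank_toZFSet, rank_toZFSet, toZFSet_mem_toZFSet_iff]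

theorem rank_lt_iff_exists {x : ZFSet.{u}} :
    x.rank < κ.ord ↔ ∃ ξ : κ.ord.ToType, (oz ξ).rank = x.rank := by
  constructor
  · intro h
    exact ⟨ToType.mk ⟨_, h⟩, by simp [oz]⟩
  · rintro ⟨ξ, h⟩
    exact h ▸ rank_oz_lt ξ

theorem mem_rangeBelow {a : κ.ord.ToType} {f : {ξ // ξ < a} → ZFSet.{u}} {x : ZFSet.{u}} :
    x ∈ rangeBelow a f ↔ ∃ ξ, f ξ = x := ZFSet.mem_range

end Oz

/-! ### Functions modulo eventual equality along the indiscernibles -/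

/-- The predicate on a tuple that is given by a quaternary relation. -/
def relPred (p : ZFSet.{u} → ZFSet.{u} → ZFSet.{u} → ZFSet.{u} → Prop) :
    ZFSet.{u} → (ℕ → ZFSet.{u}) → Prop := fun w x => p w (x 0) (x 1) (x 2)

/-- The graph of a ternary operation. -/
def opPred (G : ZFSet.{u} → ZFSet.{u} → ZFSet.{u} → ZFSet.{u}) :
    ZFSet.{u} → (ℕ → ZFSet.{u}) → Prop := fun w x => w = G (x 0) (x 1) (x 2)

/-- The functions that are used to represent elements of the extended universe. -/
abbrev Fn (κ : Cardinal.{u}) : Type (u + 1) := (ℕ → κ.ord.ToType) → ZFSet.{u}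

/-- The sequence `F, G, K, K, …`. -/
def triple {α : Type*} (F G K : α) : ℕ → α
  | 0 => F
  | 1 => G
  | _ => K

/-- The function `F`, shifted by one indiscernible. -/
def sh {κ : Cardinal.{u}} (F : Fn κ) : Fn κ := fun γ => F fun i => γ (1 + i)

/-- The `i`-th indiscernible. -/
def vr {κ : Cardinal.{u}} (i : ℕ) : Fn κ := fun γ => oz (γ i)

instance nonempty_toType_of_isInaccessible {κ : Cardinal.{u}} [hκ : Fact κ.IsInaccessible] :
    Nonempty κ.ord.ToType := by
  rw [← mk_ne_zero_iff, mk_toType, card_ord]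
  exact hκ.out.ne_zero

theorem exists_forall_le_of_mk_lt {κ : Cardinal.{u}} [hκ : Fact κ.IsInaccessible] {ι : Type u}
    (hι : #ι < κ) (f : ι → κ.ord.ToType) : ∃ δ, ∀ i, f i ≤ δ := by
  have h : (ZFSet.range fun i => oz (f i)).rank < κ.ord :=
    rank_range_lt hκ.out.isRegular hι fun i => rank_oz_lt _
  obtain ⟨δ, hδ⟩ := rank_lt_iff_exists.1 h
  refine ⟨δ, fun i => ?_⟩
  have h1 : (oz (f i)).rank < (oz δ).rank := by
    rw [hδ]
    exact ZFSet.rank_lt_of_mem (ZFSet.mem_range_self i)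
  exact (rank_oz_lt_rank_oz.1 h1).le

namespace System

variable {κ : Cardinal.{u}} [hκ : Fact κ.IsInaccessible]
  {Q : Set (ZFSet.{u} → (ℕ → ZFSet.{u}) → Prop)} (S : System κ Q)

/-- The functions of level `n`. -/
def lev (n : ℕ) : Set (Fn κ) := Set.range (S.T (n + 1))

/-- The functions of all levels. -/
def Fs : Set (Fn κ) := {F | ∃ n, F ∈ S.lev n}

/-- The filter of all sets of sequences that contain all sequences of indiscernibles which are above
some ordinal below `κ`. -/
def ev : Filter (ℕ → κ.ord.ToType) where
  sets := {s | ∃ δ, ∀ γ, SeqIn S.H γ → δ < γ 0 → γ ∈ s}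
  univ_sets := ⟨hκ.1 |> fun _ => Classical.arbitrary _, fun _ _ _ => trivial⟩
  sets_of_superset := fun ⟨δ, h⟩ hst => ⟨δ, fun γ h1 h2 => hst (h γ h1 h2)⟩
  inter_sets := fun ⟨δ, h⟩ ⟨δ', h'⟩ => ⟨max δ δ', fun γ h1 h2 =>
    ⟨h γ h1 ((le_max_left _ _).trans_lt h2), h' γ h1 ((le_max_right _ _).trans_lt h2)⟩⟩

variable {S}

theorem ev_iff {P : (ℕ → κ.ord.ToType) → Prop} :
    (∀ᶠ γ in S.ev, P γ) ↔ ∃ δ, ∀ γ, SeqIn S.H γ → δ < γ 0 → P γ := Iff.rfl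

instance ev_neBot : S.ev.NeBot := by
  refine ⟨fun h => ?_⟩
  have h1 : ∀ᶠ γ in S.ev, False := by rw [h]; exact mem_bot
  obtain ⟨δ, hδ⟩ := ev_iff.1 h1
  obtain ⟨γ, hγ, hlt⟩ := exists_seqIn S.unbounded δ
  exact hδ γ hγ hlt

theorem ev_strictMono : ∀ᶠ γ in S.ev, StrictMono γ :=
  ev_iff.2 ⟨Classical.arbitrary _, fun _ h _ => h.1⟩

theorem ev_gt (δ : κ.ord.ToType) : ∀ᶠ γ in S.ev, δ < γ 0 := ev_iff.2 ⟨δ, fun _ _ h => h⟩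

/-- By regularity, fewer than `κ` thresholds have a common bound, so the filter is `κ`-complete. -/
theorem ev_forall {ι : Type u} (hι : #ι < κ) {P : ι → (ℕ → κ.ord.ToType) → Prop}
    (h : ∀ i, ∀ᶠ γ in S.ev, P i γ) : ∀ᶠ γ in S.ev, ∀ i, P i γ := by
  simp only [ev_iff] at h
  choose f hf using h
  obtain ⟨δ, hδ⟩ := exists_forall_le_of_mk_lt hι f
  exact ev_iff.2 ⟨δ, fun γ h1 h2 i => hf i γ h1 ((hδ i).trans_lt h2)⟩

/-- Dropping the first term keeps a sequence in `H` and raises its start. All elementary embeddings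
come from this invariance. -/
theorem ev_shift {P : (ℕ → κ.ord.ToType) → Prop} (h : ∀ᶠ γ in S.ev, P γ) :
    ∀ᶠ γ in S.ev, P fun i => γ (1 + i) := by
  obtain ⟨δ, hδ⟩ := ev_iff.1 h
  exact ev_iff.2 ⟨δ, fun γ h1 h2 => hδ _ (h1.shift 1) (h2.trans (h1.1 Nat.zero_lt_one))⟩

/-! ### Closure properties of the levels -/

theorem lev_subset_succ (n : ℕ) : S.lev n ⊆ S.lev (n + 1) := by
  rintro _ ⟨ζ, rfl⟩
  exact S.prev (n + 1) ζ

theorem lev_mono : Monotone S.lev := monotone_nat_of_le_succ lev_subset_succ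

theorem lev_subset_Fs {n : ℕ} : S.lev n ⊆ S.Fs := fun _ h => ⟨n, h⟩

theorem exists_lev_pair {F G : Fn κ} (hF : F ∈ S.Fs) (hG : G ∈ S.Fs) :
    ∃ n, F ∈ S.lev n ∧ G ∈ S.lev n := by
  obtain ⟨n, hn⟩ := hF
  obtain ⟨m, hm⟩ := hG
  exact ⟨max n m, lev_mono (le_max_left _ _) hn, lev_mono (le_max_right _ _) hm⟩

theorem exists_lev_triple {F G K : Fn κ} (hF : F ∈ S.Fs) (hG : G ∈ S.Fs) (hK : K ∈ S.Fs) :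
    ∃ n, F ∈ S.lev n ∧ G ∈ S.lev n ∧ K ∈ S.lev n := by
  obtain ⟨n, h1, h2⟩ := exists_lev_pair hF hG
  obtain ⟨m, hm⟩ := hK
  exact ⟨max n m, lev_mono (le_max_left _ _) h1, lev_mono (le_max_left _ _) h2,
    lev_mono (le_max_right _ _) hm⟩

theorem rank_Fn_lt {F : Fn κ} (hF : F ∈ S.Fs) (γ : ℕ → κ.ord.ToType) : (F γ).rank < κ.ord := by
  obtain ⟨n, ξ, rfl⟩ := hF
  exact S.rank_lt _ _ _

theorem sh_mem {n : ℕ} {F : Fn κ} (hF : F ∈ S.lev n) : sh F ∈ S.lev (n + 1) := by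
  obtain ⟨ζ, rfl⟩ := hF
  exact S.shift (n + 1) ζ

theorem sh_mem_Fs {F : Fn κ} (hF : F ∈ S.Fs) : sh F ∈ S.Fs :=
  hF.elim fun _ h => ⟨_, sh_mem h⟩

theorem vr_mem (i : ℕ) : vr i ∈ S.lev i := by
  induction i with
  | zero => exact S.var 0
  | succ i ih =>
    have := sh_mem ih
    convert this using 1
    funext γ
    simp [vr, sh, add_comm]

theorem vr_mem_Fs (i : ℕ) : vr i ∈ S.Fs := ⟨i, vr_mem i⟩

theorem set_mem {n : ℕ} (l : κ.ord.ToType) (g : {x // x < l} → Fn κ) (hg : ∀ i, g i ∈ S.lev n) :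
    (fun γ => rangeBelow l fun i => g i γ) ∈ S.lev n := by
  choose a ha using hg
  obtain ⟨ξ, hξ⟩ := S.set n l a
  exact ⟨ξ, by rw [hξ]; simp only [ha]⟩

/-- By `∈`-induction: a set in `V_κ` has fewer than `κ` elements, and each level is closed under
collecting that many values. -/
theorem const_mem {x : ZFSet.{u}} (hx : x.rank < κ.ord) (n : ℕ) : (fun _ => x) ∈ S.lev n := by
  induction x using ZFSet.inductionOn with | h x ih => ?_
  obtain ⟨l, g, rfl⟩ := exists_range_eq (card_lt_of_rank_lt hκ.out hx)
  exact set_mem l (fun i _ => g i) fun i =>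
    ih _ (ZFSet.mem_range_self i) ((ZFSet.rank_lt_of_mem (ZFSet.mem_range_self i)).trans hx)

theorem const_mem_Fs {x : ZFSet.{u}} (hx : x.rank < κ.ord) : (fun _ => x) ∈ S.Fs :=
  ⟨0, const_mem hx 0⟩

/-- A single sequence starting above both indices decides the question for all such sequences, so
the filter acts as an ultrafilter on relations between represented functions. -/
theorem ev_mem_or {F G : Fn κ} (hF : F ∈ S.Fs) (hG : G ∈ S.Fs) :
    (∀ᶠ γ in S.ev, F γ ∈ G γ) ∨ ∀ᶠ γ in S.ev, F γ ∉ G γ := by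
  obtain ⟨n, ξ, rfl⟩ := hF
  obtain ⟨m, ζ, rfl⟩ := hG
  obtain ⟨γ, hγ, hlt⟩ := exists_seqIn S.unbounded (max ξ ζ)
  by_cases h : S.T (n + 1) ξ γ ∈ S.T (m + 1) ζ γ
  · refine Or.inl (ev_iff.2 ⟨max ξ ζ, fun γ' h1 h2 => ?_⟩)
    rw [max_lt_iff] at hlt h2
    exact (S.indisc_mem _ _ _ _ γ γ' hγ h1 hlt.1 hlt.2 h2.1 h2.2).1 h
  · refine Or.inr (ev_iff.2 ⟨max ξ ζ, fun γ' h1 h2 h3 => h ?_⟩)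
    rw [max_lt_iff] at hlt h2
    exact (S.indisc_mem _ _ _ _ γ γ' hγ h1 hlt.1 hlt.2 h2.1 h2.2).2 h3

theorem ev_eq_or {F G : Fn κ} (hF : F ∈ S.Fs) (hG : G ∈ S.Fs) :
    (∀ᶠ γ in S.ev, F γ = G γ) ∨ ∀ᶠ γ in S.ev, F γ ≠ G γ := by
  obtain ⟨n, ξ, rfl⟩ := hF
  obtain ⟨m, ζ, rfl⟩ := hG
  obtain ⟨γ, hγ, hlt⟩ := exists_seqIn S.unbounded (max ξ ζ)
  by_cases h : S.T (n + 1) ξ γ = S.T (m + 1) ζ γ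
  · refine Or.inl (ev_iff.2 ⟨max ξ ζ, fun γ' h1 h2 => ?_⟩)
    rw [max_lt_iff] at hlt h2
    exact (S.indisc_eq _ _ _ _ γ γ' hγ h1 hlt.1 hlt.2 h2.1 h2.2).1 h
  · refine Or.inr (ev_iff.2 ⟨max ξ ζ, fun γ' h1 h2 h3 => h ?_⟩)
    rw [max_lt_iff] at hlt h2
    exact (S.indisc_eq _ _ _ _ γ γ' hγ h1 hlt.1 hlt.2 h2.1 h2.2).2 h3

/-- A function that is regressive at `γ 0` takes a fixed value. -/
theorem exists_ev_eq_oz {F : Fn κ} (hF : F ∈ S.Fs) (h : ∀ᶠ γ in S.ev, F γ ∈ vr 0 γ) :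
    ∃ ξ : κ.ord.ToType, ∀ᶠ γ in S.ev, F γ = oz ξ := by
  obtain ⟨n, ζ, rfl⟩ := hF
  obtain ⟨δ, hδ⟩ := ev_iff.1 h
  obtain ⟨γ, hγ, hlt⟩ := exists_seqIn S.unbounded (max ζ δ)
  rw [max_lt_iff] at hlt
  obtain ⟨ξ, hξ, h1⟩ := mem_oz.1 (hδ γ hγ hlt.2)
  refine ⟨ξ, ev_iff.2 ⟨max ζ ξ, fun γ' h2 h3 => ?_⟩⟩
  rw [max_lt_iff] at h3
  -- Regressivity puts the value `ξ` below `γ 0`, so it is an admissible index of a level zero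
  -- constant, and the equation is transported to every later sequence.
  have h4 := S.indisc_eq (n + 1) 0 ζ ξ γ γ' hγ h2 hlt.1 hξ h3.1 h3.2
  rw [S.zero, S.zero] at h4
  exact h4.1 h1.symm

/-- For members of a countable family of relations, either eventually no set in `V_κ` has the
relation to the values of given functions, or a function provides such sets. -/
theorem dichotomy {n : ℕ} {P : ZFSet.{u} → (ℕ → ZFSet.{u}) → Prop} (hP : P ∈ Q) (F : ℕ → Fn κ)
    (hF : ∀ i, F i ∈ S.lev n) :
    (∀ᶠ γ in S.ev, ∀ w : ZFSet.{u}, w.rank < κ.ord → ¬ P w fun i => F i γ) ∨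
      ∃ W ∈ S.lev n, ∀ᶠ γ in S.ev, P (W γ) fun i => F i γ := by
  choose g hg using hF
  obtain rfl : (fun i => S.T (n + 1) (g i)) = F := funext hg
  obtain ⟨ξ, hξ⟩ := S.test n P hP g
  obtain ⟨ζ, hζ⟩ := S.skolem n P hP g
  have h1 : ({∅} : ZFSet.{u}).rank < κ.ord := by
    have := (isSuccLimit_ord hκ.out.aleph0_lt.le).succ_lt hκ.out.isRegular.ord_pos
    simpa using this
  -- Existence of a witness is coded as equality with the constant `{∅}`, which is eventually
  -- decided.
  rcases ev_eq_or (S := S) ⟨n, ξ, rfl⟩ (const_mem_Fs h1) with h | h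
  · refine Or.inr ⟨_, ⟨ζ, rfl⟩, h.mono fun γ h2 => hζ γ ((hξ γ).2 h2)⟩
  · exact Or.inl (h.mono fun γ h2 w hw hp => h2 ((hξ γ).1 ⟨w, hw, hp⟩))

theorem dichotomy₃ {n : ℕ} {p : ZFSet.{u} → ZFSet.{u} → ZFSet.{u} → ZFSet.{u} → Prop}
    (hp : relPred p ∈ Q) {F G K : Fn κ} (hF : F ∈ S.lev n) (hG : G ∈ S.lev n)
    (hK : K ∈ S.lev n) :
    (∀ᶠ γ in S.ev, ∀ w : ZFSet.{u}, w.rank < κ.ord → ¬ p w (F γ) (G γ) (K γ)) ∨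
      ∃ W ∈ S.lev n, ∀ᶠ γ in S.ev, p (W γ) (F γ) (G γ) (K γ) :=
  dichotomy hp (triple F G K) fun i => match i with
    | 0 => hF
    | 1 => hG
    | _ + 2 => hK

/-- Eventually a relation holds unless a function provides counterexamples. -/
theorem ev_of_no_counterexample {p : ZFSet.{u} → ZFSet.{u} → ZFSet.{u} → ZFSet.{u} → Prop}
    (hp : relPred p ∈ Q) {F G K : Fn κ} (hF : F ∈ S.Fs) (hG : G ∈ S.Fs) (hK : K ∈ S.Fs)
    (h : ∀ W ∈ S.Fs, ¬ ∀ᶠ γ in S.ev, p (W γ) (F γ) (G γ) (K γ)) :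
    ∀ᶠ γ in S.ev, ∀ w : ZFSet.{u}, w.rank < κ.ord → ¬ p w (F γ) (G γ) (K γ) := by
  obtain ⟨n, h1, h2, h3⟩ := exists_lev_triple hF hG hK
  refine (dichotomy₃ hp h1 h2 h3).resolve_right ?_
  rintro ⟨W, hW, h4⟩
  exact h W ⟨n, hW⟩ h4

theorem exists_witness {n : ℕ} {p : ZFSet.{u} → ZFSet.{u} → ZFSet.{u} → ZFSet.{u} → Prop}
    (hp : relPred p ∈ Q) {F G K : Fn κ} (hF : F ∈ S.lev n) (hG : G ∈ S.lev n) (hK : K ∈ S.lev n)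
    (h : ∀ᶠ γ in S.ev, ∃ w : ZFSet.{u}, w.rank < κ.ord ∧ p w (F γ) (G γ) (K γ)) :
    ∃ W ∈ S.lev n, ∀ᶠ γ in S.ev, p (W γ) (F γ) (G γ) (K γ) := by
  refine (dichotomy₃ hp hF hG hK).resolve_left fun h' => ?_
  obtain ⟨γ, ⟨w, h1, h2⟩, h3⟩ := (h.and h').exists
  exact h3 w h1 h2

/-- A Skolem function for the graph of an operation has no choice: it is the operation itself. -/
theorem op_mem {n : ℕ} {G : ZFSet.{u} → ZFSet.{u} → ZFSet.{u} → ZFSet.{u}} (hG : opPred G ∈ Q)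
    {F₁ F₂ F₃ : Fn κ} (h₁ : F₁ ∈ S.lev n) (h₂ : F₂ ∈ S.lev n) (h₃ : F₃ ∈ S.lev n)
    (hr : ∀ γ, (G (F₁ γ) (F₂ γ) (F₃ γ)).rank < κ.ord) :
    (fun γ => G (F₁ γ) (F₂ γ) (F₃ γ)) ∈ S.lev n := by
  have hF : ∀ i, triple F₁ F₂ F₃ i ∈ S.lev n := fun i => match i with
    | 0 => h₁
    | 1 => h₂
    | _ + 2 => h₃
  choose g hg using hF
  obtain ⟨ξ, hξ⟩ := S.skolem n _ hG g
  refine ⟨ξ, funext fun γ => ?_⟩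
  simp only [hg] at hξ
  exact hξ γ ⟨_, hr γ, rfl⟩

theorem op_mem_Fs {G : ZFSet.{u} → ZFSet.{u} → ZFSet.{u} → ZFSet.{u}} (hG : opPred G ∈ Q)
    {F₁ F₂ F₃ : Fn κ} (h₁ : F₁ ∈ S.Fs) (h₂ : F₂ ∈ S.Fs) (h₃ : F₃ ∈ S.Fs)
    (hr : ∀ γ, (G (F₁ γ) (F₂ γ) (F₃ γ)).rank < κ.ord) :
    (fun γ => G (F₁ γ) (F₂ γ) (F₃ γ)) ∈ S.Fs := by
  obtain ⟨n, h1, h2, h3⟩ := exists_lev_triple h₁ h₂ h₃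
  exact ⟨n, op_mem hG h1 h2 h3 hr⟩

/-! ### The transitive collapse -/

/-- By countable completeness, the steps of a descending sequence of functions hold at one common
`γ`, where the values would descend in `∈`. -/
theorem ev_wellFounded : WellFounded fun F G : Fn κ => ∀ᶠ γ in S.ev, F γ ∈ G γ := by
  rw [wellFounded_iff_isEmpty_descending_chain]
  refine ⟨fun ⟨f, hf⟩ => ?_⟩
  have h1 : ∀ n : ULift.{u} ℕ, ∀ᶠ γ in S.ev, f (n.down + 1) γ ∈ f n.down γ := fun n =>
    hf n.down
  obtain ⟨γ, hγ⟩ := (ev_forall (by simpa using hκ.out.aleph0_lt) h1).exists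
  exact (wellFounded_iff_isEmpty_descending_chain.1 ZFSet.mem_wf).elim
    ⟨fun n => f n γ, fun n => hγ ⟨n⟩⟩

instance small_Fs : Small.{u} S.Fs := by
  have h : S.Fs = Set.range fun p : ℕ × κ.ord.ToType => S.T (p.1 + 1) p.2 := by
    ext F
    constructor
    · rintro ⟨n, ξ, rfl⟩; exact ⟨(n, ξ), rfl⟩
    · rintro ⟨⟨n, ξ⟩, rfl⟩; exact ⟨n, ξ, rfl⟩
  rw [h]
  infer_instance

instance small_sub_Fs (p : Fn κ → Prop) : Small.{u} {F // F ∈ S.Fs ∧ p F} :=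
  small_of_injective (β := S.Fs) (f := fun F => ⟨F.1, F.2.1⟩) fun F G h => by
    simpa [Subtype.ext_iff] using h

variable (S) in
/-- The transitive collapse of the class of a function. -/
def col : Fn κ → ZFSet.{u} :=
  (ev_wellFounded (S := S)).fix fun F ih =>
    ZFSet.range fun G : {G // G ∈ S.Fs ∧ ∀ᶠ γ in S.ev, G γ ∈ F γ} => ih G.1 G.2.2

theorem mem_col {x : ZFSet.{u}} {F : Fn κ} :
    x ∈ S.col F ↔ ∃ G ∈ S.Fs, (∀ᶠ γ in S.ev, G γ ∈ F γ) ∧ S.col G = x := by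
  rw [col, WellFounded.fix_eq, ZFSet.mem_range]
  constructor
  · rintro ⟨⟨G, h1, h2⟩, rfl⟩
    exact ⟨G, h1, h2, rfl⟩
  · rintro ⟨G, h1, h2, rfl⟩
    exact ⟨⟨G, h1, h2⟩, rfl⟩

theorem col_congr {F G : Fn κ} (h : ∀ᶠ γ in S.ev, F γ = G γ) : S.col F = S.col G := by
  ext x
  rw [mem_col, mem_col]
  constructor
  · rintro ⟨K, h1, h2, h3⟩
    exact ⟨K, h1, (h2.and h).mono fun γ h => h.2 ▸ h.1, h3⟩
  · rintro ⟨K, h1, h2, h3⟩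
    exact ⟨K, h1, (h2.and h).mono fun γ h => h.2 ▸ h.1, h3⟩

end System

/-! ### The relations and operations that the functions have to handle -/

/-- `w` is the image of `d` under some function. -/
def SmallImage (d w : ZFSet.{u}) : Prop := ∃ f : ZFSet.{u} → ZFSet.{u}, ∀ y ∈ w, ∃ u ∈ d, f u = y

open Classical in
/-- The value of the function `f` at `x`. -/
def app (f x : ZFSet.{u}) : ZFSet.{u} := if h : ∃ y, ZFSet.pair x y ∈ f then h.choose else ∅

theorem app_spec {f x : ZFSet.{u}} (h : ∃ y, ZFSet.pair x y ∈ f) : ZFSet.pair x (app f x) ∈ f := by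
  rw [app, dif_pos h]
  exact h.choose_spec

theorem app_eq {f x y : ZFSet.{u}} (h : ZFSet.pair x y ∈ f) (hu : ∃! y, ZFSet.pair x y ∈ f) :
    app f x = y := hu.unique (app_spec ⟨y, h⟩) h

/-- In this relation and the following ones `w` is the object sought: a counterexample where a
property is to hold eventually, or a witness where an element of the collapse has to be produced. -/
def relSymmDiff (w x y _z : ZFSet.{u}) : Prop := w ∈ x ∧ w ∉ y ∨ w ∈ y ∧ w ∉ x
def relDiff (w x y _z : ZFSet.{u}) : Prop := w ∈ x ∧ w ∉ y
def relRank (w x y _z : ZFSet.{u}) : Prop := w ∈ x ∧ y.rank ≤ w.rank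
def relFst (w x _y _z : ZFSet.{u}) : Prop := ∃ v, x = ZFSet.pair w v
def relSnd (w x _y _z : ZFSet.{u}) : Prop := ∃ v, x = ZFSet.pair v w
def relNotProd (w x y z : ZFSet.{u}) : Prop := w ∈ z ∧ w ∉ ZFSet.prod x y
def relNotTotal (w x _y z : ZFSet.{u}) : Prop := w ∈ x ∧ ¬ ∃! v, ZFSet.pair w v ∈ z
def relOther (w x y z : ZFSet.{u}) : Prop := w ≠ y ∧ ZFSet.pair x w ∈ z
def relInv (w x _y z : ZFSet.{u}) : Prop := ZFSet.pair w x ∈ z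
def relNotReg (w x _y _z : ZFSet.{u}) : Prop := w ⊆ x ∧ w ∉ x ∧ ∃ d ∈ x, SmallImage d w
def relDom (w x y _z : ZFSet.{u}) : Prop := w ∈ y ∧ SmallImage w x
def relEnum (w x y _z : ZFSet.{u}) : Prop := ∀ v ∈ x, ∃ u ∈ y, app w u = v
def relDiag (w x _y z : ZFSet.{u}) : Prop := w ∈ x ∧ ∃ B, ZFSet.pair w B ∈ z ∧ x ∉ B
def relDiagValue (w x y z : ZFSet.{u}) : Prop := ZFSet.pair y w ∈ z ∧ x ∉ w
def relFrom (w x y z : ZFSet.{u}) : Prop := w ∈ y ∧ ZFSet.pair w x ∈ z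
def relBij (w x y _z : ZFSet.{u}) : Prop := ZFSet.IsFunc x y w ∧ ∀ v ∈ y, ∃! u, ZFSet.pair u v ∈ w

/-- The relations for which witnesses are needed. -/
def basicRels : Set (ZFSet.{u} → ZFSet.{u} → ZFSet.{u} → ZFSet.{u} → Prop) :=
  {relSymmDiff, relDiff, relRank, relFst, relSnd, relNotProd, relNotTotal, relOther, relInv,
    relNotReg, relDom, relEnum, relDiag, relDiagValue, relFrom, relBij}

def opDouble (x y _z : ZFSet.{u}) : ZFSet.{u} := {x, y}
def opInter (x y _z : ZFSet.{u}) : ZFSet.{u} := x ∩ y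
def opDiff (x y _z : ZFSet.{u}) : ZFSet.{u} := x \ y
def opV (x _y _z : ZFSet.{u}) : ZFSet.{u} := ZFSet.vonNeumann x.rank
def opRank (x _y _z : ZFSet.{u}) : ZFSet.{u} := x.rank.toZFSet
def opInterWith (A x _y _z : ZFSet.{u}) : ZFSet.{u} := A ∩ x
def opApp (f x _z : ZFSet.{u}) : ZFSet.{u} := app f x
def opDiag (x f _z : ZFSet.{u}) : ZFSet.{u} :=
  x.sep fun ξ => ∀ α ∈ ξ, ∀ B, ZFSet.pair α B ∈ f → ξ ∈ B
def opAgree (R : ZFSet.{u} → ZFSet.{u} → Prop) (x f g : ZFSet.{u}) : ZFSet.{u} :=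
  x.sep fun ξ => ∃ y z, ZFSet.pair ξ y ∈ f ∧ ZFSet.pair ξ z ∈ g ∧ R y z
def opConst (x y _z : ZFSet.{u}) : ZFSet.{u} := ZFSet.prod x {y}
-- A partial function into `v` is made total on `x` by the value `∅` where `f` has no value in `v`.
def opTotal (x f v : ZFSet.{u}) : ZFSet.{u} :=
  (ZFSet.prod x v).sep fun p => ∃ ξ y, p = ZFSet.pair ξ y ∧
    (ZFSet.pair ξ y ∈ f ∨ y = ∅ ∧ ¬ ∃ y' ∈ v, ZFSet.pair ξ y' ∈ f)
def opRan (f v _z : ZFSet.{u}) : ZFSet.{u} := v.sep fun y => ∃ x, ZFSet.pair x y ∈ f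
-- With `x` the first indiscernible and `g` a shifted enumeration, these are the indices of sets
-- that the ultrafilter accepts; `opTrace` then collects the sets with these indices. Components of
-- pairs in `f` lie in its double union.
def opTraceIdx (x g _z : ZFSet.{u}) : ZFSet.{u} :=
  x.sep fun ξ => ∃ B, ZFSet.pair ξ B ∈ g ∧ x ∈ B
def opTrace (x t f : ZFSet.{u}) : ZFSet.{u} :=
  (ZFSet.sUnion (ZFSet.sUnion f)).sep fun B => B ⊆ x ∧ ∃ ξ ∈ t, ZFSet.pair ξ B ∈ f

/-- The operations under which the functions have to be closed. -/
def basicOps (A : ZFSet.{u}) : Set (ZFSet.{u} → ZFSet.{u} → ZFSet.{u} → ZFSet.{u}) :=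
  {opDouble, opInter, opDiff, opV, opRank, opInterWith A, opApp, opDiag, opAgree (· = ·),
    opAgree (· ∈ ·), opConst, opTotal, opRan, opTraceIdx, opTrace}

/-- The formula `φ` holds in the structure `v` at the first `n` terms of `x`. -/
def Sat (v : ZFSet.{u}) {n : ℕ} (φ : LSet.BoundedFormula Empty n) (x : ℕ → ZFSet.{u}) : Prop :=
  ∃ h : ∀ i : Fin n, x i ∈ v, φ.Realize (M := v) default fun i => ⟨x i, h i⟩

/-- The element `w` of the structure `x 0` together with `x 1, …, x n` satisfies `φ`. -/
def skolemPred {n : ℕ} (φ : LSet.BoundedFormula Empty (n + 1)) (w : ZFSet.{u})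
    (x : ℕ → ZFSet.{u}) : Prop :=
  Sat (x 0) φ fun i => if i < n then x (i + 1) else w

/-- All predicates for which the functions provide witnesses. -/
def preds (A : ZFSet.{u}) : Set (ZFSet.{u} → (ℕ → ZFSet.{u}) → Prop) :=
  (relPred '' basicRels ∪ opPred '' basicOps A) ∪
    Set.range fun p : Σ n, LSet.BoundedFormula Empty (n + 1) => skolemPred p.2

theorem countable_preds (A : ZFSet.{u}) : (preds A).Countable := by
  have h1 : (basicRels.{u}).Countable := by
    unfold basicRels
    exact (Set.toFinite _).countable
  have h2 : (basicOps A).Countable := by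
    unfold basicOps
    exact (Set.toFinite _).countable
  have h3 : Countable (Σ n, LSet.BoundedFormula Empty n) := by
    rw [← mk_le_aleph0_iff]
    have hL : LSet.card ≤ ℵ₀ := by
      have : Countable LSet.Symbols := by
        have h1 : ∀ n, Countable (LSet.Functions n) := fun n => inferInstanceAs (Countable Empty)
        have h2 : ∀ n, Countable (LSet.Relations n) := fun n => by
          have : Subsingleton (SetRel n) := ⟨fun a b => by cases a; cases b; rfl⟩
          exact inferInstanceAs (Countable (SetRel n))
        exact inferInstanceAs (Countable (_ ⊕ _))
      exact mk_le_aleph0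
    refine (BoundedFormula.card_le (L := LSet) (α := Empty)).trans ?_
    simpa using hL
  have h4 : Countable (Σ n, LSet.BoundedFormula Empty (n + 1)) := by
    refine Function.Injective.countable (β := Σ n, LSet.BoundedFormula Empty n)
      (f := fun p => ⟨p.1 + 1, p.2⟩) ?_
    rintro ⟨n, φ⟩ ⟨m, ψ⟩ h
    simp only [Sigma.mk.injEq, add_left_inj] at h
    obtain ⟨rfl, h⟩ := h
    rw [eq_of_heq h]
  exact ((h1.image _).union (h2.image _)).union (Set.countable_range _)

theorem rel_mem {A : ZFSet.{u}} {p : ZFSet.{u} → ZFSet.{u} → ZFSet.{u} → ZFSet.{u} → Prop}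
    (h : p ∈ basicRels) : relPred p ∈ preds A := Or.inl (Or.inl ⟨p, h, rfl⟩)

theorem op_mem_preds {A : ZFSet.{u}} {p : ZFSet.{u} → ZFSet.{u} → ZFSet.{u} → ZFSet.{u}}
    (h : p ∈ basicOps A) : opPred p ∈ preds A := Or.inl (Or.inr ⟨p, h, rfl⟩)

theorem skolemPred_mem {A : ZFSet.{u}} {n : ℕ} (φ : LSet.BoundedFormula Empty (n + 1)) :
    skolemPred φ ∈ preds A := Or.inr ⟨⟨n, φ⟩, rfl⟩

/-! ### Rank bounds for pairs, products and values -/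

section Rank

variable {o : Ordinal.{u}} (ho : Order.IsSuccLimit o)

include ho

theorem rank_double_lt {x y : ZFSet.{u}} (hx : x.rank < o) (hy : y.rank < o) :
    ({x, y} : ZFSet.{u}).rank < o := by
  rw [ZFSet.rank_pair]
  exact max_lt (ho.succ_lt hx) (ho.succ_lt hy)

theorem rank_prod_lt {x y : ZFSet.{u}} (hx : x.rank < o) (hy : y.rank < o) :
    (ZFSet.prod x y).rank < o := by
  have h : (ZFSet.prod x y).rank ≤ (ZFSet.powerset (ZFSet.powerset (x ∪ y))).rank :=
    ZFSet.rank_mono (by unfold ZFSet.prod ZFSet.pairSep; exact ZFSet.sep_subset)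
  refine h.trans_lt ?_
  rw [ZFSet.rank_powerset, ZFSet.rank_powerset, ZFSet.rank_union]
  exact ho.succ_lt (ho.succ_lt (max_lt hx hy))

end Rank

theorem rank_lt_of_pair_mem {x y f : ZFSet.{u}} (h : ZFSet.pair x y ∈ f) :
    x.rank < f.rank ∧ y.rank < f.rank := by
  have h1 : x ∈ ({x, y} : ZFSet.{u}) := by simp
  have h2 : y ∈ ({x, y} : ZFSet.{u}) := by simp
  have h3 : ({x, y} : ZFSet.{u}) ∈ ZFSet.pair x y := by simp [ZFSet.pair]
  have h4 := (ZFSet.rank_lt_of_mem h3).trans (ZFSet.rank_lt_of_mem h)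
  exact ⟨(ZFSet.rank_lt_of_mem h1).trans h4, (ZFSet.rank_lt_of_mem h2).trans h4⟩

theorem rank_app_le (f x : ZFSet.{u}) : (app f x).rank ≤ f.rank := by
  by_cases h : ∃ y, ZFSet.pair x y ∈ f
  · exact (rank_lt_of_pair_mem (app_spec h)).2.le
  · rw [app, dif_neg h]
    simp

namespace System

variable {κ : Cardinal.{u}} [hκ : Fact κ.IsInaccessible] {A : ZFSet.{u}} {S : System κ (preds A)}

theorem isSuccLimit_ord' : Order.IsSuccLimit κ.ord := isSuccLimit_ord hκ.out.aleph0_lt.le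

/-! ### The collapse respects membership, rank, pairs and functions -/

/-- If the values did not eventually agree, a function `W` would choose elements of their symmetric
difference. Its collapse lies in the collapse of one function, hence in that of the other, where by
induction it is represented by a function eventually equal to `W`. -/
theorem ev_eq_of_col_eq {F G : Fn κ} (hF : F ∈ S.Fs) (hG : G ∈ S.Fs) (h : S.col F = S.col G) :
    ∀ᶠ γ in S.ev, F γ = G γ := by
  induction F using (ev_wellFounded (S := S)).induction generalizing G with | _ F ih => ?_
  have key : ∀ᶠ γ in S.ev, ∀ w : ZFSet.{u}, w.rank < κ.ord →
      ¬ relSymmDiff w (F γ) (G γ) (G γ) := by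
    refine ev_of_no_counterexample (rel_mem (by simp [basicRels])) hF hG hG fun W hW hev => ?_
    rcases ev_mem_or hW hF with hWF | hWF
    · have h1 : S.col W ∈ S.col G := h ▸ mem_col.2 ⟨W, hW, hWF, rfl⟩
      obtain ⟨W', hW', h2, h3⟩ := mem_col.1 h1
      obtain ⟨γ, h4, h5, h6, h7⟩ := (hev.and (hWF.and (h2.and (ih W hWF hW hW' h3.symm)))).exists
      rw [← h7] at h6
      exact h4.elim (fun h => h.2 h6) fun h => h.2 h5
    · have hWG : ∀ᶠ γ in S.ev, W γ ∈ G γ := (hev.and hWF).mono fun γ ⟨h1, h2⟩ =>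
        h1.elim (fun h => absurd h.1 h2) fun h => h.1
      have h1 : S.col W ∈ S.col F := h ▸ mem_col.2 ⟨W, hW, hWG, rfl⟩
      obtain ⟨W', hW', h2, h3⟩ := mem_col.1 h1
      obtain ⟨γ, h5, h6, h7⟩ := (hWF.and (h2.and (ih W' h2 hW' hW h3))).exists
      rw [h7] at h6
      exact h5 h6
  refine key.mono fun γ h => ?_
  ext w
  constructor
  · intro h1
    by_contra h2
    exact h w ((ZFSet.rank_lt_of_mem h1).trans (rank_Fn_lt hF γ)) (Or.inl ⟨h1, h2⟩)
  · intro h1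
    by_contra h2
    exact h w ((ZFSet.rank_lt_of_mem h1).trans (rank_Fn_lt hG γ)) (Or.inr ⟨h1, h2⟩)

theorem col_eq_col {F G : Fn κ} (hF : F ∈ S.Fs) (hG : G ∈ S.Fs) :
    S.col F = S.col G ↔ ∀ᶠ γ in S.ev, F γ = G γ :=
  ⟨ev_eq_of_col_eq hF hG, col_congr⟩

theorem col_mem_col {F G : Fn κ} (hF : F ∈ S.Fs) (_hG : G ∈ S.Fs) :
    S.col F ∈ S.col G ↔ ∀ᶠ γ in S.ev, F γ ∈ G γ := by
  constructor
  · intro h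
    obtain ⟨F', h1, h2, h3⟩ := mem_col.1 h
    exact (h2.and (ev_eq_of_col_eq h1 hF h3)).mono fun γ h => h.2 ▸ h.1
  · exact fun h => mem_col.2 ⟨F, hF, h, rfl⟩

/-- Otherwise the function would eventually differ from each element of `x`, and by `κ`-completeness
from all of them at once. -/
theorem exists_ev_eq_of_ev_mem {F : Fn κ} (hF : F ∈ S.Fs) {x : ZFSet.{u}} (hx : x.rank < κ.ord)
    (h : ∀ᶠ γ in S.ev, F γ ∈ x) : ∃ y ∈ x, ∀ᶠ γ in S.ev, F γ = y := by
  obtain ⟨l, g, rfl⟩ := exists_range_eq (card_lt_of_rank_lt hκ.out hx)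
  by_contra hcon
  have h1 : ∀ i, ∀ᶠ γ in S.ev, F γ ≠ g i := fun i =>
    (ev_eq_or hF (const_mem_Fs ((ZFSet.rank_lt_of_mem (ZFSet.mem_range_self i)).trans
      hx))).resolve_left fun h' => hcon ⟨_, ZFSet.mem_range_self i, h'⟩
  obtain ⟨γ, h2, h3⟩ := (h.and (ev_forall (mk_Iio_lt_of_ord l) h1)).exists
  obtain ⟨i, hi⟩ := ZFSet.mem_range.1 h2
  exact h3 i hi.symm

theorem col_const {x : ZFSet.{u}} (hx : x.rank < κ.ord) : S.col (fun _ => x) = x := by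
  induction x using ZFSet.inductionOn with | h x ih => ?_
  ext y
  rw [mem_col]
  constructor
  · rintro ⟨F, hF, h1, rfl⟩
    obtain ⟨y, hy, h2⟩ := exists_ev_eq_of_ev_mem hF hx h1
    rw [col_congr (G := fun _ => y) h2, ih y hy ((ZFSet.rank_lt_of_mem hy).trans hx)]
    exact hy
  · intro hy
    have hy' := (ZFSet.rank_lt_of_mem hy).trans hx
    exact ⟨fun _ => y, const_mem_Fs hy', Eventually.of_forall fun _ => hy, ih y hy hy'⟩

theorem col_oz (ξ : κ.ord.ToType) : S.col (fun _ => oz ξ) = oz ξ := col_const (rank_oz_lt ξ)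

/-- Functions with values below `γ 0` are eventually constant, so exactly the ordinals below `κ` lie
under the first indiscernible. -/
theorem col_vr_zero : S.col (vr 0) = kset κ := by
  ext x
  rw [mem_col, mem_kset]
  constructor
  · rintro ⟨F, hF, h, rfl⟩
    obtain ⟨ξ, hξ⟩ := exists_ev_eq_oz hF h
    exact ⟨ξ, by rw [col_congr (G := fun _ => oz ξ) hξ, col_oz]⟩
  · rintro ⟨ξ, rfl⟩
    exact ⟨_, const_mem_Fs (rank_oz_lt ξ), (ev_gt ξ).mono fun γ h => oz_mem_oz.2 h, col_oz ξ⟩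

theorem col_subset_col {F G : Fn κ} (hF : F ∈ S.Fs) (hG : G ∈ S.Fs) :
    S.col F ⊆ S.col G ↔ ∀ᶠ γ in S.ev, F γ ⊆ G γ := by
  constructor
  · intro h
    have := ev_of_no_counterexample (p := relDiff) (rel_mem (by simp [basicRels])) hF hG hG
      fun W hW hev => by
        have h1 := h ((col_mem_col hW hF).2 (hev.mono fun γ h => h.1))
        obtain ⟨γ, h2, h3⟩ := (hev.and ((col_mem_col hW hG).1 h1)).exists
        exact h2.2 h3
    refine this.mono fun γ h w hw => ?_
    by_contra h2
    exact h w ((ZFSet.rank_lt_of_mem hw).trans (rank_Fn_lt hF γ)) ⟨hw, h2⟩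
  · intro h x hx
    obtain ⟨W, hW, h1, rfl⟩ := mem_col.1 hx
    exact mem_col.2 ⟨W, hW, (h1.and h).mono fun γ h => h.2 h.1, rfl⟩

theorem rank_col_le {F G : Fn κ} (hF : F ∈ S.Fs) (hG : G ∈ S.Fs)
    (h : ∀ᶠ γ in S.ev, (F γ).rank ≤ (G γ).rank) : (S.col F).rank ≤ (S.col G).rank := by
  induction F using (ev_wellFounded (S := S)).induction generalizing G with | _ F ih => ?_
  rw [ZFSet.rank_le_iff]
  intro y hy
  obtain ⟨W, hW, h1, rfl⟩ := mem_col.1 hy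
  obtain ⟨n, hGn, hWn⟩ := exists_lev_pair hG hW
  obtain ⟨K, hK, h2⟩ := exists_witness (p := relRank) (rel_mem (by simp [basicRels])) hGn hWn hWn
    ((h.and h1).mono fun γ ⟨h2, h3⟩ => by
      obtain ⟨w, hw, h4⟩ := ZFSet.lt_rank_iff.1 ((ZFSet.rank_lt_of_mem h3).trans_le h2)
      exact ⟨w, (ZFSet.rank_lt_of_mem hw).trans (rank_Fn_lt hG γ), hw, h4⟩)
  have hK' := lev_subset_Fs hK
  exact (ih W h1 hW hK' (h2.mono fun γ h => h.2)).trans_lt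
    (ZFSet.rank_lt_of_mem ((col_mem_col hK' hG).2 (h2.mono fun γ h => h.1)))

theorem opRank_mem {n : ℕ} {F : Fn κ} (hF : F ∈ S.lev n) :
    (fun γ => (F γ).rank.toZFSet) ∈ S.lev n :=
  op_mem (G := opRank) (op_mem_preds (by simp [basicOps])) hF hF hF fun γ => by
    simpa [opRank] using rank_Fn_lt (lev_subset_Fs hF) γ

/-- The rank of a represented function is again represented, so one of the two comparisons holds
eventually, and `relRank` provides elements of large rank that carry it through the collapse. -/
theorem rank_col_lt_iff {F G : Fn κ} (hF : F ∈ S.Fs) (hG : G ∈ S.Fs) :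
    (S.col F).rank < (S.col G).rank ↔ ∀ᶠ γ in S.ev, (F γ).rank < (G γ).rank := by
  obtain ⟨n, hFn, hGn⟩ := exists_lev_pair hF hG
  constructor
  · intro h
    rcases ev_mem_or (lev_subset_Fs (opRank_mem hFn)) (lev_subset_Fs (opRank_mem hGn)) with h1 | h1
    · simpa using h1
    · simp only [toZFSet_mem_toZFSet_iff, not_lt] at h1
      exact absurd h (rank_col_le hG hF h1).not_gt
  · intro h
    obtain ⟨K, hK, h2⟩ := exists_witness (p := relRank) (rel_mem (by simp [basicRels])) hGn hFn hFn
      (h.mono fun γ h2 => by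
        obtain ⟨w, hw, h4⟩ := ZFSet.lt_rank_iff.1 h2
        exact ⟨w, (ZFSet.rank_lt_of_mem hw).trans (rank_Fn_lt hG γ), hw, h4⟩)
    have hK' := lev_subset_Fs hK
    exact (rank_col_le hF hK' (h2.mono fun γ h => h.2)).trans_lt
      (ZFSet.rank_lt_of_mem ((col_mem_col hK' hG).2 (h2.mono fun γ h => h.1)))

theorem double_mem {n : ℕ} {F G : Fn κ} (hF : F ∈ S.lev n) (hG : G ∈ S.lev n) :
    (fun γ => ({F γ, G γ} : ZFSet.{u})) ∈ S.lev n :=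
  op_mem (G := opDouble) (op_mem_preds (by simp [basicOps])) hF hG hG fun γ =>
    rank_double_lt isSuccLimit_ord' (rank_Fn_lt (lev_subset_Fs hF) γ) (rank_Fn_lt (lev_subset_Fs hG) γ)

theorem col_double {F G : Fn κ} (hF : F ∈ S.Fs) (hG : G ∈ S.Fs) :
    S.col (fun γ => ({F γ, G γ} : ZFSet.{u})) = {S.col F, S.col G} := by
  ext x
  rw [mem_col, ZFSet.mem_pair]
  constructor
  · rintro ⟨W, hW, h, rfl⟩
    rw [col_eq_col hW hF, col_eq_col hW hG]
    rcases ev_eq_or hW hF with h1 | h1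
    · exact Or.inl h1
    · exact Or.inr ((h.and h1).mono fun γ ⟨h2, h3⟩ => (ZFSet.mem_pair.1 h2).resolve_left h3)
  · rintro (rfl | rfl)
    · exact ⟨F, hF, Eventually.of_forall fun γ => by simp, rfl⟩
    · exact ⟨G, hG, Eventually.of_forall fun γ => by simp, rfl⟩

theorem pair_eq_double (x y : ZFSet.{u}) : ZFSet.pair x y = {{x, x}, {x, y}} := by
  rw [ZFSet.pair, ZFSet.pair_eq_singleton]

theorem pair_mem {n : ℕ} {F G : Fn κ} (hF : F ∈ S.lev n) (hG : G ∈ S.lev n) :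
    (fun γ => ZFSet.pair (F γ) (G γ)) ∈ S.lev n := by
  simp only [pair_eq_double]
  exact double_mem (double_mem hF hF) (double_mem hF hG)

theorem pair_mem_Fs {F G : Fn κ} (hF : F ∈ S.Fs) (hG : G ∈ S.Fs) :
    (fun γ => ZFSet.pair (F γ) (G γ)) ∈ S.Fs := by
  obtain ⟨n, h1, h2⟩ := exists_lev_pair hF hG
  exact ⟨n, pair_mem h1 h2⟩

theorem col_pair {F G : Fn κ} (hF : F ∈ S.Fs) (hG : G ∈ S.Fs) :
    S.col (fun γ => ZFSet.pair (F γ) (G γ)) = ZFSet.pair (S.col F) (S.col G) := by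
  obtain ⟨n, h1, h2⟩ := exists_lev_pair hF hG
  simp only [pair_eq_double]
  rw [col_double (lev_subset_Fs (double_mem h1 h1)) (lev_subset_Fs (double_mem h1 h2)),
    col_double hF hF, col_double hF hG]

theorem pair_col_mem_col {F G K : Fn κ} (hF : F ∈ S.Fs) (hG : G ∈ S.Fs) (hK : K ∈ S.Fs) :
    ZFSet.pair (S.col F) (S.col G) ∈ S.col K ↔ ∀ᶠ γ in S.ev, ZFSet.pair (F γ) (G γ) ∈ K γ := by
  rw [← col_pair hF hG, col_mem_col (pair_mem_Fs hF hG) hK]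

/-- The class of all collapsed functions is closed under components of pairs. -/
theorem exists_of_pair_mem {x y : ZFSet.{u}} {F : Fn κ} (h : ZFSet.pair x y ∈ S.col F) :
    ∃ G ∈ S.Fs, ∃ K ∈ S.Fs, S.col G = x ∧ S.col K = y := by
  obtain ⟨W, -, -, hW⟩ := mem_col.1 h
  have h1 : ({x, y} : ZFSet.{u}) ∈ S.col W := by rw [hW, ZFSet.pair]; simp
  obtain ⟨W', -, -, hW'⟩ := mem_col.1 h1
  have h2 : x ∈ S.col W' := by rw [hW']; simp
  have h3 : y ∈ S.col W' := by rw [hW']; simp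
  obtain ⟨G, hG, -, h4⟩ := mem_col.1 h2
  obtain ⟨K, hK, -, h5⟩ := mem_col.1 h3
  exact ⟨G, hG, K, hK, h4, h5⟩

theorem exists_fst_snd {F D X : Fn κ} (hF : F ∈ S.Fs)
    (h : ∀ᶠ γ in S.ev, F γ ∈ ZFSet.prod (D γ) (X γ)) :
    ∃ G ∈ S.Fs, ∃ K ∈ S.Fs, ∀ᶠ γ in S.ev, F γ = ZFSet.pair (G γ) (K γ) ∧ G γ ∈ D γ ∧ K γ ∈ X γ := by
  obtain ⟨n, hn⟩ := hF
  have hr : ∀ γ a b, F γ = ZFSet.pair a b → a.rank < κ.ord ∧ b.rank < κ.ord := by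
    intro γ a b h
    have h1 := rank_lt_of_pair_mem (x := a) (y := b) (f := {F γ}) (by simp [h])
    have h2 : ({F γ} : ZFSet.{u}).rank < κ.ord := by
      rw [ZFSet.rank_singleton]
      exact isSuccLimit_ord'.succ_lt (rank_Fn_lt ⟨n, hn⟩ γ)
    exact ⟨h1.1.trans h2, h1.2.trans h2⟩
  obtain ⟨G, hG, h1⟩ := exists_witness (p := relFst) (rel_mem (by simp [basicRels])) hn hn hn
    (h.mono fun γ h => by
      obtain ⟨a, -, b, -, h⟩ := ZFSet.mem_prod.1 h
      exact ⟨a, (hr γ a b h).1, b, h⟩)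
  obtain ⟨K, hK, h2⟩ := exists_witness (p := relSnd) (rel_mem (by simp [basicRels])) hn hn hn
    (h.mono fun γ h => by
      obtain ⟨a, -, b, -, h⟩ := ZFSet.mem_prod.1 h
      exact ⟨b, (hr γ a b h).2, a, h⟩)
  refine ⟨G, ⟨n, hG⟩, K, ⟨n, hK⟩, (h.and (h1.and h2)).mono fun γ ⟨h3, ⟨b, hb⟩, a, ha⟩ => ?_⟩
  rw [hb, ZFSet.pair_inj] at ha
  obtain ⟨rfl, rfl⟩ := ha
  refine ⟨hb, ?_⟩
  rw [hb, ZFSet.pair_mem_prod] at h3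
  exact h3

theorem app_mem {n : ℕ} {F G : Fn κ} (hF : F ∈ S.lev n) (hG : G ∈ S.lev n) :
    (fun γ => app (F γ) (G γ)) ∈ S.lev n :=
  op_mem (G := opApp) (op_mem_preds (by simp [basicOps])) hF hG hG fun γ =>
    (rank_app_le _ _).trans_lt (rank_Fn_lt (lev_subset_Fs hF) γ)

theorem app_mem_Fs {F G : Fn κ} (hF : F ∈ S.Fs) (hG : G ∈ S.Fs) :
    (fun γ => app (F γ) (G γ)) ∈ S.Fs := by
  obtain ⟨n, h1, h2⟩ := exists_lev_pair hF hG
  exact ⟨n, app_mem h1 h2⟩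

/-- A pointwise failure of either clause is witnessed by a represented function, whose collapse
violates the same clause. -/
theorem isFunc_col {D X F : Fn κ} (hD : D ∈ S.Fs) (hX : X ∈ S.Fs) (hF : F ∈ S.Fs) :
    ZFSet.IsFunc (S.col D) (S.col X) (S.col F) ↔
      ∀ᶠ γ in S.ev, ZFSet.IsFunc (D γ) (X γ) (F γ) := by
  constructor
  · intro h
    have h1 := ev_of_no_counterexample (p := relNotProd) (rel_mem (by simp [basicRels])) hD hX hF
      fun W hW hev => by
        have h1 := h.1 ((col_mem_col hW hF).2 (hev.mono fun γ h => h.1))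
        obtain ⟨a, ha, b, hb, h2⟩ := ZFSet.mem_prod.1 h1
        obtain ⟨G, hG, h3, rfl⟩ := mem_col.1 ha
        obtain ⟨K, hK, h4, rfl⟩ := mem_col.1 hb
        rw [← col_pair hG hK, col_eq_col hW (pair_mem_Fs hG hK)] at h2
        obtain ⟨γ, h5, h6, h7, h8⟩ := (hev.and (h2.and (h3.and h4))).exists
        exact h5.2 (by rw [h6]; exact ZFSet.pair_mem_prod.2 ⟨h7, h8⟩)
    have h2 := ev_of_no_counterexample (p := relNotTotal) (rel_mem (by simp [basicRels])) hD hX hF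
      fun W hW hev => by
        obtain ⟨v, hv, huniq⟩ := h.2 _ ((col_mem_col hW hD).2 (hev.mono fun γ h => h.1))
        obtain ⟨-, -, V, hV, -, rfl⟩ := exists_of_pair_mem hv
        have hv' := (pair_col_mem_col hW hV hF).1 hv
        obtain ⟨n, hWn, hVn, hFn⟩ := exists_lev_triple hW hV hF
        -- `V` is already a value at `W`, so failure of unique existence means that there is a
        -- second value.
        obtain ⟨V', hV', h3⟩ := exists_witness (p := relOther) (rel_mem (by simp [basicRels]))
          hWn hVn hFn ((hev.and hv').mono fun γ ⟨h3, h4⟩ => by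
            by_contra! hcon
            refine h3.2 ⟨V γ, h4, fun y hy => ?_⟩
            by_contra hne
            exact hcon y ((rank_lt_of_pair_mem hy).2.trans (rank_Fn_lt hF γ)) ⟨hne, hy⟩)
        have h4 := huniq _ ((pair_col_mem_col hW (lev_subset_Fs hV') hF).2
          (h3.mono fun γ h => h.2))
        obtain ⟨γ, h5, h6⟩ := (h3.and ((col_eq_col (lev_subset_Fs hV') hV).1 h4)).exists
        exact h5.1 h6
    refine (h1.and h2).mono fun γ ⟨h3, h4⟩ => ⟨fun w hw => ?_, fun w hw => ?_⟩
    · by_contra hcon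
      exact h3 w ((ZFSet.rank_lt_of_mem hw).trans (rank_Fn_lt hF γ)) ⟨hw, hcon⟩
    · by_contra hcon
      exact h4 w ((ZFSet.rank_lt_of_mem hw).trans (rank_Fn_lt hD γ)) ⟨hw, hcon⟩
  · intro h
    refine ⟨fun x hx => ?_, fun x hx => ?_⟩
    · obtain ⟨W, hW, h1, rfl⟩ := mem_col.1 hx
      obtain ⟨G, hG, K, hK, h2⟩ := exists_fst_snd hW ((h.and h1).mono fun γ h => h.1.1 h.2)
      rw [col_congr (h2.mono fun γ h => h.1), col_pair hG hK, ZFSet.pair_mem_prod,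
        col_mem_col hG hD, col_mem_col hK hX]
      exact ⟨h2.mono fun γ h => h.2.1, h2.mono fun γ h => h.2.2⟩
    · obtain ⟨W, hW, h1, rfl⟩ := mem_col.1 hx
      have hap := app_mem_Fs hF hW
      refine ⟨S.col fun γ => app (F γ) (W γ), ?_, ?_⟩
      · exact (pair_col_mem_col hW hap hF).2 ((h.and h1).mono fun γ ⟨h2, h3⟩ =>
          app_spec (h2.2 _ h3).exists)
      · intro y hy
        obtain ⟨-, -, V, hV, -, rfl⟩ := exists_of_pair_mem hy
        have h2 := (pair_col_mem_col hW hV hF).1 hy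
        exact (col_congr ((h.and (h1.and h2)).mono fun γ ⟨h3, h4, h5⟩ =>
          app_eq h5 (h3.2 _ h4))).symm

theorem bij_col {X F Y : Fn κ} (hX : X ∈ S.Fs) (hF : F ∈ S.Fs) (hY : Y ∈ S.Fs)
    (h : ∀ᶠ γ in S.ev, relBij (F γ) (X γ) (Y γ) (Y γ)) :
    relBij (S.col F) (S.col X) (S.col Y) (S.col Y) := by
  refine ⟨(isFunc_col hX hY hF).2 (h.mono fun γ h => h.1), fun y hy => ?_⟩
  obtain ⟨W, hW, h1, rfl⟩ := mem_col.1 hy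
  obtain ⟨n, hWn, hFn⟩ := exists_lev_pair hW hF
  obtain ⟨V, hV, h2⟩ := exists_witness (p := relInv) (rel_mem (by simp [basicRels])) hWn hWn hFn
    ((h.and h1).mono fun γ ⟨h2, h3⟩ => by
      obtain ⟨v, hv, -⟩ := h2.2 _ h3
      exact ⟨v, (rank_lt_of_pair_mem hv).1.trans (rank_Fn_lt hF γ), hv⟩)
  refine ⟨S.col V, (pair_col_mem_col (lev_subset_Fs hV) hW hF).2 h2, fun z hz => ?_⟩
  obtain ⟨Z, hZ, -, -, rfl, -⟩ := exists_of_pair_mem hz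
  have h3 := (pair_col_mem_col hZ hW hF).1 hz
  exact col_congr ((h.and (h1.and (h2.and h3))).mono fun γ ⟨h4, h5, h6, h7⟩ =>
    (h4.2 _ h5).unique h7 h6)

end System

/-! ### Satisfaction in the values of a function -/

section Sat

variable {v : ZFSet.{u}} {n : ℕ} {x : ℕ → ZFSet.{u}}

theorem Sat.mem {φ : LSet.BoundedFormula Empty n} (h : Sat v φ x) {i : ℕ} (hi : i < n) : x i ∈ v :=
  h.1 ⟨i, hi⟩

theorem sat_iff {φ : LSet.BoundedFormula Empty n} (h : ∀ i : Fin n, x i ∈ v) :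
    Sat v φ x ↔ φ.Realize (M := v) default fun i => ⟨x i, h i⟩ :=
  ⟨fun h => h.2, fun h' => ⟨h, h'⟩⟩

theorem sat_congr {φ : LSet.BoundedFormula Empty n} {y : ℕ → ZFSet.{u}}
    (h : ∀ i < n, x i = y i) : Sat v φ x ↔ Sat v φ y := by
  have h1 : (fun i : Fin n => x i) = fun i : Fin n => y i := funext fun i => h i i.2
  unfold Sat
  constructor
  · rintro ⟨h2, h3⟩
    refine ⟨fun i => h i i.2 ▸ h2 i, ?_⟩
    convert h3 using 3 with i
    exact (h i i.2).symm
  · rintro ⟨h2, h3⟩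
    refine ⟨fun i => (h i i.2).symm ▸ h2 i, ?_⟩
    convert h3 using 3 with i
    exact h i i.2

theorem sat_imp {φ ψ : LSet.BoundedFormula Empty n} (h : ∀ i : Fin n, x i ∈ v) :
    Sat v (φ.imp ψ) x ↔ (Sat v φ x → Sat v ψ x) := by
  rw [sat_iff h, sat_iff h, sat_iff h, BoundedFormula.realize_imp]

theorem sat_not {φ : LSet.BoundedFormula Empty n} (h : ∀ i : Fin n, x i ∈ v) :
    Sat v (∼φ) x ↔ ¬ Sat v φ x := by
  rw [sat_iff h, sat_iff h, BoundedFormula.realize_not]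

/-- The first `n` terms of `x`, followed by `w`. -/
def extend (n : ℕ) (x : ℕ → ZFSet.{u}) (w : ZFSet.{u}) : ℕ → ZFSet.{u} :=
  fun i => if i < n then x i else w

theorem mem_extend (h : ∀ i : Fin n, x i ∈ v) {w : ZFSet.{u}} (hw : w ∈ v) (i : Fin (n + 1)) :
    extend n x w i ∈ v := by
  unfold extend
  split_ifs with hi
  · exact h ⟨i, hi⟩
  · exact hw

theorem snoc_eq (h : ∀ i : Fin n, x i ∈ v) {w : ZFSet.{u}} (hw : w ∈ v) :
    (Fin.snoc (fun i : Fin n => (⟨x i, h i⟩ : v)) ⟨w, hw⟩ : Fin (n + 1) → v) =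
      fun i : Fin (n + 1) => ⟨extend n x w i, mem_extend h hw i⟩ := by
  funext i
  refine Fin.lastCases ?_ (fun i => ?_) i
  · simp [extend]
  · simp [extend]

theorem sat_all {φ : LSet.BoundedFormula Empty (n + 1)} (h : ∀ i : Fin n, x i ∈ v) :
    Sat v (∀' φ) x ↔ ∀ w ∈ v, Sat v φ (extend n x w) := by
  rw [sat_iff h, BoundedFormula.realize_all]
  constructor
  · intro h1 w hw
    rw [sat_iff (mem_extend h hw), ← snoc_eq h hw]
    exact h1 ⟨w, hw⟩
  · rintro h1 ⟨w, hw⟩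
    rw [snoc_eq h hw, ← sat_iff (mem_extend h hw)]
    exact h1 w hw

end Sat

theorem exists_term_eq {n : ℕ} (t : LSet.Term (Empty ⊕ Fin n)) :
    ∃ i, t = Term.var (Sum.inr i) := by
  cases t with
  | var a =>
    rcases a with a | i
    · exact a.elim
    · exact ⟨i, rfl⟩
  | func f _ => exact f.elim

namespace System

variable {κ : Cardinal.{u}} [hκ : Fact κ.IsInaccessible] {A : ZFSet.{u}} {S : System κ (preds A)}

variable (S) in
/-- The set `s` consists of the collapses of those functions in `𝔊` that take values in `v`, where
`𝔊` is closed under Skolem functions for the structures `v γ`. -/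
structure IsHull (𝔊 : Set (Fn κ)) (v : Fn κ) (s : ZFSet.{u}) : Prop where
  subset : 𝔊 ⊆ S.Fs
  mem_Fs : v ∈ S.Fs
  mem_iff : ∀ x, x ∈ s ↔ ∃ F ∈ 𝔊, (∀ᶠ γ in S.ev, F γ ∈ v γ) ∧ S.col F = x
  skolem : ∀ (n : ℕ) (φ : LSet.BoundedFormula Empty (n + 1)) (F : ℕ → Fn κ),
    (∀ i < n, F i ∈ 𝔊) →
    (∀ᶠ γ in S.ev, ∀ w ∈ v γ, ¬ Sat (v γ) φ (extend n (fun i => F i γ) w)) ∨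
      ∃ W ∈ 𝔊, ∀ᶠ γ in S.ev, Sat (v γ) φ (extend n (fun i => F i γ) (W γ))

/-- A witness is found in the same level as the structure and the parameters, so a single level
already yields an elementary submodel. -/
theorem skolem_lev {v : Fn κ} {m : ℕ} (hv : v ∈ S.lev m) (n : ℕ)
    (φ : LSet.BoundedFormula Empty (n + 1)) (F : ℕ → Fn κ) (hF : ∀ i < n, F i ∈ S.lev m) :
    (∀ᶠ γ in S.ev, ∀ w ∈ v γ, ¬ Sat (v γ) φ (extend n (fun i => F i γ) w)) ∨
      ∃ W ∈ S.lev m, ∀ᶠ γ in S.ev, Sat (v γ) φ (extend n (fun i => F i γ) (W γ)) := by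
  -- Position `0` holds the structure and the parameters follow; the remaining positions are
  -- padding.
  let G : ℕ → Fn κ := fun i => if i - 1 < n ∧ i ≠ 0 then F (i - 1) else v
  have hG : ∀ i, G i ∈ S.lev m := fun i => by
    by_cases h : i - 1 < n ∧ i ≠ 0
    · simp only [G, if_pos h]
      exact hF _ h.1
    · simp only [G, if_neg h]
      exact hv
  have key : ∀ γ w, skolemPred φ w (fun i => G i γ) ↔
      Sat (v γ) φ (extend n (fun i => F i γ) w) := by
    intro γ w
    have h0 : G 0 γ = v γ := by simp [G]
    simp only [skolemPred, h0]
    refine sat_congr fun i _ => ?_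
    by_cases h : i < n
    · simp [h, G, extend]
    · simp [h, extend]
  rcases dichotomy (skolemPred_mem φ) G hG with h | ⟨W, hW, h⟩
  · exact Or.inl (h.mono fun γ h w hw h1 => h w ((ZFSet.rank_lt_of_mem hw).trans
      (rank_Fn_lt (lev_subset_Fs hv) γ)) ((key γ w).2 h1))
  · exact Or.inr ⟨W, hW, h.mono fun γ h => (key γ _).1 h⟩

theorem isHull_lev {v : Fn κ} {m : ℕ} (hv : v ∈ S.lev m) {s : ZFSet.{u}}
    (hs : ∀ x, x ∈ s ↔ ∃ F ∈ S.lev m, (∀ᶠ γ in S.ev, F γ ∈ v γ) ∧ S.col F = x) :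
    S.IsHull (S.lev m) v s :=
  ⟨lev_subset_Fs, lev_subset_Fs hv, hs, skolem_lev hv⟩

theorem exists_lev_forall {n : ℕ} {F : ℕ → Fn κ} (hF : ∀ i < n, F i ∈ S.Fs) (k : ℕ) :
    ∃ m, k ≤ m ∧ ∀ i < n, F i ∈ S.lev m := by
  induction n with
  | zero => exact ⟨k, le_rfl, by simp⟩
  | succ n ih =>
    obtain ⟨m, hm, h⟩ := ih fun i hi => hF i (hi.trans n.lt_succ_self)
    obtain ⟨l, hl⟩ := hF n n.lt_succ_self
    refine ⟨max m l, hm.trans (le_max_left _ _), fun i hi => ?_⟩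
    rcases Nat.lt_succ_iff_lt_or_eq.1 hi with hi | rfl
    · exact lev_mono (le_max_left _ _) (h i hi)
    · exact lev_mono (le_max_right _ _) hl

theorem isHull_col {v : Fn κ} (hv : v ∈ S.Fs) : S.IsHull S.Fs v (S.col v) := by
  refine ⟨subset_rfl, hv, fun _ => mem_col, fun n φ F hF => ?_⟩
  obtain ⟨k, hk⟩ := hv
  obtain ⟨m, hm, h⟩ := exists_lev_forall hF k
  refine (skolem_lev (lev_mono hm hk) n φ F h).imp_right ?_
  rintro ⟨W, hW, h1⟩
  exact ⟨W, ⟨m, hW⟩, h1⟩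

namespace IsHull

variable {𝔊 : Set (Fn κ)} {v : Fn κ} {s : ZFSet.{u}}

theorem ev_forall_mem {n : ℕ} {F : ℕ → Fn κ} (hm : ∀ i < n, ∀ᶠ γ in S.ev, F i γ ∈ v γ) :
    ∀ᶠ γ in S.ev, ∀ i : Fin n, F i γ ∈ v γ :=
  eventually_all.2 fun i => hm i i.2

/-- A version of Łoś's theorem. -/
theorem los_aux (h : S.IsHull 𝔊 v s) {n : ℕ} (φ : LSet.BoundedFormula Empty n) :
    ∀ (F : ℕ → Fn κ), (∀ i < n, F i ∈ 𝔊) → (∀ i < n, ∀ᶠ γ in S.ev, F i γ ∈ v γ) →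
    ∀ x : Fin n → s, (∀ i : Fin n, S.col (F i) = (x i : ZFSet.{u})) →
    (φ.Realize default x → ∀ᶠ γ in S.ev, Sat (v γ) φ fun i => F i γ) ∧
      (¬ φ.Realize default x → ∀ᶠ γ in S.ev, ¬ Sat (v γ) φ fun i => F i γ) := by
  -- Truth and falsity must both be shown to be eventual, since an arbitrary set of sequences need
  -- not be decided by the filter.
  induction φ with
  | falsum =>
    intro F _ _ x _
    refine ⟨fun h => h.elim, fun _ => Eventually.of_forall fun γ h => h.2⟩
  | @equal n t₁ t₂ =>
    intro F hF hm x hx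
    obtain ⟨i, rfl⟩ := exists_term_eq t₁
    obtain ⟨j, rfl⟩ := exists_term_eq t₂
    have h1 : (BoundedFormula.equal (L := LSet) (Term.var (Sum.inr i)) (Term.var (Sum.inr j)) :
        LSet.BoundedFormula Empty n).Realize default x ↔ S.col (F i) = S.col (F j) := by
      rw [hx, hx, ← Subtype.ext_iff]; rfl
    have h2 : ∀ᶠ γ in S.ev, (Sat (v γ) (BoundedFormula.equal (L := LSet) (Term.var (Sum.inr i))
        (Term.var (Sum.inr j)) : LSet.BoundedFormula Empty n) fun i => F i γ) ↔ F i γ = F j γ :=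
      (ev_forall_mem hm).mono fun γ h => by
        rw [sat_iff h]
        exact Subtype.ext_iff
    rw [h1, col_eq_col (h.subset (hF i i.2)) (h.subset (hF j j.2))]
    refine ⟨fun h3 => (h2.and h3).mono fun γ h => h.1.2 h.2, fun h3 => ?_⟩
    exact (h2.and ((ev_eq_or (h.subset (hF i i.2)) (h.subset (hF j j.2))).resolve_left h3)).mono
      fun γ h h4 => h.2 (h.1.1 h4)
  | @rel n l R ts =>
    intro F hF hm x hx
    cases R
    choose k hk using fun i => exists_term_eq (ts i)
    obtain rfl := funext hk
    have h1 : (BoundedFormula.rel (L := LSet) SetRel.mem (fun i => Term.var (Sum.inr (k i))) :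
        LSet.BoundedFormula Empty n).Realize default x ↔ S.col (F (k 0)) ∈ S.col (F (k 1)) := by
      rw [hx, hx]; rfl
    have h2 : ∀ᶠ γ in S.ev, (Sat (v γ) (BoundedFormula.rel (L := LSet) SetRel.mem
        (fun i => Term.var (Sum.inr (k i))) : LSet.BoundedFormula Empty n) fun i => F i γ) ↔
        F (k 0) γ ∈ F (k 1) γ :=
      (ev_forall_mem hm).mono fun γ h => by
        rw [sat_iff h]
        rfl
    have hF' := fun i => h.subset (hF (k i) (k i).2)
    rw [h1, col_mem_col (hF' 0) (hF' 1)]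
    refine ⟨fun h3 => (h2.and h3).mono fun γ h => h.1.2 h.2, fun h3 => ?_⟩
    exact (h2.and ((ev_mem_or (hF' 0) (hF' 1)).resolve_left h3)).mono
      fun γ h h4 => h.2 (h.1.1 h4)
  | @imp n φ ψ ihφ ihψ =>
    intro F hF hm x hx
    have h1 := ev_forall_mem hm
    obtain ⟨h2, h3⟩ := ihφ F hF hm x hx
    obtain ⟨h4, h5⟩ := ihψ F hF hm x hx
    rw [BoundedFormula.realize_imp]
    constructor
    · intro h6
      by_cases h7 : φ.Realize default x
      · exact (h1.and (h4 (h6 h7))).mono fun γ h => (sat_imp h.1).2 fun _ => h.2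
      · exact (h1.and (h3 h7)).mono fun γ h => (sat_imp h.1).2 fun h' => absurd h' h.2
    · intro h6
      rw [Classical.not_imp] at h6
      exact (h1.and ((h2 h6.1).and (h5 h6.2))).mono fun γ h h' =>
        h.2.2 ((sat_imp h.1).1 h' h.2.1)
  | @all n φ ih =>
    intro F hF hm x hx
    have h1 := ev_forall_mem hm
    have key : ∀ W ∈ 𝔊, (∀ᶠ γ in S.ev, W γ ∈ v γ) → ∃ a : s, (a : ZFSet.{u}) = S.col W ∧
        (φ.Realize default (Fin.snoc x a : Fin (n + 1) → s) →
          ∀ᶠ γ in S.ev, Sat (v γ) φ (extend n (fun i => F i γ) (W γ))) ∧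
        (¬ φ.Realize default (Fin.snoc x a : Fin (n + 1) → s) →
          ∀ᶠ γ in S.ev, ¬ Sat (v γ) φ (extend n (fun i => F i γ) (W γ))) := by
      intro W hW hWv
      refine ⟨⟨S.col W, (h.mem_iff _).2 ⟨W, hW, hWv, rfl⟩⟩, rfl, ?_⟩
      have := ih (fun i => if i < n then F i else W) (fun i _ => by
        split_ifs with hi
        exacts [hF i hi, hW]) (fun i _ => by
        split_ifs with hi
        exacts [hm i hi, hWv]) (Fin.snoc x ⟨S.col W, (h.mem_iff _).2 ⟨W, hW, hWv, rfl⟩⟩) (fun i => by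
        refine Fin.lastCases ?_ (fun i => ?_) i
        · simp
        · simp [hx])
      have h3 : ∀ γ, (fun i => (if i < n then F i else W) γ) = extend n (fun i => F i γ) (W γ) :=
        fun γ => funext fun i => by simp only [extend, ite_apply]
      simpa only [h3] using this
    rw [BoundedFormula.realize_all]
    -- Either there is eventually no counterexample, or one is chosen by a function from the hull
    -- and refutes the universal statement on both sides.
    rcases h.skolem n (∼φ) F hF with h2 | ⟨W, hW, h2⟩
    · constructor
      · intro _
        refine (h1.and h2).mono fun γ ⟨h3, h4⟩ => (sat_all h3).2 fun w hw => ?_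
        by_contra h5
        exact h4 w hw ((sat_not (mem_extend h3 hw)).2 h5)
      · intro h3
        push Not at h3
        obtain ⟨a, ha⟩ := h3
        obtain ⟨W, hW, hWv, hWa⟩ := (h.mem_iff _).1 a.2
        obtain ⟨a', ha', -, h4⟩ := key W hW hWv
        obtain rfl : a' = a := Subtype.ext (ha'.trans hWa)
        obtain ⟨γ, h5, h6, h7, h8⟩ := (h1.and (h2.and ((h4 ha).and hWv))).exists
        exact (h6 _ h8 ((sat_not (mem_extend h5 h8)).2 h7)).elim
    · have hWv : ∀ᶠ γ in S.ev, W γ ∈ v γ := h2.mono fun γ h => by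
        simpa [extend] using h.mem n.lt_succ_self
      obtain ⟨a, -, h3, -⟩ := key W hW hWv
      have h4 : ∀ᶠ γ in S.ev, ¬ Sat (v γ) φ (extend n (fun i => F i γ) (W γ)) :=
        (h1.and (h2.and hWv)).mono fun γ ⟨h3, h4, h5⟩ => (sat_not (mem_extend h3 h5)).1 h4
      constructor
      · intro h5
        obtain ⟨γ, h6, h7⟩ := (h4.and (h3 (h5 a))).exists
        exact (h6 h7).elim
      · intro _
        exact (h1.and (h4.and hWv)).mono fun γ ⟨h3, h4, h5⟩ h6 => h4 ((sat_all h3).1 h6 _ h5)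

end IsHull

end System

/-! ### The meaning of the axioms in a structure -/

section Realize

variable {M : ZFSet.{u}} {α : Type*} {m : ℕ}

theorem relMap_memSym {a b : M} :
    Structure.RelMap memSym ![a, b] ↔ (a : ZFSet.{u}) ∈ (b : ZFSet.{u}) := Iff.rfl

theorem realize_sub {n k : ℕ} {φ : LSet.Formula (Fin n ⊕ Fin k)} {w : Fin k → Fin m}
    {p : Fin n → M} {xs : Fin m → M} :
    (sub φ w).Realize p xs ↔ φ.Realize (Sum.elim p (xs ∘ w)) := by
  rw [sub, BoundedFormula.realize_relabel, Formula.Realize]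
  have : Sum.elim p (xs ∘ Fin.castAdd 0) ∘ Sum.map id w = Sum.elim p (xs ∘ w) := by
    funext a; rcases a with a | a <;> rfl
  rw [this]
  exact iff_of_eq (congrArg _ (Subsingleton.elim _ _))

theorem comp_vec₁ {β γ : Type*} (f : β → γ) (a : β) : f ∘ ![a] = ![f a] := by
  funext i; fin_cases i; rfl

theorem comp_vec₂ {β γ : Type*} (f : β → γ) (a b : β) : f ∘ ![a, b] = ![f a, f b] := by
  funext i; fin_cases i <;> rfl

theorem realize_closure {n : ℕ} {φ : LSet.Formula (Fin n)} :
    M ⊨ closure φ ↔ ∀ p : Fin n → M, φ.Realize p := by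
  rw [closure, Sentence.Realize, Formula.realize_iAlls]
  simp only [Formula.realize_relabel]
  rfl

theorem realize_extensionality : M ⊨ extensionality ↔
    ∀ x ∈ M, ∀ y ∈ M, (∀ z ∈ M, z ∈ x ↔ z ∈ y) → x = y := by
  simp [extensionality, Sentence.Realize, Formula.Realize, relMap_memSym, Fin.snoc]

theorem realize_foundation : M ⊨ foundation ↔
    ∀ x : M, (∃ y : M, y.1 ∈ x.1) → ∃ y : M, y.1 ∈ x.1 ∧ ∀ z : M, z.1 ∈ y.1 → z.1 ∉ x.1 := by
  simp [foundation, Sentence.Realize, Formula.Realize, relMap_memSym, Fin.snoc]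

theorem realize_pairing : M ⊨ pairing ↔
    ∀ x ∈ M, ∀ y ∈ M, ∃ p ∈ M, ∀ z ∈ M, z ∈ p ↔ z = x ∨ z = y := by
  simp [pairing, Sentence.Realize, Formula.Realize, relMap_memSym, Fin.snoc]

theorem realize_union : M ⊨ union ↔
    ∀ x : M, ∃ y : M, ∀ z : M, z.1 ∈ y.1 ↔ ∃ w : M, w.1 ∈ x.1 ∧ z.1 ∈ w.1 := by
  simp [union, Sentence.Realize, Formula.Realize, relMap_memSym, Fin.snoc]

theorem realize_infinity : M ⊨ infinity ↔
    ∃ x : M, (∃ y : M, y.1 ∈ x.1 ∧ ∀ z : M, z.1 ∉ y.1) ∧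
      ∀ y : M, y.1 ∈ x.1 → ∃ s : M, s.1 ∈ x.1 ∧ ∀ z : M, z.1 ∈ s.1 ↔ z.1 ∈ y.1 ∨ z = y := by
  simp [infinity, Sentence.Realize, Formula.Realize, relMap_memSym, Fin.snoc]

theorem realize_powerSet : M ⊨ powerSet ↔
    ∀ x ∈ M, ∃ y ∈ M, ∀ z ∈ M, z ∈ y ↔ ∀ w ∈ M, w ∈ z → w ∈ x := by
  simp [powerSet, Sentence.Realize, Formula.Realize, relMap_memSym, Fin.snoc]

theorem realize_choice : M ⊨ choice ↔
    ∀ x : M, (∀ y : M, y.1 ∈ x.1 → ∃ z : M, z.1 ∈ y.1) →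
      (∀ y y' : M, y.1 ∈ x.1 → y'.1 ∈ x.1 → (∃ z : M, z.1 ∈ y.1 ∧ z.1 ∈ y'.1) → y = y') →
      ∃ c : M, ∀ y : M, y.1 ∈ x.1 → ∃ w : M, ∀ z : M, z.1 ∈ y.1 ∧ z.1 ∈ c.1 ↔ z = w := by
  simp [choice, Sentence.Realize, Formula.Realize, relMap_memSym, Fin.snoc]

theorem realize_separation {n : ℕ} (φ : LSet.Formula (Fin n ⊕ Fin 1)) : M ⊨ separation φ ↔
    ∀ p : Fin n → M, ∀ a : M, ∃ b : M, ∀ x : M, (x : ZFSet.{u}) ∈ (b : ZFSet.{u}) ↔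
      (x : ZFSet.{u}) ∈ (a : ZFSet.{u}) ∧ φ.Realize (Sum.elim p ![x]) := by
  rw [separation, realize_closure]
  simp [Formula.Realize, relMap_memSym, Fin.snoc, realize_sub, comp_vec₁]

theorem realize_collection {n : ℕ} (φ : LSet.Formula (Fin n ⊕ Fin 2)) : M ⊨ collection φ ↔
    ∀ p : Fin n → M, ∀ a : M,
      (∀ x : M, (x : ZFSet.{u}) ∈ (a : ZFSet.{u}) → ∃ y : M, φ.Realize (Sum.elim p ![x, y])) →
      ∃ b : M, ∀ x : M, (x : ZFSet.{u}) ∈ (a : ZFSet.{u}) →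
        ∃ y : M, (y : ZFSet.{u}) ∈ (b : ZFSet.{u}) ∧ φ.Realize (Sum.elim p ![x, y]) := by
  rw [collection, realize_closure]
  simp [Formula.Realize, relMap_memSym, Fin.snoc, realize_sub, comp_vec₂]

theorem realize_replacement {n : ℕ} (φ : LSet.Formula (Fin n ⊕ Fin 2)) : M ⊨ replacement φ ↔
    ∀ p : Fin n → M, ∀ a : M,
      (∀ x : M, (x : ZFSet.{u}) ∈ (a : ZFSet.{u}) → ∀ y y' : M, φ.Realize (Sum.elim p ![x, y]) →
        φ.Realize (Sum.elim p ![x, y']) → y = y') →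
      ∃ b : M, ∀ y : M, (y : ZFSet.{u}) ∈ (b : ZFSet.{u}) ↔
        ∃ x : M, (x : ZFSet.{u}) ∈ (a : ZFSet.{u}) ∧ φ.Realize (Sum.elim p ![x, y]) := by
  rw [replacement, realize_closure]
  simp [Formula.Realize, relMap_memSym, Fin.snoc, realize_sub, comp_vec₂]

theorem realize_pairMem (v : Fin 3 → M) : pairMem.Realize v ↔
    ∃ p : M, p.1 ∈ (v 0).1 ∧
    ∀ q : M, q.1 ∈ p.1 ↔ (∀ z : M, z.1 ∈ q.1 ↔ z = v 1) ∨ (∀ z : M, z.1 ∈ q.1 ↔ z = v 1 ∨ z = v 2) := by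
  simp [pairMem, Formula.Realize, relMap_memSym, Fin.snoc]

theorem realize_pairIn {r x y : Fin m} {p : Empty → M} {xs : Fin m → M} :
    (pairIn r x y).Realize p xs ↔ pairMem.Realize ![xs r, xs x, xs y] := by
  rw [pairIn, BoundedFormula.realize_relabel, Formula.Realize]
  have : Sum.elim p (xs ∘ Fin.castAdd 0) ∘ (fun i => Sum.inr (![r, x, y] i)) =
      ![xs r, xs x, xs y] := by
    funext i
    fin_cases i <;> rfl
  rw [this]
  exact iff_of_eq (congrArg _ (Subsingleton.elim _ _))

theorem realize_wellOrdering (hM : ∀ r x y : M, pairMem.Realize ![r, x, y] ↔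
      ZFSet.pair (x : ZFSet.{u}) y ∈ (r : ZFSet.{u})) : M ⊨ wellOrdering ↔
    ∀ a : M, ∃ r : M, (∀ x : M, x.1 ∈ a.1 → ZFSet.pair x.1 x.1 ∉ r.1) ∧
      (∀ x y z : M, x.1 ∈ a.1 → y.1 ∈ a.1 → z.1 ∈ a.1 → ZFSet.pair x.1 y.1 ∈ r.1 →
        ZFSet.pair y.1 z.1 ∈ r.1 → ZFSet.pair x.1 z.1 ∈ r.1) ∧
      (∀ x y : M, x.1 ∈ a.1 → y.1 ∈ a.1 →
        (ZFSet.pair x.1 y.1 ∈ r.1 ∨ x = y) ∨ ZFSet.pair y.1 x.1 ∈ r.1) ∧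
      ∀ b : M, (∃ x : M, x.1 ∈ b.1) → (∀ x : M, x.1 ∈ b.1 → x.1 ∈ a.1) →
        ∃ x : M, x.1 ∈ b.1 ∧ ∀ y : M, y.1 ∈ b.1 → y = x ∨ ZFSet.pair x.1 y.1 ∈ r.1 := by
  simp only [Formula.Realize] at hM
  simp [wellOrdering, Sentence.Realize, Formula.Realize, relMap_memSym, Fin.snoc, realize_pairIn,
    hM, and_assoc]

end Realize

/-! ### The universe below an inaccessible cardinal -/

section Inaccessible

variable {κ : Cardinal.{u}} (hκ : κ.IsInaccessible)

theorem mem_V {x : ZFSet.{u}} : x ∈ ZFSet.vonNeumann κ.ord ↔ x.rank < κ.ord := ZFSet.mem_vonNeumann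

theorem mem_V_of_mem {x y : ZFSet.{u}} (h : x ∈ y) (hy : y ∈ ZFSet.vonNeumann κ.ord) :
    x ∈ ZFSet.vonNeumann κ.ord := (ZFSet.isTransitive_vonNeumann _).mem_trans h hy

include hκ

theorem isSuccLimit_ord_of_isInaccessible : Order.IsSuccLimit κ.ord :=
  isSuccLimit_ord hκ.aleph0_lt.le

/-- Every function from a set in `V_κ` to `V_κ` has its range in `V_κ`. -/
theorem exists_image_mem_V {a : ZFSet.{u}} (ha : a ∈ ZFSet.vonNeumann κ.ord)
    (g : ZFSet.{u} → ZFSet.{u}) (hg : ∀ u ∈ a, g u ∈ ZFSet.vonNeumann κ.ord) :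
    ∃ b ∈ ZFSet.vonNeumann κ.ord, ∀ y, y ∈ b ↔ ∃ u ∈ a, g u = y := by
  obtain ⟨l, f, rfl⟩ := exists_range_eq (card_lt_of_rank_lt hκ (mem_V.1 ha))
  refine ⟨ZFSet.range fun i => g (f i), mem_V.2 (rank_range_lt hκ.isRegular
    (mk_Iio_lt_of_ord l) fun i => mem_V.1 (hg _ (ZFSet.mem_range_self i))), fun y => ?_⟩
  simp [ZFSet.mem_range]

theorem double_mem_V {x y : ZFSet.{u}} (hx : x ∈ ZFSet.vonNeumann κ.ord)
    (hy : y ∈ ZFSet.vonNeumann κ.ord) : ({x, y} : ZFSet.{u}) ∈ ZFSet.vonNeumann κ.ord :=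
  mem_V.2 (rank_double_lt (isSuccLimit_ord_of_isInaccessible hκ) (mem_V.1 hx) (mem_V.1 hy))

/-- `V_κ` is transitive and closed under unordered pairs, so the formula for Kuratowski pairs has
its true meaning there. -/
theorem pairMem_V (r x y : ZFSet.vonNeumann κ.ord) :
    pairMem.Realize ![r, x, y] ↔ ZFSet.pair x.1 y.1 ∈ r.1 := by
  have h1 : ∀ q a b : ZFSet.vonNeumann κ.ord,
      (∀ z : ZFSet.vonNeumann κ.ord, z.1 ∈ q.1 ↔ z = a ∨ z = b) ↔ q.1 = {a.1, b.1} := by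
    intro q a b
    constructor
    · intro h
      ext z
      rw [ZFSet.mem_pair]
      constructor
      · intro hz
        simpa [Subtype.ext_iff] using (h ⟨z, mem_V_of_mem hz q.2⟩).1 hz
      · rintro (rfl | rfl)
        · exact (h a).2 (Or.inl rfl)
        · exact (h b).2 (Or.inr rfl)
    · intro h z
      rw [h, ZFSet.mem_pair, Subtype.ext_iff, Subtype.ext_iff]
  have h2 : ∀ q a : ZFSet.vonNeumann κ.ord,
      (∀ z : ZFSet.vonNeumann κ.ord, z.1 ∈ q.1 ↔ z = a) ↔ q.1 = {a.1, a.1} := by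
    intro q a
    have := h1 q a a
    simp only [or_self] at this
    exact this
  rw [realize_pairMem]
  simp only [h1, h2, Matrix.cons_val]
  rw [System.pair_eq_double]
  constructor
  · rintro ⟨p, hp, h⟩
    convert hp using 1
    symm
    ext q
    rw [ZFSet.mem_pair]
    constructor
    · intro hq
      exact (h ⟨q, mem_V_of_mem hq p.2⟩).1 hq
    · rintro (rfl | rfl)
      · exact (h ⟨_, double_mem_V hκ x.2 x.2⟩).2 (Or.inl rfl)
      · exact (h ⟨_, double_mem_V hκ x.2 y.2⟩).2 (Or.inr rfl)
  · intro h
    exact ⟨⟨_, mem_V_of_mem h r.2⟩, h, fun q => ZFSet.mem_pair⟩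

theorem V_models_baseAxioms : ZFSet.vonNeumann κ.ord ⊨ baseAxioms := by
  have hlim := isSuccLimit_ord_of_isInaccessible hκ
  refine ⟨?_⟩
  rintro σ ((rfl | rfl | rfl | rfl | rfl) | ⟨n, φ, rfl⟩)
  · rw [realize_extensionality]
    intro x hx y hy h
    ext z
    exact ⟨fun hz => (h z (mem_V_of_mem hz hx)).1 hz, fun hz => (h z (mem_V_of_mem hz hy)).2 hz⟩
  · rw [realize_foundation]
    rintro x ⟨y, hy⟩
    obtain ⟨z, hz, h⟩ := ZFSet.regularity x.1 (by rintro h; rw [h] at hy; simp at hy)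
    refine ⟨⟨z, mem_V_of_mem hz x.2⟩, hz, fun w hw hx => ?_⟩
    have : w.1 ∈ x.1 ∩ z := ZFSet.mem_inter.2 ⟨hx, hw⟩
    rw [h] at this
    simp at this
  · rw [realize_pairing]
    exact fun x hx y hy => ⟨_, double_mem_V hκ hx hy, fun z _ => ZFSet.mem_pair⟩
  · rw [realize_union]
    intro x
    refine ⟨⟨ZFSet.sUnion x.1, mem_V.2 ((ZFSet.rank_sUnion_le _).trans_lt (mem_V.1 x.2))⟩,
      fun z => ?_⟩
    rw [ZFSet.mem_sUnion]
    exact ⟨fun ⟨w, h1, h2⟩ => ⟨⟨w, mem_V_of_mem h1 x.2⟩, h1, h2⟩, fun ⟨w, h1, h2⟩ => ⟨w, h1, h2⟩⟩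
  · rw [realize_infinity]
    have hω : ω < κ.ord := by rw [← ord_aleph0]; exact ord_lt_ord.2 hκ.aleph0_lt
    refine ⟨⟨(ω : Ordinal.{u}).toZFSet, mem_V.2 (by simpa using hω)⟩,
      ⟨⟨(0 : Ordinal.{u}).toZFSet, mem_V.2 (by simpa using zero_le.trans_lt hω)⟩,
        toZFSet_mem_toZFSet_iff.2 omega0_pos, by simp⟩, ?_⟩
    rintro ⟨y, hy⟩ h
    obtain ⟨a, ha, rfl⟩ := mem_toZFSet_iff.1 h
    have ha' : Order.succ a < ω := isSuccLimit_omega0.succ_lt ha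
    refine ⟨⟨(Order.succ a).toZFSet, mem_V.2 (by simpa using ha'.trans hω)⟩,
      toZFSet_mem_toZFSet_iff.2 ha', fun z => ?_⟩
    rw [Subtype.ext_iff]
    simp only [mem_toZFSet_iff, Order.lt_succ_iff, le_iff_lt_or_eq]
    constructor
    · rintro ⟨b, hb | rfl, hz⟩
      · exact Or.inl ⟨b, hb, hz⟩
      · exact Or.inr hz.symm
    · rintro (⟨b, hb, hz⟩ | hz)
      · exact ⟨b, Or.inl hb, hz⟩
      · exact ⟨a, Or.inr rfl, hz.symm⟩
  · rw [realize_separation]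
    intro p a
    refine ⟨⟨a.1.sep fun x => ∃ h : x ∈ ZFSet.vonNeumann κ.ord,
      φ.Realize (Sum.elim p ![⟨x, h⟩]), ZFSet.mem_vonNeumann_of_subset ZFSet.sep_subset a.2⟩,
      fun x => ?_⟩
    rw [ZFSet.mem_sep]
    exact and_congr_right fun _ => ⟨fun ⟨_, h⟩ => h, fun h => ⟨x.2, h⟩⟩

theorem V_models_collection {n : ℕ} (φ : LSet.Formula (Fin n ⊕ Fin 2)) :
    ZFSet.vonNeumann κ.ord ⊨ collection φ := by
  classical
  rw [realize_collection]
  intro p a h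
  choose! g hg using h
  obtain ⟨b, hb, h1⟩ := exists_image_mem_V hκ a.2
    (fun x => if hx : x ∈ ZFSet.vonNeumann κ.ord then (g ⟨x, hx⟩).1 else ∅) (fun u hu => by
      rw [dif_pos (mem_V_of_mem hu a.2)]
      exact (g _).2)
  refine ⟨⟨b, hb⟩, fun x hx => ⟨g x, (h1 _).2 ⟨x, hx, by rw [dif_pos x.2]⟩, hg x hx⟩⟩

theorem V_models_replacement {n : ℕ} (φ : LSet.Formula (Fin n ⊕ Fin 2)) :
    ZFSet.vonNeumann κ.ord ⊨ replacement φ := by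
  classical
  rw [realize_replacement]
  intro p a h
  obtain ⟨b, hb, h1⟩ := exists_image_mem_V hκ a.2
    (fun x => if hx : ∃ (h : x ∈ ZFSet.vonNeumann κ.ord) (y : ZFSet.vonNeumann κ.ord),
      φ.Realize (Sum.elim p ![⟨x, h⟩, y]) then hx.choose_spec.choose.1 else ∅) (fun u hu => by
      split_ifs with hx
      · exact hx.choose_spec.choose.2
      · exact mem_V.2 (by simpa using zero_le.trans_lt (mem_V.1 a.2)))
  refine ⟨⟨b.sep fun y => ∃ (x : ZFSet.vonNeumann κ.ord) (hy : y ∈ ZFSet.vonNeumann κ.ord),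
    x.1 ∈ a.1 ∧ φ.Realize (Sum.elim p ![x, ⟨y, hy⟩]),
    ZFSet.mem_vonNeumann_of_subset ZFSet.sep_subset hb⟩, fun y => ?_⟩
  rw [ZFSet.mem_sep]
  constructor
  · rintro ⟨-, x, _, h2, h3⟩
    exact ⟨x, h2, h3⟩
  · rintro ⟨x, h2, h3⟩
    refine ⟨(h1 _).2 ⟨x, h2, ?_⟩, x, y.2, h2, h3⟩
    have hx : ∃ (h : x.1 ∈ ZFSet.vonNeumann κ.ord) (y : ZFSet.vonNeumann κ.ord),
      φ.Realize (Sum.elim p ![⟨x, h⟩, y]) := ⟨x.2, y, h3⟩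
    rw [dif_pos hx]
    exact congrArg Subtype.val (h x h2 _ _ hx.choose_spec.choose_spec h3)

theorem V_models_powerSet : ZFSet.vonNeumann κ.ord ⊨ powerSet := by
  rw [realize_powerSet]
  intro x hx
  refine ⟨ZFSet.powerset x, mem_V.2 ?_, fun z hz => ?_⟩
  · rw [ZFSet.rank_powerset]
    exact (isSuccLimit_ord_of_isInaccessible hκ).succ_lt (mem_V.1 hx)
  · rw [ZFSet.mem_powerset]
    exact ⟨fun h w _ hw => h hw, fun h w hw => h w (mem_V_of_mem hw hz) hw⟩

theorem V_models_choice : ZFSet.vonNeumann κ.ord ⊨ choice := by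
  classical
  rw [realize_choice]
  intro x h1 h2
  choose! g hg using h1
  obtain ⟨b, hb, h3⟩ := exists_image_mem_V hκ x.2
    (fun y => if hy : y ∈ ZFSet.vonNeumann κ.ord then (g ⟨y, hy⟩).1 else ∅) (fun u hu => by
      rw [dif_pos (mem_V_of_mem hu x.2)]
      exact (g _).2)
  refine ⟨⟨b, hb⟩, fun y hy => ⟨g y, fun z => ?_⟩⟩
  constructor
  · rintro ⟨h4, h5⟩
    obtain ⟨y', h6, h7⟩ := (h3 _).1 h5
    have h8 := mem_V_of_mem h6 x.2
    rw [dif_pos h8] at h7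
    have h9 : g ⟨y', h8⟩ = z := Subtype.ext h7
    obtain rfl : ⟨y', h8⟩ = y := h2 _ _ h6 hy ⟨z, h9 ▸ hg _ h6, h4⟩
    exact h9.symm
  · rintro rfl
    exact ⟨hg y hy, (h3 _).2 ⟨y, hy, by rw [dif_pos y.2]⟩⟩

theorem V_models_wellOrdering : ZFSet.vonNeumann κ.ord ⊨ wellOrdering := by
  rw [realize_wellOrdering (pairMem_V hκ)]
  intro a
  let r := (ZFSet.prod a.1 a.1).sep fun p =>
    ∃ x y, p = ZFSet.pair x y ∧ WellOrderingRel x y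
  have hr : ∀ x y, ZFSet.pair x y ∈ r ↔ (x ∈ a.1 ∧ y ∈ a.1) ∧ WellOrderingRel x y := by
    intro x y
    rw [ZFSet.mem_sep, ZFSet.pair_mem_prod]
    refine and_congr_right fun _ => ⟨?_, fun h => ⟨x, y, rfl, h⟩⟩
    rintro ⟨x', y', h1, h2⟩
    obtain ⟨rfl, rfl⟩ := ZFSet.pair_inj.1 h1
    exact h2
  refine ⟨⟨r, ZFSet.mem_vonNeumann_of_subset ZFSet.sep_subset (mem_V.2 (rank_prod_lt
    (isSuccLimit_ord_of_isInaccessible hκ) (mem_V.1 a.2) (mem_V.1 a.2)))⟩, ?_, ?_, ?_, ?_⟩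
  · intro x _ h
    exact irrefl_of WellOrderingRel _ ((hr _ _).1 h).2
  · intro x y z hx hy hz h1 h2
    exact (hr _ _).2 ⟨⟨hx, hz⟩, trans_of WellOrderingRel ((hr _ _).1 h1).2 ((hr _ _).1 h2).2⟩
  · intro x y hx hy
    rcases trichotomous_of WellOrderingRel x.1 y.1 with h | h | h
    · exact Or.inl (Or.inl ((hr _ _).2 ⟨⟨hx, hy⟩, h⟩))
    · exact Or.inl (Or.inr (Subtype.ext h))
    · exact Or.inr ((hr _ _).2 ⟨⟨hy, hx⟩, h⟩)
  · rintro b ⟨x, hx⟩ h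
    have hwf : WellFounded (WellOrderingRel (α := ZFSet.{u})) := IsWellFounded.wf
    obtain ⟨m, hm, hmin⟩ := hwf.has_min {y | y ∈ b.1} ⟨x, hx⟩
    refine ⟨⟨m, mem_V_of_mem hm b.2⟩, hm, fun y hy => ?_⟩
    rcases trichotomous_of WellOrderingRel m y.1 with h1 | h1 | h1
    · exact Or.inr ((hr _ _).2 ⟨⟨h ⟨m, mem_V_of_mem hm b.2⟩ hm, h y hy⟩, h1⟩)
    · exact Or.inl (Subtype.ext h1.symm)
    · exact absurd h1 (hmin _ hy)

theorem V_models_ZFCMinus : ZFSet.vonNeumann κ.ord ⊨ ZFCMinus := by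
  refine ⟨?_⟩
  rintro σ ((h | rfl) | ⟨n, φ, rfl⟩)
  · exact (V_models_baseAxioms hκ).realize_of_mem σ h
  · exact V_models_wellOrdering hκ
  · exact V_models_collection hκ φ

theorem V_models_ZFC : ZFSet.vonNeumann κ.ord ⊨ ZFC := by
  refine ⟨?_⟩
  rintro σ ((h | rfl | rfl) | ⟨n, φ, rfl⟩)
  · exact (V_models_baseAxioms hκ).realize_of_mem σ h
  · exact V_models_powerSet hκ
  · exact V_models_choice hκ
  · exact V_models_replacement hκ φ

end Inaccessible

namespace System

variable {κ : Cardinal.{u}} [hκ : Fact κ.IsInaccessible] {A : ZFSet.{u}} {S : System κ (preds A)}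

/-! ### Elementarity -/

section Elementarity

variable {𝔊 𝔊' : Set (Fn κ)} {v v' : Fn κ} {s s' : ZFSet.{u}}

theorem IsHull.exists_fns (h : S.IsHull 𝔊 v s) {n : ℕ} (x : Fin n → s) :
    ∃ F : ℕ → Fn κ, (∀ i < n, F i ∈ 𝔊) ∧ (∀ i < n, ∀ᶠ γ in S.ev, F i γ ∈ v γ) ∧
      ∀ i : Fin n, S.col (F i) = (x i : ZFSet.{u}) := by
  choose F h1 h2 h3 using fun i => (h.mem_iff _).1 (x i).2
  refine ⟨fun i => if hi : i < n then F ⟨i, hi⟩ else v, fun i hi => ?_, fun i hi => ?_, fun i => ?_⟩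
  · simpa [hi] using h1 _
  · simpa [hi] using h2 ⟨i, hi⟩
  · simpa using h3 i

/-- Formulas are preserved between hulls if the assignments have the same values up to a shift. -/
theorem IsHull.realize_iff (h : S.IsHull 𝔊 v s) (h' : S.IsHull 𝔊' v' s')
    {n : ℕ} (φ : LSet.Formula (Fin n)) (x : Fin n → s) (x' : Fin n → s')
    (sft : Fn κ → Fn κ) (hv : v' = sft v)
    (hsft : ∀ P : ZFSet.{u} → (ℕ → ZFSet.{u}) → Prop, ∀ F : ℕ → Fn κ,
      (∀ᶠ γ in S.ev, P (v γ) fun i => F i γ) → ∀ᶠ γ in S.ev, P (sft v γ) fun i => sft (F i) γ)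
    (h𝔊 : ∀ F ∈ 𝔊, sft F ∈ 𝔊')
    (hx : ∀ i, ∀ F ∈ 𝔊, (∀ᶠ γ in S.ev, F γ ∈ v γ) → S.col F = (x i : ZFSet.{u}) →
      S.col (sft F) = x' i) :
    φ.Realize x' ↔ φ.Realize x := by
  -- In the applications `sft` is the identity, for inclusions between levels, or `sh`, for the
  -- embedding `j`. Both preserve eventual statements, so Łoś's theorem on the two sides gives the
  -- same truth value.
  obtain ⟨F, h1, h2, h3⟩ := h.exists_fns x
  subst hv
  have h4 := h.los_aux (BoundedFormula.relabel Sum.inr φ) F h1 h2 x h3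
  have h5 := h'.los_aux (BoundedFormula.relabel Sum.inr φ) (fun i => sft (F i))
    (fun i hi => h𝔊 _ (h1 i hi))
    (fun i hi => hsft (fun v y => y 0 ∈ v) (fun _ => F i) (h2 i hi)) x'
    (fun i => hx i _ (h1 i i.2) (h2 i i.2) (h3 i))
  have e1 : BoundedFormula.Realize (M := s) (BoundedFormula.relabel Sum.inr φ) default x ↔
    φ.Realize x := Formula.realize_relabel_sumInr φ
  have e2 : BoundedFormula.Realize (M := s') (BoundedFormula.relabel Sum.inr φ) default x' ↔
    φ.Realize x' := Formula.realize_relabel_sumInr φ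
  rw [e1] at h4
  rw [e2] at h5
  constructor
  · intro h6
    by_contra h7
    obtain ⟨γ, h8, h9⟩ := ((h5.1 h6).and
      (hsft (fun v y => ¬ Sat v (BoundedFormula.relabel Sum.inr φ) y) F (h4.2 h7))).exists
    exact h9 h8
  · intro h6
    by_contra h7
    obtain ⟨γ, h8, h9⟩ := ((h5.2 h7).and
      (hsft (fun v y => Sat v (BoundedFormula.relabel Sum.inr φ) y) F (h4.1 h6))).exists
    exact h8 h9

theorem IsHull.elemSub (h : S.IsHull 𝔊 v s) (h' : S.IsHull 𝔊' v s') (h𝔊 : 𝔊 ⊆ 𝔊') :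
    ElemSub s s' := by
  have hs : ∀ x ∈ s, x ∈ s' := fun x hx => by
    obtain ⟨F, h1, h2, h3⟩ := (h.mem_iff x).1 hx
    exact (h'.mem_iff x).2 ⟨F, h𝔊 h1, h2, h3⟩
  refine ⟨⟨fun x => ⟨x, hs x x.2⟩, fun {n} φ x => ?_⟩, fun x => rfl⟩
  exact h.realize_iff h' φ x _ id rfl (fun _ _ h => h) (fun F hF => h𝔊 hF) fun i F _ _ h => h

theorem ev_mem_sh {F v : Fn κ} (h : ∀ᶠ γ in S.ev, F γ ∈ v γ) : ∀ᶠ γ in S.ev, sh F γ ∈ sh v γ :=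
  ev_shift h

theorem col_sh_congr {F G : Fn κ} (hF : F ∈ S.Fs) (hG : G ∈ S.Fs) (h : S.col F = S.col G) :
    S.col (sh F) = S.col (sh G) :=
  col_congr (ev_shift (P := fun γ => F γ = G γ) ((col_eq_col hF hG).1 h))

/-- The embedding sends the collapse of `F` to that of its shift. It is well defined because
eventual equality survives the shift, and elementary because eventual satisfaction does. -/
theorem exists_emb (hv : v ∈ S.Fs) : ∃ j : S.col v ↪ₑ[LSet] S.col (sh v),
    ∀ F ∈ S.Fs, ∀ x : S.col v, S.col F = x → (j x : ZFSet.{u}) = S.col (sh F) := by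
  choose F h1 h2 h3 using fun x : S.col v => mem_col.1 x.2
  have h4 : ∀ G ∈ S.Fs, ∀ x : S.col v, S.col G = x → S.col (sh (F x)) = S.col (sh G) :=
    fun G hG x hx => col_sh_congr (h1 x) hG ((h3 x).trans hx.symm)
  refine ⟨⟨fun x => ⟨S.col (sh (F x)),
    (col_mem_col (sh_mem_Fs (h1 x)) (sh_mem_Fs hv)).2 (ev_mem_sh (h2 x))⟩, fun {n} φ x => ?_⟩, h4⟩
  exact (isHull_col hv).realize_iff (isHull_col (sh_mem_Fs hv)) φ x _ sh rfl
    (fun P F h => ev_shift (P := fun γ => P (v γ) fun i => F i γ) h) (fun _ h => sh_mem_Fs h)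
    fun i G hG _ h => (h4 G hG _ h).symm

theorem models_col_sh (hv : v ∈ S.Fs) {σ : LSet.Sentence} (h : S.col v ⊨ σ) :
    S.col (sh v) ⊨ σ := by
  obtain ⟨j, -⟩ := exists_emb hv
  exact (j.map_sentence σ).1 h

end Elementarity

/-! ### The rank initial segments at the indiscernibles -/

/-- The rank initial segment of the universe at the `i`-th indiscernible. -/
def vn (i : ℕ) : Fn κ := fun γ => ZFSet.vonNeumann (oz (γ i)).rank

theorem mem_vn {i : ℕ} {γ : ℕ → κ.ord.ToType} {x : ZFSet.{u}} :
    x ∈ vn i γ ↔ x.rank < (oz (γ i)).rank := ZFSet.mem_vonNeumann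

theorem sh_vr (i : ℕ) : sh (vr i : Fn κ) = vr (i + 1) := by
  funext γ; simp [sh, vr, add_comm]

theorem sh_vn (i : ℕ) : sh (vn i : Fn κ) = vn (i + 1) := by
  funext γ; simp [sh, vn, add_comm]

theorem vn_mem (i : ℕ) : vn i ∈ S.lev i :=
  op_mem (G := opV) (op_mem_preds (by simp [basicOps])) (vr_mem i) (vr_mem i) (vr_mem i) fun γ => by
    simpa [opV, ZFSet.rank_vonNeumann] using rank_oz_lt (γ i)

theorem vn_mem_Fs (i : ℕ) : vn i ∈ S.Fs := ⟨i, vn_mem i⟩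

theorem oz_rank (ξ : κ.ord.ToType) : (oz ξ).rank.toZFSet = oz ξ := by
  rw [oz, rank_toZFSet]

/-- Functions that take values of rank less than `γ 0` are eventually constant. -/
theorem exists_ev_const {F : Fn κ} (hF : F ∈ S.Fs) (h : ∀ᶠ γ in S.ev, F γ ∈ vn 0 γ) :
    ∃ y : ZFSet.{u}, y.rank < κ.ord ∧ ∀ᶠ γ in S.ev, F γ = y := by
  obtain ⟨n, hn⟩ := hF
  -- The rank is regressive, hence eventually a fixed `ξ`; then all values lie in one element of
  -- `V_κ`, and completeness selects one of them.
  obtain ⟨ξ, hξ⟩ := exists_ev_eq_oz (lev_subset_Fs (opRank_mem hn)) (h.mono fun γ h => by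
    rw [vr, ← oz_rank, toZFSet_mem_toZFSet_iff]
    exact mem_vn.1 h)
  have hr : (ZFSet.vonNeumann (Order.succ (oz ξ).rank)).rank < κ.ord := by
    rw [ZFSet.rank_vonNeumann]
    exact isSuccLimit_ord'.succ_lt (rank_oz_lt ξ)
  obtain ⟨y, hy, h1⟩ := exists_ev_eq_of_ev_mem ⟨n, hn⟩ hr (hξ.mono fun γ h1 => by
    rw [← oz_rank] at h1
    rw [ZFSet.mem_vonNeumann, toZFSet_injective h1]
    exact Order.lt_succ _)
  exact ⟨y, (ZFSet.rank_lt_of_mem hy).trans hr, h1⟩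

theorem ev_const_mem_vn {x : ZFSet.{u}} (hx : x.rank < κ.ord) : ∀ᶠ γ in S.ev, x ∈ vn 0 γ := by
  obtain ⟨ξ, hξ⟩ := rank_lt_iff_exists.1 hx
  exact (ev_gt ξ).mono fun γ h => mem_vn.2 (hξ ▸ rank_oz_lt_rank_oz.2 h)

theorem col_vn_zero : S.col (vn 0) = ZFSet.vonNeumann κ.ord := by
  ext x
  rw [mem_col, ZFSet.mem_vonNeumann]
  constructor
  · rintro ⟨F, hF, h, rfl⟩
    obtain ⟨y, hy, h1⟩ := exists_ev_const hF h
    rwa [col_congr (G := fun _ => y) h1, col_const hy]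
  · intro hx
    exact ⟨_, const_mem_Fs hx, ev_const_mem_vn hx, col_const hx⟩

/-- Eventually every subset of `V_(γ 0)` that is an image of an element of `V_(γ 0)` is an element
of `V_(γ 0)`. -/
theorem ev_regular_zero : ∀ᶠ γ in S.ev, ∀ d ∈ vn 0 γ, ∀ w ⊆ vn 0 γ, SmallImage d w →
    w ∈ vn 0 γ := by
  classical
  have h0 := vn_mem_Fs (S := S) 0
  -- A counterexample `W` would come with a domain `D` of rank below `γ 0`, which is eventually a
  -- fixed `d`, and with an enumeration `G` of `W` along `d`.
  have key := ev_of_no_counterexample (p := relNotReg) (rel_mem (by simp [basicRels])) h0 h0 h0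
    fun W hW hev => by
      obtain ⟨n, hWn, h0n⟩ := exists_lev_pair hW h0
      obtain ⟨D, hD, h1⟩ := exists_witness (p := relDom) (rel_mem (by simp [basicRels])) hWn h0n h0n
        (hev.mono fun γ h => by
          obtain ⟨-, -, d, hd, h⟩ := h
          exact ⟨d, (ZFSet.rank_lt_of_mem hd).trans (rank_Fn_lt h0 γ), hd, h⟩)
      obtain ⟨d, hd, h2⟩ := exists_ev_const (lev_subset_Fs hD) (h1.mono fun γ h => h.1)
      obtain ⟨G, hG, h3⟩ := exists_witness (p := relEnum) (rel_mem (by simp [basicRels])) hWn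
        (const_mem hd n) hWn ((h1.and h2).mono fun γ ⟨h3, h4⟩ => by
          rw [h4] at h3
          obtain ⟨f, hf⟩ := h3.2
          refine ⟨(ZFSet.prod d (W γ)).sep fun p => ∃ u, p = ZFSet.pair u (f u),
            (ZFSet.rank_mono ZFSet.sep_subset).trans_lt
              (rank_prod_lt isSuccLimit_ord' hd (rank_Fn_lt hW γ)), fun v hv => ?_⟩
          obtain ⟨u, hu, rfl⟩ := hf v hv
          have hp : ZFSet.pair u (f u) ∈ (ZFSet.prod d (W γ)).sep fun p =>
            ∃ u, p = ZFSet.pair u (f u) :=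
            ZFSet.mem_sep.2 ⟨ZFSet.pair_mem_prod.2 ⟨hu, hv⟩, u, rfl⟩
          refine ⟨u, hu, app_eq hp ⟨_, hp, fun y hy => ?_⟩⟩
          obtain ⟨u', h⟩ := (ZFSet.mem_sep.1 hy).2
          obtain ⟨rfl, rfl⟩ := ZFSet.pair_inj.1 h
          rfl)
      obtain ⟨l, g, rfl⟩ := exists_range_eq (card_lt_of_rank_lt hκ.out hd)
      -- Each `u` in `d` contributes either nothing to `W`, or a value in `V_(γ 0)`, which is
      -- eventually constant.
      have h4 : ∀ i, ∃ t : ZFSet.{u}, t.rank < κ.ord ∧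
          ∀ᶠ γ in S.ev, ∀ y, y ∈ t ↔ app (G γ) (g i) = y ∧ y ∈ W γ := by
        intro i
        have hgi := (ZFSet.rank_lt_of_mem (ZFSet.mem_range_self i)).trans hd
        have hap := app_mem_Fs (lev_subset_Fs hG) (const_mem_Fs hgi)
        rcases ev_mem_or hap hW with h4 | h4
        · obtain ⟨y, hy, h5⟩ := exists_ev_const hap ((hev.and h4).mono fun γ h => h.1.1 h.2)
          refine ⟨{y}, by simpa using isSuccLimit_ord'.succ_lt hy,
            (h4.and h5).mono fun γ ⟨h6, h7⟩ z => ?_⟩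
          rw [h7] at h6 ⊢
          rw [ZFSet.mem_singleton]
          exact ⟨fun h => ⟨h.symm, h ▸ h6⟩, fun h => h.1.symm⟩
        · refine ⟨∅, by simpa using hκ.out.isRegular.ord_pos, h4.mono fun γ h6 z => ?_⟩
          simp only [ZFSet.notMem_empty, false_iff, not_and]
          rintro rfl
          exact h6
      choose t ht h5 using h4
      -- The union of these fewer than `κ` constant contributions is in `V_κ` and eventually equals
      -- `W`, so `W` is in `V_(γ 0)` after all.
      have hr : (ZFSet.sUnion (ZFSet.range t)).rank < κ.ord := (ZFSet.rank_sUnion_le _).trans_lt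
        (rank_range_lt hκ.out.isRegular (mk_Iio_lt_of_ord l) ht)
      obtain ⟨γ, h6, h7, h8, h9⟩ := ((ev_const_mem_vn hr).and
        (hev.and (h3.and (ev_forall (mk_Iio_lt_of_ord l) h5)))).exists
      refine h7.2.1 ?_
      convert h6 using 1
      ext y
      simp only [ZFSet.mem_sUnion, ZFSet.mem_range, exists_exists_eq_and]
      constructor
      · intro hy
        obtain ⟨u, hu, h10⟩ := h8 y hy
        obtain ⟨i, rfl⟩ := ZFSet.mem_range.1 hu
        exact ⟨i, (h9 i y).2 ⟨h10, hy⟩⟩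
      · rintro ⟨i, hi⟩
        exact ((h9 i y).1 hi).2
  refine key.mono fun γ h d hd w hw hs => ?_
  by_contra hcon
  exact h w ((ZFSet.rank_mono hw).trans_lt (rank_Fn_lt h0 γ)) ⟨hw, hcon, d, hd, hs⟩

theorem ev_shift_vn {P : ZFSet.{u} → Prop} (h : ∀ᶠ γ in S.ev, P (vn 0 γ)) (i : ℕ) :
    ∀ᶠ γ in S.ev, P (vn i γ) := by
  induction i with
  | zero => exact h
  | succ i ih =>
    rw [← sh_vn]
    exact ev_shift ih

theorem ev_regular (i : ℕ) : ∀ᶠ γ in S.ev, ∀ d ∈ vn i γ, ∀ w ⊆ vn i γ, SmallImage d w →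
    w ∈ vn i γ :=
  ev_shift_vn (P := fun v => ∀ d ∈ v, ∀ w ⊆ v, SmallImage d w → w ∈ v) ev_regular_zero i

theorem ev_const_mem_vn' {x : ZFSet.{u}} (hx : x.rank < κ.ord) (i : ℕ) :
    ∀ᶠ γ in S.ev, x ∈ vn i γ := ev_shift_vn (P := fun v => x ∈ v) (ev_const_mem_vn hx) i

/-- A singleton is an image of `{∅}`, so by regularity `{a}` has rank below `γ i` whenever `a` does.
-/
theorem ev_isSuccLimit (i : ℕ) : ∀ᶠ γ in S.ev, Order.IsSuccLimit (oz (γ i)).rank := by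
  have h1 : ({∅} : ZFSet.{u}).rank < κ.ord := by
    simpa using isSuccLimit_ord'.succ_lt hκ.out.isRegular.ord_pos
  refine ((ev_regular i).and (ev_const_mem_vn' h1 i)).mono fun γ ⟨h2, h3⟩ => ?_
  refine isSuccLimit_iff.2 ⟨fun h => ?_, Order.isSuccPrelimit_of_succ_lt fun a ha => ?_⟩
  · have := mem_vn.1 h3
    rw [h] at this
    exact not_lt_bot this
  · have h4 : a.toZFSet ∈ vn i γ := mem_vn.2 (by rwa [rank_toZFSet])
    have h5 := h2 {∅} h3 {a.toZFSet} (fun x hx => by rwa [ZFSet.mem_singleton.1 hx])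
      ⟨fun _ => a.toZFSet, fun y hy => ⟨∅, by simp, (ZFSet.mem_singleton.1 hy).symm⟩⟩
    simpa [mem_vn] using h5

/-! ### The model of height the second indiscernible -/

variable (S) in
/-- The collapse of the rank initial segment at the `i`-th indiscernible. -/
def Mod (i : ℕ) : ZFSet.{u} := S.col (vn i)

theorem isTransitive_col {v : Fn κ} (hv : v ∈ S.Fs)
    (h : ∀ᶠ γ in S.ev, (v γ).IsTransitive) : (S.col v).IsTransitive := by
  intro y hy x hx
  obtain ⟨G, hG, h1, rfl⟩ := mem_col.1 hy
  obtain ⟨F, hF, h2, rfl⟩ := mem_col.1 hx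
  exact (col_mem_col hF hv).2 ((h.and (h1.and h2)).mono fun γ ⟨h3, h4, h5⟩ => h3 _ h4 h5)

theorem isTransitive_Mod (i : ℕ) : (S.Mod i).IsTransitive :=
  isTransitive_col (vn_mem_Fs i) (Eventually.of_forall fun _ => ZFSet.isTransitive_vonNeumann _)

theorem col_mem_Mod {i : ℕ} {F : Fn κ} (hF : F ∈ S.Fs) :
    S.col F ∈ S.Mod i ↔ ∀ᶠ γ in S.ev, F γ ∈ vn i γ := col_mem_col hF (vn_mem_Fs i)

theorem mem_Mod {i : ℕ} {x : ZFSet.{u}} :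
    x ∈ S.Mod i ↔ ∃ F ∈ S.Fs, (∀ᶠ γ in S.ev, F γ ∈ vn i γ) ∧ S.col F = x := mem_col

theorem ev_lt {i j : ℕ} (h : i < j) : ∀ᶠ γ in S.ev, γ i < γ j :=
  ev_strictMono.mono fun _ hγ => hγ h

theorem ev_vr_mem_vr {i j : ℕ} (h : i < j) : ∀ᶠ γ in S.ev, vr i γ ∈ vr j γ :=
  (ev_lt h).mono fun _ h => oz_mem_oz.2 h

theorem ev_vr_mem_vn {i j : ℕ} (h : i < j) : ∀ᶠ γ in S.ev, vr i γ ∈ vn j γ :=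
  (ev_lt h).mono fun _ h => mem_vn.2 (rank_oz_lt_rank_oz.2 h)

theorem ev_vn_mem_vn {i j : ℕ} (h : i < j) : ∀ᶠ γ in S.ev, vn i γ ∈ vn j γ :=
  (ev_lt h).mono fun _ h => mem_vn.2 (by
    rw [vn, ZFSet.rank_vonNeumann]; exact rank_oz_lt_rank_oz.2 h)

theorem Mod_mem_Mod {i j : ℕ} (h : i < j) : S.Mod i ∈ S.Mod j :=
  (col_mem_Mod (vn_mem_Fs i)).2 (ev_vn_mem_vn h)

theorem kset_mem_Mod : kset κ ∈ S.Mod 1 := by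
  rw [← col_vr_zero (S := S), col_mem_Mod (vr_mem_Fs 0)]
  exact ev_vr_mem_vn Nat.zero_lt_one

theorem subset_mem_Mod {i : ℕ} {F : Fn κ} (hF : F ∈ S.Fs) {x : ZFSet.{u}} (hx : x ∈ S.Mod i)
    (h : S.col F ⊆ x) : S.col F ∈ S.Mod i := by
  obtain ⟨G, hG, h1, rfl⟩ := mem_Mod.1 hx
  rw [col_mem_Mod hF]
  exact (h1.and ((col_subset_col hF hG).1 h)).mono fun γ ⟨h2, h3⟩ =>
    ZFSet.mem_vonNeumann_of_subset h3 h2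

/-- `Mod 0` is `V_κ`, and truth passes from each model to the next along the shift. -/
theorem models_Mod {i : ℕ} {T : LSet.Theory} (h : ZFSet.vonNeumann κ.ord ⊨ T) : S.Mod i ⊨ T := by
  refine ⟨fun σ hσ => ?_⟩
  have h1 := h.realize_of_mem σ hσ
  rw [← col_vn_zero (S := S)] at h1
  induction i with
  | zero => exact h1
  | succ i ih =>
    rw [Mod, ← sh_vn]
    exact models_col_sh (vn_mem_Fs i) ih

theorem card_kset : (kset κ).card = κ := by
  have h : #(kset κ) = lift.{u + 1} #κ.ord.ToType := by
    rw [← Cardinal.lift_id'.{u, u + 1} #(kset κ)]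
    refine Cardinal.lift_mk_eq'.2 ⟨(Equiv.ofBijective (fun ξ => (⟨oz ξ, mem_kset.2 ⟨ξ, rfl⟩⟩ :
      kset κ)) ⟨fun ξ ζ h => oz_injective (congrArg Subtype.val h), fun x => ?_⟩).symm⟩
    obtain ⟨ξ, hξ⟩ := mem_kset.1 x.2
    exact ⟨ξ, Subtype.ext hξ⟩
  rw [ZFSet.cardinalMk_coe_sort, Cardinal.lift_inj] at h
  rw [h, mk_toType, card_ord]

theorem card_Mod_one : (S.Mod 1).card = κ := by
  refine le_antisymm ?_ ?_
  · have h : S.Mod 1 ⊆ ZFSet.range fun p : ℕ × κ.ord.ToType => S.col (S.T (p.1 + 1) p.2) := by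
      intro x hx
      obtain ⟨_, ⟨n, ξ, rfl⟩, -, rfl⟩ := mem_Mod.1 hx
      exact ZFSet.mem_range.2 ⟨(n, ξ), rfl⟩
    refine (ZFSet.card_mono h).trans ?_
    have h1 := ZFSet.lift_card_range_le (f := fun p : ℕ × κ.ord.ToType =>
      S.col (S.T (p.1 + 1) p.2))
    rw [Cardinal.lift_id, Cardinal.lift_id] at h1
    refine h1.trans ?_
    rw [mk_prod, mk_nat, lift_aleph0, Cardinal.lift_uzero, mk_toType, card_ord]
    exact mul_le_of_le hκ.out.aleph0_lt.le hκ.out.aleph0_lt.le le_rfl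
  · conv_lhs => rw [← card_kset (κ := κ)]
    exact ZFSet.card_mono ((isTransitive_Mod 1).subset_of_mem kset_mem_Mod)

theorem isWeakModel_Mod : IsWeakModel κ (S.Mod 1) :=
  ⟨isTransitive_Mod 1, card_Mod_one, kset_mem_Mod, models_Mod (V_models_ZFCMinus hκ.out)⟩

theorem exists_oz_of_mem {x : ZFSet.{u}} (hx : x ∈ kset κ) :
    ∃ ξ : κ.ord.ToType, x = oz ξ := (mem_kset.1 hx).imp fun _ h => h.symm

theorem oz_mem_col {ξ : κ.ord.ToType} {F : Fn κ} (hF : F ∈ S.Fs) :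
    oz ξ ∈ S.col F ↔ ∀ᶠ γ in S.ev, oz ξ ∈ F γ := by
  conv_lhs => rw [← col_oz (S := S) ξ]
  exact col_mem_col (const_mem_Fs (rank_oz_lt ξ)) hF

theorem pair_oz_mem_col {ξ : κ.ord.ToType} {F G : Fn κ} (hF : F ∈ S.Fs) (hG : G ∈ S.Fs) :
    ZFSet.pair (oz ξ) (S.col G) ∈ S.col F ↔ ∀ᶠ γ in S.ev, ZFSet.pair (oz ξ) (G γ) ∈ F γ := by
  conv_lhs => rw [← col_oz (S := S) ξ]
  exact pair_col_mem_col (const_mem_Fs (rank_oz_lt ξ)) hG hF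

theorem ev_oz_mem_vr (ξ : κ.ord.ToType) : ∀ᶠ γ in S.ev, oz ξ ∈ vr 0 γ :=
  (ev_gt ξ).mono fun _ h => oz_mem_oz.2 h

/-- A subset of `κ` is represented by a function if the function is eventually correct at each
ordinal below `κ`. -/
theorem col_eq_of_subset_kset {F : Fn κ} (hF : F ∈ S.Fs) {B : ZFSet.{u}} (hB : B ⊆ kset κ)
    (h1 : ∀ᶠ γ in S.ev, F γ ⊆ vr 0 γ)
    (h2 : ∀ ξ : κ.ord.ToType, (∀ᶠ γ in S.ev, oz ξ ∈ F γ) ↔ oz ξ ∈ B) : S.col F = B := by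
  have h3 : S.col F ⊆ kset κ := by
    rw [← col_vr_zero (S := S)]
    exact (col_subset_col hF (vr_mem_Fs 0)).2 h1
  ext x
  constructor
  · intro hx
    obtain ⟨ξ, rfl⟩ := exists_oz_of_mem (h3 hx)
    exact (h2 ξ).1 ((oz_mem_col hF).1 hx)
  · intro hx
    obtain ⟨ξ, rfl⟩ := exists_oz_of_mem (hB hx)
    exact (oz_mem_col hF).2 ((h2 ξ).2 hx)

/-- The function `γ ↦ A ∩ γ 0` represents `A`; this is why intersection with `A` is among the basic
operations. -/
theorem mem_Mod_of_subset_kset (hA : A ⊆ kset κ) : A ∈ S.Mod 1 := by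
  have hF : (fun γ => A ∩ vr 0 γ) ∈ S.Fs :=
    op_mem_Fs (G := opInterWith A) (op_mem_preds (by simp [basicOps]))
      (vr_mem_Fs 0) (vr_mem_Fs 0) (vr_mem_Fs 0) fun γ =>
        (ZFSet.rank_mono fun x hx => (ZFSet.mem_inter.1 hx).2).trans_lt (rank_oz_lt (γ 0))
  have h := col_eq_of_subset_kset hF hA
    (Eventually.of_forall fun γ x hx => (ZFSet.mem_inter.1 hx).2) fun ξ => by
      simp only [ZFSet.mem_inter]
      constructor
      · intro h
        obtain ⟨γ, h1⟩ := h.exists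
        exact h1.1
      · exact fun h => (ev_oz_mem_vr ξ).mono fun γ h1 => ⟨h, h1⟩
  exact h.subst (motive := fun x => x ∈ S.Mod 1)
    (subset_mem_Mod hF kset_mem_Mod (h.symm.subst (motive := fun x => x ⊆ kset κ) hA))

/-! ### The elementary chain -/

theorem mem_rangeBelow_pair {a : κ.ord.ToType} {f : κ.ord.ToType → ZFSet.{u}} {x y : ZFSet.{u}} :
    ZFSet.pair x y ∈ (rangeBelow a fun ξ => ZFSet.pair (oz ξ.1) (f ξ.1)) ↔
      ∃ ξ < a, oz ξ = x ∧ f ξ = y := by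
  simp only [mem_rangeBelow, ZFSet.pair_inj, Subtype.exists, exists_prop]

/-- The collapse of a set of the values of fewer than `κ` functions. -/
theorem mem_col_rangeBelow {n : ℕ} (l : κ.ord.ToType) (g : {x // x < l} → Fn κ)
    (hg : ∀ i, g i ∈ S.lev n) {x : ZFSet.{u}} :
    x ∈ S.col (fun γ => rangeBelow l fun i => g i γ) ↔ ∃ i, S.col (g i) = x := by
  rw [mem_col]
  constructor
  · rintro ⟨F, hF, h, rfl⟩
    by_contra! hcon
    have h1 : ∀ i, ∀ᶠ γ in S.ev, F γ ≠ g i γ := fun i =>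
      (ev_eq_or hF (lev_subset_Fs (hg i))).resolve_left fun h2 => hcon i (col_congr h2).symm
    obtain ⟨γ, h2, h3⟩ := (h.and (ev_forall (mk_Iio_lt_of_ord l) h1)).exists
    obtain ⟨i, hi⟩ := mem_rangeBelow.1 h2
    exact h3 i hi.symm
  · rintro ⟨i, rfl⟩
    exact ⟨g i, lev_subset_Fs (hg i), Eventually.of_forall fun γ => mem_rangeBelow.2 ⟨i, rfl⟩, rfl⟩

variable (S) in
/-- The set of those values at `γ` of the functions of level `n` with index below `γ 0` that are in
the model of height `γ 1`. -/
def chainFn (n : ℕ) : Fn κ := fun γ =>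
  opRan (rangeBelow (γ 0) fun ξ => ZFSet.pair (oz ξ.1) (S.T (n + 1) ξ γ)) (vn 1 γ) ∅

theorem mem_chainFn {n : ℕ} {γ : ℕ → κ.ord.ToType} {y : ZFSet.{u}} :
    y ∈ S.chainFn n γ ↔ y ∈ vn 1 γ ∧ ∃ ξ < γ 0, S.T (n + 1) ξ γ = y := by
  simp only [chainFn, opRan, ZFSet.mem_sep, mem_rangeBelow_pair (f := fun ξ => S.T (n + 1) ξ γ)]
  refine and_congr_right fun _ => ⟨?_, ?_⟩
  · rintro ⟨_, ξ, h1, rfl, h2⟩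
    exact ⟨ξ, h1, h2⟩
  · rintro ⟨ξ, h1, h2⟩
    exact ⟨_, ξ, h1, rfl, h2⟩

theorem graph_mem (n : ℕ) :
    (fun γ => rangeBelow (γ 0) fun ξ => ZFSet.pair (oz ξ.1) (S.T (n + 1) ξ γ)) ∈ S.lev (n + 1) := by
  obtain ⟨ξ, hξ⟩ := S.graph (n + 1)
  exact ⟨ξ, hξ⟩

theorem chainFn_mem (n : ℕ) : S.chainFn n ∈ S.Fs :=
  op_mem_Fs (G := opRan) (F₃ := fun _ => ∅) (op_mem_preds (by simp [basicOps])) ⟨_, graph_mem n⟩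
    (vn_mem_Fs 1) (const_mem_Fs (by simpa using hκ.out.isRegular.ord_pos)) fun γ =>
      (ZFSet.rank_mono ZFSet.sep_subset).trans_lt (rank_Fn_lt (S := S) (vn_mem_Fs 1) γ)

/-- An element selects at each `γ` an index below `γ 0` of a function of level `n`. The index is
regressive, hence eventually constant, so the element is represented by that one function. -/
theorem mem_col_chainFn {n : ℕ} {x : ZFSet.{u}} : x ∈ S.col (S.chainFn n) ↔
    ∃ F ∈ S.lev n, (∀ᶠ γ in S.ev, F γ ∈ vn 1 γ) ∧ S.col F = x := by
  rw [mem_col]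
  constructor
  · rintro ⟨F, hF, h, rfl⟩
    simp only [mem_chainFn] at h
    obtain ⟨m, hFm, hGm⟩ := exists_lev_pair hF (⟨_, graph_mem n⟩ : _ ∈ S.Fs)
    obtain ⟨I, hI, h1⟩ := exists_witness (p := relInv) (rel_mem (by simp [basicRels])) hFm hFm hGm
      (h.mono fun γ h => by
        obtain ⟨-, ξ, h2, h3⟩ := h
        exact ⟨oz ξ, rank_oz_lt ξ,
          (mem_rangeBelow_pair (f := fun ξ => S.T (n + 1) ξ γ)).2 ⟨ξ, h2, rfl, h3⟩⟩)
    have h2 : ∀ᶠ γ in S.ev, ∃ ξ < γ 0, oz ξ = I γ ∧ S.T (n + 1) ξ γ = F γ :=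
      h1.mono fun γ h => (mem_rangeBelow_pair (f := fun ξ => S.T (n + 1) ξ γ)).1 h
    obtain ⟨ζ, h3⟩ := exists_ev_eq_oz (lev_subset_Fs hI) (h2.mono fun γ h => by
      obtain ⟨ξ, h3, h4, -⟩ := h
      exact h4 ▸ oz_mem_oz.2 h3)
    have h4 : ∀ᶠ γ in S.ev, S.T (n + 1) ζ γ = F γ := (h2.and h3).mono fun γ ⟨h4, h5⟩ => by
      obtain ⟨ξ, -, h6, h7⟩ := h4
      rwa [← oz_injective (h6.trans h5)]
    exact ⟨S.T (n + 1) ζ, ⟨ζ, rfl⟩, (h.and h4).mono fun γ h => h.2 ▸ h.1.1, col_congr h4⟩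
  · rintro ⟨_, ⟨ξ, rfl⟩, h, rfl⟩
    refine ⟨_, ⟨n, ξ, rfl⟩, (h.and (ev_gt ξ)).mono fun γ h => mem_chainFn.2 ⟨h.1, ξ, h.2, rfl⟩, rfl⟩

theorem ev_subset_mem_vn {F : Fn κ} (h1 : ∀ᶠ γ in S.ev, F γ ⊆ vn 1 γ)
    (h2 : ∀ᶠ γ in S.ev, SmallImage (vr 0 γ) (F γ)) : ∀ᶠ γ in S.ev, F γ ∈ vn 1 γ :=
  ((ev_regular 1).and ((ev_vr_mem_vn Nat.zero_lt_one).and (h1.and h2))).mono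
    fun _ ⟨h3, h4, h5, h6⟩ => h3 _ h4 _ h5 h6

theorem smallImage_chainFn (n : ℕ) (γ : ℕ → κ.ord.ToType) :
    SmallImage (vr 0 γ) (S.chainFn n γ) := by
  refine ⟨Function.extend oz (fun ξ => S.T (n + 1) ξ γ) fun _ => ∅, fun y hy => ?_⟩
  obtain ⟨-, ξ, h, rfl⟩ := mem_chainFn.1 hy
  exact ⟨oz ξ, oz_mem_oz.2 h, oz_injective.extend_apply _ _ _⟩

theorem ev_chainFn_mem (n : ℕ) : ∀ᶠ γ in S.ev, S.chainFn n γ ∈ vn 1 γ :=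
  ev_subset_mem_vn (Eventually.of_forall fun _ _ h => (mem_chainFn.1 h).1)
    (Eventually.of_forall fun _ => smallImage_chainFn n _)

theorem ev_vr_subset_chainFn (n : ℕ) : ∀ᶠ γ in S.ev, vr 0 γ ⊆ S.chainFn n γ := by
  rw [← col_subset_col (vr_mem_Fs 0) (chainFn_mem n), col_vr_zero]
  intro x hx
  obtain ⟨ξ, rfl⟩ := exists_oz_of_mem hx
  exact mem_col_chainFn.2 ⟨_, const_mem (rank_oz_lt ξ) n, ev_const_mem_vn' (rank_oz_lt ξ) 1,
    col_oz ξ⟩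

/-- Sets that are images of each other are in bijection. -/
theorem exists_relBij {o : Ordinal.{u}} (ho : Order.IsSuccLimit o) {x y : ZFSet.{u}} (hxy : x ⊆ y)
    (h : SmallImage x y) (hx : x.rank < o) (hy : y.rank < o) :
    ∃ w : ZFSet.{u}, w.rank < o ∧ relBij w x y y := by
  classical
  obtain ⟨f, hf⟩ := h
  choose g hg hfg using fun z : y => hf z z.2
  -- The inclusion embeds `x` in `y`, and a choice of preimages embeds `y` in `x`.
  obtain ⟨e, he⟩ := Function.Embedding.schroeder_bernstein
    (f := fun z : x => (⟨z, hxy z.2⟩ : y)) (g := fun z : y => (⟨g z, hg z⟩ : x))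
    (fun a b h => Subtype.ext (Subtype.ext_iff.1 h :)) (fun a b h => Subtype.ext (by
      have h' : g a = g b := Subtype.ext_iff.1 h
      rw [← hfg a, ← hfg b, h']))
  let w := (ZFSet.prod x y).sep fun p => ∃ z : x, p = ZFSet.pair z.1 (e z).1
  have hw : ∀ a b, ZFSet.pair a b ∈ w ↔ ∃ z : x, z.1 = a ∧ (e z).1 = b := by
    intro a b
    rw [ZFSet.mem_sep]
    constructor
    · rintro ⟨-, z, hz⟩
      obtain ⟨rfl, rfl⟩ := ZFSet.pair_inj.1 hz
      exact ⟨z, rfl, rfl⟩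
    · rintro ⟨z, rfl, rfl⟩
      exact ⟨ZFSet.pair_mem_prod.2 ⟨z.2, (e z).2⟩, z, rfl⟩
  refine ⟨w, (ZFSet.rank_mono ZFSet.sep_subset).trans_lt (rank_prod_lt ho hx hy),
    ⟨ZFSet.sep_subset, fun a ha => ?_⟩, fun b hb => ?_⟩
  · refine ⟨e ⟨a, ha⟩, (hw _ _).2 ⟨⟨a, ha⟩, rfl, rfl⟩, fun b hb => ?_⟩
    obtain ⟨z, rfl, rfl⟩ := (hw _ _).1 hb
    rfl
  · obtain ⟨z, hz⟩ := he.2 ⟨b, hb⟩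
    refine ⟨z, (hw _ _).2 ⟨z, rfl, by rw [hz]⟩, fun a ha => ?_⟩
    obtain ⟨z', rfl, h⟩ := (hw _ _).1 ha
    rw [he.1 (Subtype.ext (h.trans (by rw [hz]) : (e z').1 = (e z).1))]

theorem chain_mem_Mod (n : ℕ) : S.col (S.chainFn n) ∈ S.Mod 1 :=
  (col_mem_Mod (chainFn_mem n)).2 (ev_chainFn_mem n)

/-- At each `γ` the set contains `γ 0` and is an image of it, hence is in bijection with it. A
represented function chooses the bijections, and their ranks stay below the limit `γ 1`. -/
theorem hasSizeIn_chain (n : ℕ) : HasSizeIn (S.Mod 1) κ (S.col (S.chainFn n)) := by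
  obtain ⟨m, h1, h2⟩ := exists_lev_pair (S := S) (vr_mem_Fs 0) (chainFn_mem n)
  obtain ⟨B, hB, h3⟩ := exists_witness (p := relBij) (rel_mem (by simp [basicRels])) h1 h2 h2
    ((ev_vr_subset_chainFn n).mono fun γ h => exists_relBij isSuccLimit_ord' h
      (smallImage_chainFn n γ) (rank_Fn_lt (S := S) (vr_mem_Fs 0) γ)
      (rank_Fn_lt (S := S) (chainFn_mem n) γ))
  have hB' := lev_subset_Fs hB
  refine ⟨S.col B, (col_mem_Mod hB').2 ?_, ?_⟩
  · refine ((ev_isSuccLimit 1).and (h3.and ((ev_vr_mem_vn Nat.zero_lt_one).and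
      (ev_chainFn_mem n)))).mono fun γ ⟨h4, h5, h6, h7⟩ => mem_vn.2 ?_
    exact (ZFSet.rank_mono h5.1.1).trans_lt (rank_prod_lt h4 (mem_vn.1 h6) (mem_vn.1 h7))
  · have h4 := bij_col (vr_mem_Fs 0) hB' (chainFn_mem n) h3
    rw [col_vr_zero] at h4
    exact h4

/-- The terms of a short sequence are given by fewer than `κ` functions of level `n`, and the level
contains the function that collects their values, paired with the positions. -/
theorem closedIn_chain (n : ℕ) : ClosedIn (S.Mod 1) κ (S.col (S.chainFn n)) := by
  intro δ hδ f hf hfun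
  obtain ⟨l, rfl⟩ := exists_oz_of_mem hδ
  obtain ⟨F, hF, h1, rfl⟩ := mem_Mod.1 hf
  have h2 : ∀ i : {ξ // ξ < l}, ∃ G ∈ S.lev n, ZFSet.pair (oz i.1) (S.col G) ∈ S.col F := by
    intro i
    obtain ⟨y, hy, -⟩ := hfun.2 _ (oz_mem_oz.2 i.2)
    obtain ⟨G, hG, -, rfl⟩ := mem_col_chainFn.1 (ZFSet.pair_mem_prod.1 (hfun.1 hy)).2
    exact ⟨G, hG, hy⟩
  choose G hG h3 using h2
  have h4 : ∀ i, (fun γ => ZFSet.pair (oz i.1) (G i γ)) ∈ S.lev n := fun i =>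
    pair_mem (const_mem (rank_oz_lt i.1) n) (hG i)
  have h5 : ∀ i, S.col (fun γ => ZFSet.pair (oz i.1) (G i γ)) = ZFSet.pair (oz i.1) (S.col (G i)) :=
    fun i => by
      rw [col_pair (F := fun _ => oz i.1) (const_mem_Fs (rank_oz_lt i.1)) (lev_subset_Fs (hG i)),
        col_oz]
  have h6 := set_mem l _ h4
  have h7 : S.col (fun γ => rangeBelow l fun i => ZFSet.pair (oz i.1) (G i γ)) = S.col F := by
    ext x
    rw [mem_col_rangeBelow l _ h4]
    simp only [h5]
    constructor
    · rintro ⟨i, rfl⟩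
      exact h3 i
    · intro hx
      obtain ⟨a, ha, b, -, rfl⟩ := ZFSet.mem_prod.1 (hfun.1 hx)
      obtain ⟨ξ, hξ, rfl⟩ := mem_oz.1 ha
      exact ⟨⟨ξ, hξ⟩, by rw [(hfun.2 _ ha).unique (h3 ⟨ξ, hξ⟩) hx]⟩
  refine mem_col_chainFn.2 ⟨_, h6, ?_, h7⟩
  have h8 := (col_eq_col (lev_subset_Fs h6) hF).1 h7
  exact (h8.and h1).mono fun γ h => h.1 ▸ h.2

theorem elemSub_chain {n m : ℕ} (hn : 1 ≤ n) (h : n ≤ m) :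
    ElemSub (S.col (S.chainFn n)) (S.col (S.chainFn m)) :=
  (isHull_lev (lev_mono hn (vn_mem 1)) fun _ => mem_col_chainFn).elemSub
    (isHull_lev (lev_mono (hn.trans h) (vn_mem 1)) fun _ => mem_col_chainFn) (lev_mono h)

theorem isSpecial_Mod : IsSpecial ω κ (S.Mod 1) := by
  have hnat : ∀ n : ℕ, Cardinal.toNat (n : Ordinal.{u}).card = n := fun n => by simp
  -- The chain starts at level `1`, where `vn 1` is available, as elementarity requires. Below `ω`
  -- the clause on limit indices is vacuous.
  refine ⟨fun ξ => S.col (S.chainFn (Cardinal.toNat ξ.card + 1)), fun x => ?_, ?_, ?_,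
    fun ξ _ => ⟨chain_mem_Mod _, hasSizeIn_chain _⟩, fun ξ _ => closedIn_chain _⟩
  · rw [mem_Mod]
    constructor
    · rintro ⟨F, ⟨n, hF⟩, h, rfl⟩
      refine ⟨n, natCast_lt_omega0 n, ?_⟩
      simp only [hnat]
      exact mem_col_chainFn.2 ⟨F, lev_subset_succ n hF, h, rfl⟩
    · rintro ⟨ξ, -, h⟩
      obtain ⟨F, hF, h1⟩ := mem_col_chainFn.1 h
      exact ⟨F, lev_subset_Fs hF, h1⟩
  · intro ξ η h hη
    obtain ⟨m, rfl⟩ := lt_omega0.1 hη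
    obtain ⟨n, rfl⟩ := lt_omega0.1 (h.trans_lt hη)
    simp only [hnat]
    exact elemSub_chain (Nat.le_add_left 1 n) (Nat.succ_le_succ (by exact_mod_cast h))
  · intro ξ hξ hlim
    exact absurd (omega0_le_of_isSuccLimit hlim) hξ.not_ge

/-! ### The ultrafilter -/

theorem const_empty_mem : (fun _ => ∅) ∈ S.Fs := const_mem_Fs (by simpa using hκ.out.isRegular.ord_pos)

variable (S) in
/-- The subsets of `κ` whose shift contains `κ`. -/
def Ult : ZFSet.{u} :=
  (S.Mod 1).sep fun B => B ⊆ kset κ ∧ ∃ F ∈ S.Fs, S.col F = B ∧ ∀ᶠ γ in S.ev, vr 0 γ ∈ sh F γ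

theorem Ult_subset_Mod : S.Ult ⊆ S.Mod 1 := ZFSet.sep_subset

theorem col_mem_Ult {F : Fn κ} (hF : F ∈ S.Fs) :
    S.col F ∈ S.Ult ↔ S.col F ⊆ kset κ ∧ ∀ᶠ γ in S.ev, vr 0 γ ∈ sh F γ := by
  rw [Ult, ZFSet.mem_sep]
  constructor
  · rintro ⟨-, h, G, hG, h1, h2⟩
    exact ⟨h, (h2.and (ev_shift (P := fun γ => G γ = F γ) ((col_eq_col hG hF).1 h1))).mono
      fun γ ⟨h3, h4⟩ => (show sh G γ = sh F γ from h4) ▸ h3⟩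
  · rintro ⟨h1, h2⟩
    exact ⟨subset_mem_Mod hF kset_mem_Mod h1, h1, F, hF, rfl, h2⟩

theorem col_subset_kset {F : Fn κ} (hF : F ∈ S.Fs) :
    S.col F ⊆ kset κ ↔ ∀ᶠ γ in S.ev, F γ ⊆ vr 0 γ := by
  rw [← col_vr_zero (S := S), col_subset_col hF (vr_mem_Fs 0)]

theorem inter_mem_Fs {F G : Fn κ} (hF : F ∈ S.Fs) (hG : G ∈ S.Fs) : (fun γ => F γ ∩ G γ) ∈ S.Fs :=
  op_mem_Fs (G := opInter) (op_mem_preds (by simp [basicOps])) hF hG hG fun γ =>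
    (ZFSet.rank_mono fun _ h => (ZFSet.mem_inter.1 h).1).trans_lt (rank_Fn_lt hF γ)

theorem diff_mem_Fs {F G : Fn κ} (hF : F ∈ S.Fs) (hG : G ∈ S.Fs) : (fun γ => F γ \ G γ) ∈ S.Fs :=
  op_mem_Fs (G := opDiff) (op_mem_preds (by simp [basicOps])) hF hG hG fun γ =>
    (ZFSet.rank_mono fun _ h => (ZFSet.mem_sdiff.1 h).1).trans_lt (rank_Fn_lt hF γ)

theorem col_inter {F G : Fn κ} (hF : F ∈ S.Fs) (hG : G ∈ S.Fs) :
    S.col (fun γ => F γ ∩ G γ) = S.col F ∩ S.col G := by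
  ext x
  rw [ZFSet.mem_inter]
  constructor
  · intro hx
    obtain ⟨W, hW, h, rfl⟩ := mem_col.1 hx
    simp only [ZFSet.mem_inter, eventually_and] at h
    exact ⟨(col_mem_col hW hF).2 h.1, (col_mem_col hW hG).2 h.2⟩
  · rintro ⟨hx, hx'⟩
    obtain ⟨W, hW, h, rfl⟩ := mem_col.1 hx
    exact (col_mem_col hW (inter_mem_Fs hF hG)).2
      ((h.and ((col_mem_col hW hG).1 hx')).mono fun γ h => ZFSet.mem_inter.2 h)

theorem col_diff {F G : Fn κ} (hF : F ∈ S.Fs) (hG : G ∈ S.Fs) :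
    S.col (fun γ => F γ \ G γ) = S.col F \ S.col G := by
  ext x
  rw [ZFSet.mem_sdiff]
  constructor
  · intro hx
    obtain ⟨W, hW, h, rfl⟩ := mem_col.1 hx
    refine ⟨(col_mem_col hW hF).2 (h.mono fun γ h => (ZFSet.mem_sdiff.1 h).1), fun h1 => ?_⟩
    obtain ⟨γ, h2, h3⟩ := (h.and ((col_mem_col hW hG).1 h1)).exists
    exact (ZFSet.mem_sdiff.1 h2).2 h3
  · rintro ⟨hx, hx'⟩
    obtain ⟨W, hW, h, rfl⟩ := mem_col.1 hx
    rw [col_mem_col hW hG] at hx'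
    exact (col_mem_col hW (diff_mem_Fs hF hG)).2
      ((h.and ((ev_mem_or hW hG).resolve_left hx')).mono fun γ h => ZFSet.mem_sdiff.2 h)

/-- Complements of sets that are not in the ultrafilter. -/
theorem kset_diff_mem_Ult {F : Fn κ} (hF : F ∈ S.Fs) (h : ∀ᶠ γ in S.ev, vr 0 γ ∉ sh F γ) :
    kset κ \ S.col F ∈ S.Ult := by
  rw [← col_vr_zero (S := S), ← col_diff (vr_mem_Fs 0) hF, col_mem_Ult (diff_mem_Fs (vr_mem_Fs 0) hF)]
  refine ⟨?_, (h.and (ev_vr_mem_vr Nat.zero_lt_one)).mono fun γ ⟨h1, h2⟩ => ?_⟩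
  · rw [col_subset_kset (diff_mem_Fs (vr_mem_Fs 0) hF)]
    exact Eventually.of_forall fun γ x hx => (ZFSet.mem_sdiff.1 hx).1
  · exact ZFSet.mem_sdiff.2 ⟨by rwa [← sh_vr] at h2, h1⟩

/-! ### Represented functions on `κ` and their values -/

section Functions

variable {F : Fn κ} {Y : ZFSet.{u}}

theorem IsFunc.mono {x y y' f : ZFSet.{u}} (h : ZFSet.IsFunc x y f) (hy : y ⊆ y') :
    ZFSet.IsFunc x y' f :=
  ⟨fun p hp => by
    obtain ⟨a, ha, b, hb, rfl⟩ := ZFSet.mem_prod.1 (h.1 hp)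
    exact ZFSet.pair_mem_prod.2 ⟨ha, hy hb⟩, h.2⟩

theorem ev_isFunc (hF : F ∈ S.Fs) (h : ZFSet.IsFunc (kset κ) Y (S.col F)) (hY : Y ⊆ S.Mod 1) :
    ∀ᶠ γ in S.ev, ZFSet.IsFunc (vr 0 γ) (vn 1 γ) (F γ) := by
  rw [← isFunc_col (vr_mem_Fs 0) (vn_mem_Fs 1) hF, col_vr_zero]
  exact IsFunc.mono h hY

theorem ev_isFunc_sh (h : ∀ᶠ γ in S.ev, ZFSet.IsFunc (vr 0 γ) (vn 1 γ) (F γ)) :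
    ∀ᶠ γ in S.ev, ZFSet.IsFunc (vr 1 γ) (vn 2 γ) (sh F γ) := by
  have := ev_shift h
  rw [← sh_vr, ← sh_vn]
  exact this

/-- The value of a represented function at an ordinal below `κ`. -/
def val (F : Fn κ) (ξ : κ.ord.ToType) : Fn κ := fun γ => app (F γ) (oz ξ)

theorem val_mem_Fs (hF : F ∈ S.Fs) (ξ : κ.ord.ToType) : val F ξ ∈ S.Fs :=
  app_mem_Fs hF (const_mem_Fs (rank_oz_lt ξ))

theorem ev_pair_val (h : ∀ᶠ γ in S.ev, ZFSet.IsFunc (vr 0 γ) (vn 1 γ) (F γ)) (ξ : κ.ord.ToType) :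
    ∀ᶠ γ in S.ev, ∀ y, ZFSet.pair (oz ξ) y ∈ F γ ↔ y = val F ξ γ :=
  (h.and (ev_oz_mem_vr ξ)).mono fun γ ⟨h1, h2⟩ y => by
    have h3 := h1.2 _ h2
    exact ⟨fun h => (app_eq h h3).symm, fun h => h ▸ app_spec h3.exists⟩

theorem pair_oz_mem_iff (hF : F ∈ S.Fs) (h : ZFSet.IsFunc (kset κ) Y (S.col F)) (hY : Y ⊆ S.Mod 1)
    (ξ : κ.ord.ToType) {y : ZFSet.{u}} :
    ZFSet.pair (oz ξ) y ∈ S.col F ↔ y = S.col (val F ξ) := by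
  have h1 : ZFSet.pair (oz ξ) (S.col (val F ξ)) ∈ S.col F :=
    (pair_oz_mem_col hF (val_mem_Fs hF ξ)).2 ((ev_pair_val (ev_isFunc hF h hY) ξ).mono
      fun γ h => (h _).2 rfl)
  refine ⟨fun h2 => ?_, fun h2 => h2 ▸ h1⟩
  exact (h.2 _ (mem_kset.2 ⟨ξ, rfl⟩)).unique h2 h1

theorem ev_pair_val_sh (h : ∀ᶠ γ in S.ev, ZFSet.IsFunc (vr 0 γ) (vn 1 γ) (F γ))
    (ξ : κ.ord.ToType) :
    ∀ᶠ γ in S.ev, ∀ y, ZFSet.pair (oz ξ) y ∈ sh F γ ↔ y = sh (val F ξ) γ :=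
  ev_shift (ev_pair_val h ξ)

end Functions

/-- If `κ` were not in the image under `j` of the diagonal intersection, a represented function
would pick an `α < γ 0` with `γ 0` outside the shifted `α`-th set. It is regressive, so `α` is
fixed, contradicting that the `α`-th set is in the ultrafilter. -/
theorem diagInter_mem_Ult {f : ZFSet.{u}} (hf : f ∈ S.Mod 1) (h : ZFSet.IsFunc (kset κ) S.Ult f) :
    diagInter κ f ∈ S.Ult := by
  obtain ⟨F, hF, -, rfl⟩ := mem_Mod.1 hf
  have hfun := ev_isFunc hF h Ult_subset_Mod
  have hD : (fun γ => opDiag (vr 0 γ) (F γ) ∅) ∈ S.Fs :=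
    op_mem_Fs (G := opDiag) (op_mem_preds (by simp [basicOps])) (vr_mem_Fs 0) hF const_empty_mem
      fun γ => (ZFSet.rank_mono ZFSet.sep_subset).trans_lt (rank_oz_lt (γ 0))
  -- Membership of `ξ` involves only the sets with index below `ξ`, fewer than `κ` many, so it may
  -- be evaluated pointwise.
  have hcol : S.col (fun γ => opDiag (vr 0 γ) (F γ) ∅) = diagInter κ (S.col F) := by
    refine col_eq_of_subset_kset hD ZFSet.sep_subset
      (Eventually.of_forall fun γ => ZFSet.sep_subset) fun ξ => ?_
    have h1 : ∀ᶠ γ in S.ev, oz ξ ∈ opDiag (vr 0 γ) (F γ) ∅ ↔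
        ∀ i : {ζ // ζ < ξ}, oz ξ ∈ val F i.1 γ := by
      filter_upwards [ev_forall (mk_Iio_lt_of_ord ξ) fun i => ev_pair_val hfun i.1,
        ev_oz_mem_vr ξ] with γ h1 h2
      rw [opDiag, ZFSet.mem_sep]
      constructor
      · rintro ⟨-, h3⟩ i
        exact h3 _ (oz_mem_oz.2 i.2) _ ((h1 i _).2 rfl)
      · refine fun h3 => ⟨h2, fun α hα B hB => ?_⟩
        obtain ⟨ζ, hζ, rfl⟩ := mem_oz.1 hα
        rw [(h1 ⟨ζ, hζ⟩ B).1 hB]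
        exact h3 ⟨ζ, hζ⟩
    rw [eventually_congr h1, diagInter, ZFSet.mem_sep]
    constructor
    · intro h2
      refine ⟨mem_kset.2 ⟨ξ, rfl⟩, fun α hα B hB => ?_⟩
      obtain ⟨ζ, hζ, rfl⟩ := mem_oz.1 hα
      rw [(pair_oz_mem_iff hF h Ult_subset_Mod ζ).1 hB, oz_mem_col (val_mem_Fs hF ζ)]
      exact h2.mono fun γ h => h ⟨ζ, hζ⟩
    · rintro ⟨-, h2⟩
      refine ev_forall (mk_Iio_lt_of_ord ξ) fun i => ?_
      exact (oz_mem_col (val_mem_Fs hF i.1)).1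
        (h2 _ (oz_mem_oz.2 i.2) _ ((pair_oz_mem_iff hF h Ult_subset_Mod i.1).2 rfl))
  rw [← hcol, col_mem_Ult hD]
  refine ⟨hcol ▸ ZFSet.sep_subset, ?_⟩
  have key := ev_of_no_counterexample (p := relDiag) (rel_mem (by simp [basicRels])) (vr_mem_Fs 0)
    (vr_mem_Fs 0) (sh_mem_Fs hF) fun W hW hev => by
      obtain ⟨ξ, hξ⟩ := exists_ev_eq_oz hW (hev.mono fun γ h => h.1)
      have h1 := ((pair_oz_mem_iff hF h Ult_subset_Mod ξ).2 rfl)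
      have h2 := (ZFSet.pair_mem_prod.1 (h.1 h1)).2
      obtain ⟨γ, ⟨-, B, h3, h4⟩, h5, h6, h7⟩ := (hev.and (hξ.and ((ev_pair_val_sh hfun ξ).and
        ((col_mem_Ult (val_mem_Fs hF ξ)).1 h2).2))).exists
      rw [h5, h6] at h3
      exact h4 (h3 ▸ h7)
  refine (key.and (ev_vr_mem_vr Nat.zero_lt_one)).mono fun γ ⟨h1, h2⟩ => ?_
  show vr 0 γ ∈ opDiag (sh (vr 0) γ) (sh F γ) ∅
  refine ZFSet.mem_sep.2 ⟨by rwa [← sh_vr] at h2, fun α hα B hB => ?_⟩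
  by_contra hcon
  exact h1 α ((ZFSet.rank_lt_of_mem hα).trans (rank_oz_lt _)) ⟨hα, B, hB, hcon⟩

theorem isMUltrafilter_Ult : IsMUltrafilter (S.Mod 1) κ S.Ult where
  mem_model B hB := ⟨(ZFSet.mem_sep.1 hB).1, (ZFSet.mem_sep.1 hB).2.1⟩
  empty_notMem h := by
    have h1 : S.col (fun _ => ∅) = ∅ := col_const (by simpa using hκ.out.isRegular.ord_pos)
    rw [← h1, col_mem_Ult const_empty_mem] at h
    obtain ⟨γ, h2⟩ := h.2.exists
    exact ZFSet.notMem_empty _ h2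
  upward B hB C hC hBC hCκ := by
    obtain ⟨F, hF, -, rfl⟩ := mem_Mod.1 (Ult_subset_Mod hB)
    obtain ⟨G, hG, -, rfl⟩ := mem_Mod.1 hC
    rw [col_mem_Ult hF] at hB
    refine (col_mem_Ult hG).2 ⟨hCκ, ?_⟩
    exact (hB.2.and (ev_shift ((col_subset_col hF hG).1 hBC))).mono fun γ ⟨h1, h2⟩ => h2 h1
  inter B hB C hC := by
    obtain ⟨F, hF, -, rfl⟩ := mem_Mod.1 (Ult_subset_Mod hB)
    obtain ⟨G, hG, -, rfl⟩ := mem_Mod.1 (Ult_subset_Mod hC)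
    rw [col_mem_Ult hF] at hB
    rw [col_mem_Ult hG] at hC
    rw [← col_inter hF hG, col_mem_Ult (inter_mem_Fs hF hG), col_inter hF hG]
    exact ⟨fun x hx => hB.1 (ZFSet.mem_inter.1 hx).1,
      (hB.2.and hC.2).mono fun γ h => ZFSet.mem_inter.2 h⟩
  ultra B hB hBκ := by
    obtain ⟨F, hF, -, rfl⟩ := mem_Mod.1 hB
    rcases ev_mem_or (vr_mem_Fs 0) (sh_mem_Fs hF) with h | h
    · exact Or.inl ((col_mem_Ult hF).2 ⟨hBκ, h⟩)
    · exact Or.inr (kset_diff_mem_Ult hF h)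
  tail α hα := by
    obtain ⟨ξ, rfl⟩ := exists_oz_of_mem hα
    rw [← col_oz (S := S) ξ]
    exact kset_diff_mem_Ult (const_mem_Fs (rank_oz_lt ξ))
      ((ev_gt ξ).mono fun γ h h1 => h.not_gt (oz_mem_oz.1 h1))
  normal f hf h := diagInter_mem_Ult hf h

/-- Enumerate `X` along `κ` by `G`. The indices of sets in the ultrafilter are computed by a
function that uses one more indiscernible through `sh G`; the resulting trace is represented, and
its rank is at most that of `G`, so it stays in the model. -/
theorem weaklyAmenable_Ult : WeaklyAmenable (S.Mod 1) κ S.Ult := by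
  rintro X hX ⟨g, hg, hfun, hsurj⟩
  obtain ⟨G, hG, hGv, rfl⟩ := mem_Mod.1 hg
  have hXM : X ⊆ S.Mod 1 := (isTransitive_Mod 1).subset_of_mem hX
  have hev := ev_isFunc hG hfun hXM
  let D : Fn κ := fun γ => opTraceIdx (vr 0 γ) (sh G γ) ∅
  have hD : D ∈ S.Fs :=
    op_mem_Fs (G := opTraceIdx) (op_mem_preds (by simp [basicOps])) (vr_mem_Fs 0) (sh_mem_Fs hG)
      const_empty_mem fun γ => (ZFSet.rank_mono ZFSet.sep_subset).trans_lt (rank_oz_lt (γ 0))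
  have hrank : ∀ γ, (opTrace (vr 0 γ) (D γ) (G γ)).rank ≤ (G γ).rank := fun γ =>
    (ZFSet.rank_mono ZFSet.sep_subset).trans ((ZFSet.rank_sUnion_le _).trans
      (ZFSet.rank_sUnion_le _))
  have hE : (fun γ => opTrace (vr 0 γ) (D γ) (G γ)) ∈ S.Fs :=
    op_mem_Fs (G := opTrace) (op_mem_preds (by simp [basicOps])) (vr_mem_Fs 0) hD hG
      fun γ => (hrank γ).trans_lt (rank_Fn_lt hG γ)
  have hidx : ∀ ξ, ∀ᶠ γ in S.ev, oz ξ ∈ D γ ↔ vr 0 γ ∈ sh (val G ξ) γ := fun ξ => by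
    filter_upwards [ev_pair_val_sh hev ξ, ev_oz_mem_vr ξ] with γ h1 h2
    simp only [D, opTraceIdx, ZFSet.mem_sep, h1, exists_eq_left, h2, true_and]
  have hcol : S.col (fun γ => opTrace (vr 0 γ) (D γ) (G γ)) = S.Ult ∩ X := by
    ext y
    rw [ZFSet.mem_inter]
    constructor
    · intro hy
      obtain ⟨W, hW, h1, rfl⟩ := mem_col.1 hy
      simp only [opTrace, ZFSet.mem_sep] at h1
      obtain ⟨n, hWn, hDn, hGn⟩ := exists_lev_triple hW hD hG
      obtain ⟨I, hI, h2⟩ := exists_witness (p := relFrom) (rel_mem (by simp [basicRels]))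
        hWn hDn hGn (h1.mono fun γ h => by
          obtain ⟨-, -, ξ, h3, h4⟩ := h
          exact ⟨ξ, (ZFSet.rank_lt_of_mem h3).trans (rank_Fn_lt hD γ), h3, h4⟩)
      obtain ⟨ξ, hξ⟩ := exists_ev_eq_oz (lev_subset_Fs hI)
        (h2.mono fun γ h => (ZFSet.mem_sep.1 h.1).1)
      have h3 : ∀ᶠ γ in S.ev, W γ = val G ξ γ :=
        (h2.and (hξ.and (ev_pair_val hev ξ))).mono fun γ ⟨h3, h4, h5⟩ =>
          (h5 _).1 (h4 ▸ h3.2)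
      rw [col_congr h3, col_mem_Ult (val_mem_Fs hG ξ), col_subset_kset (val_mem_Fs hG ξ)]
      refine ⟨⟨(h1.and h3).mono fun γ h => h.2 ▸ h.1.2.1,
        (h2.and (hξ.and (hidx ξ))).mono fun γ ⟨h4, h5, h6⟩ => h6.1 (h5 ▸ h4.1)⟩, ?_⟩
      exact (ZFSet.pair_mem_prod.1 (hfun.1 ((pair_oz_mem_iff hG hfun hXM ξ).2 rfl))).2
    · rintro ⟨hyU, hyX⟩
      obtain ⟨a, ha, -⟩ := hsurj y hyX
      obtain ⟨ξ, rfl⟩ := exists_oz_of_mem (ZFSet.pair_mem_prod.1 (hfun.1 ha)).1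
      obtain rfl := (pair_oz_mem_iff hG hfun hXM ξ).1 ha
      rw [col_mem_Ult (val_mem_Fs hG ξ), col_subset_kset (val_mem_Fs hG ξ)] at hyU
      refine (col_mem_col (val_mem_Fs hG ξ) hE).2 ?_
      filter_upwards [hyU.1, hyU.2, hidx ξ, ev_pair_val hev ξ] with γ h1 h2 h3 h4
      have h5 := (h4 _).2 rfl
      refine ZFSet.mem_sep.2 ⟨ZFSet.mem_sUnion.2 ⟨{oz ξ, val G ξ γ}, ZFSet.mem_sUnion.2 ⟨_, h5, ?_⟩,
        ?_⟩, h1, oz ξ, h3.2 h2, h5⟩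
      · simp [ZFSet.pair]
      · simp
  rw [← hcol, col_mem_Mod hE]
  exact hGv.mono fun γ h => mem_vn.2 ((hrank γ).trans_lt (mem_vn.1 h))

/-- Choose `γ` above the indices of all the representing functions and the thresholds for membership
in the ultrafilter. Then `γ 0` belongs to the values at `γ 1, γ 2, …`, and by indiscernibility with
parameter `γ 0` to those at every later sequence, so it is a common element. -/
theorem omegaOneIntersecting_Ult : OmegaOneIntersecting S.Ult := by
  intro B hB
  choose F hF h1 h2 using fun n => mem_Mod.1 (Ult_subset_Mod (hB n))
  have h3 : ∀ n : ULift.{u} ℕ, ∀ᶠ γ in S.ev, vr 0 γ ∈ sh (F n.down) γ := fun n => by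
    have := hB n.down
    rw [← h2, col_mem_Ult (hF _)] at this
    exact this.2
  choose m ζ hζ using hF
  obtain ⟨δ, hδ⟩ := exists_forall_le_of_mk_lt (ι := ULift.{u} ℕ)
    (by simpa using hκ.out.aleph0_lt) fun n => ζ n.down
  obtain ⟨δ', hδ'⟩ := ev_iff.1 (ev_forall (by simpa using hκ.out.aleph0_lt) h3)
  obtain ⟨γ, hγ, hlt⟩ := exists_seqIn S.unbounded (max δ δ')
  rw [max_lt_iff] at hlt
  refine ⟨oz (γ 0), fun n => ?_⟩
  rw [← h2, oz_mem_col ⟨m n, ζ n, hζ n⟩]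
  have h4 : ζ n < γ 0 := (hδ ⟨n⟩).trans_lt hlt.1
  have h5 : γ 0 < γ 1 := hγ.1 Nat.zero_lt_one
  refine ev_iff.2 ⟨γ 0, fun γ' hγ' h => ?_⟩
  have h6 := S.indisc_mem 0 (m n + 1) (γ 0) (ζ n) _ γ' (hγ.shift 1) hγ' h5 (h4.trans h5) h (h4.trans h)
  rw [S.zero, S.zero, hζ] at h6
  exact h6.1 (hδ' γ hγ hlt.2 ⟨n⟩)

/-! ### The ultrapower -/

/-- The value of the shift of a represented function at the first indiscernible. -/
def shVal (F : Fn κ) : Fn κ := fun γ => app (sh F γ) (vr 0 γ)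

theorem shVal_mem_Fs {F : Fn κ} (hF : F ∈ S.Fs) : shVal F ∈ S.Fs :=
  app_mem_Fs (sh_mem_Fs hF) (vr_mem_Fs 0)

theorem col_shVal_congr {F G : Fn κ} (hF : F ∈ S.Fs) (hG : G ∈ S.Fs) (h : S.col F = S.col G) :
    S.col (shVal F) = S.col (shVal G) :=
  col_congr ((ev_shift (P := fun γ => F γ = G γ) ((col_eq_col hF hG).1 h)).mono fun γ h => by
    simp only [shVal, sh, h])

section

variable {F G : Fn κ}

theorem ev_pair_shVal (h : ∀ᶠ γ in S.ev, ZFSet.IsFunc (vr 0 γ) (vn 1 γ) (F γ)) :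
    ∀ᶠ γ in S.ev, ∀ y, ZFSet.pair (vr 0 γ) y ∈ sh F γ ↔ y = shVal F γ := by
  refine ((ev_isFunc_sh h).and (ev_vr_mem_vr Nat.zero_lt_one)).mono fun γ ⟨h1, h2⟩ y => ?_
  have h3 := h1.2 _ h2
  exact ⟨fun h => (app_eq h h3).symm, fun h => h ▸ app_spec h3.exists⟩

theorem col_shVal_mem (hF : F ∈ S.Fs)
    (h : ∀ᶠ γ in S.ev, ZFSet.IsFunc (vr 0 γ) (vn 1 γ) (F γ)) : S.col (shVal F) ∈ S.Mod 2 :=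
  (col_mem_Mod (shVal_mem_Fs hF)).2 (((ev_pair_shVal h).and (ev_isFunc_sh h)).mono
    fun _ ⟨h1, h2⟩ => (ZFSet.pair_mem_prod.1 (h2.1 ((h1 _).2 rfl))).2)

/-- Agreement in the ultrapower. -/
theorem agreeSet_mem_Ult {R : ZFSet.{u} → ZFSet.{u} → Prop}
    (hR : ∀ F ∈ S.Fs, ∀ G ∈ S.Fs, R (S.col F) (S.col G) ↔ ∀ᶠ γ in S.ev, R (F γ) (G γ))
    (hop : opAgree R ∈ basicOps A) (hF : F ∈ S.Fs) (hG : G ∈ S.Fs)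
    (hfF : ZFSet.IsFunc (kset κ) (S.Mod 1) (S.col F))
    (hfG : ZFSet.IsFunc (kset κ) (S.Mod 1) (S.col G)) :
    R (S.col (shVal F)) (S.col (shVal G)) ↔ agreeSet κ R (S.col F) (S.col G) ∈ S.Ult := by
  have hevF := ev_isFunc hF hfF fun _ h => h
  have hevG := ev_isFunc hG hfG fun _ h => h
  have hE : (fun γ => opAgree R (vr 0 γ) (F γ) (G γ)) ∈ S.Fs :=
    op_mem_Fs (op_mem_preds hop) (vr_mem_Fs 0) hF hG fun γ =>
      (ZFSet.rank_mono ZFSet.sep_subset).trans_lt (rank_oz_lt (γ 0))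
  have hcol : S.col (fun γ => opAgree R (vr 0 γ) (F γ) (G γ)) =
      agreeSet κ R (S.col F) (S.col G) := by
    refine col_eq_of_subset_kset hE ZFSet.sep_subset
      (Eventually.of_forall fun γ => ZFSet.sep_subset) fun ξ => ?_
    have h1 : ∀ᶠ γ in S.ev, oz ξ ∈ opAgree R (vr 0 γ) (F γ) (G γ) ↔
        R (val F ξ γ) (val G ξ γ) := by
      filter_upwards [ev_pair_val hevF ξ, ev_pair_val hevG ξ, ev_oz_mem_vr ξ] with γ h1 h2 h3
      simp [opAgree, h1, h2, h3]
    rw [eventually_congr h1, ← hR _ (val_mem_Fs hF ξ) _ (val_mem_Fs hG ξ), agreeSet, ZFSet.mem_sep]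
    simp [pair_oz_mem_iff hF hfF (fun _ h => h),
      pair_oz_mem_iff hG hfG (fun _ h => h), mem_kset]
  rw [← hcol, col_mem_Ult hE, hcol, hR _ (shVal_mem_Fs hF) _ (shVal_mem_Fs hG)]
  have h1 : ∀ᶠ γ in S.ev, vr 0 γ ∈ sh (fun γ => opAgree R (vr 0 γ) (F γ) (G γ)) γ ↔
      R (shVal F γ) (shVal G γ) := by
    filter_upwards [ev_pair_shVal hevF, ev_pair_shVal hevG, ev_vr_mem_vr Nat.zero_lt_one]
      with γ h1 h2 h3
    show vr 0 γ ∈ opAgree R (sh (vr 0) γ) (sh F γ) (sh G γ) ↔ _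
    simp [opAgree, h1, h2, h3, sh_vr]
  rw [eventually_congr h1]
  exact ⟨fun h => ⟨ZFSet.sep_subset, h⟩, fun h => h.2⟩

end

/-- The graph is an image of `γ 0` inside `V_(γ 1)`, so regularity of `γ 1` makes it an element. -/
theorem ev_subset_prod_mem_vn {F : Fn κ}
    (h1 : ∀ᶠ γ in S.ev, ZFSet.IsFunc (vr 0 γ) (vn 1 γ) (F γ)) : ∀ᶠ γ in S.ev, F γ ∈ vn 1 γ := by
  refine ev_subset_mem_vn (((ev_isSuccLimit 1).and ((ev_vr_mem_vn Nat.zero_lt_one).and h1)).mono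
    fun γ ⟨h2, h3, h4⟩ p hp => ?_) (h1.mono fun γ h2 => ?_)
  · obtain ⟨a, ha, b, hb, rfl⟩ := ZFSet.mem_prod.1 (h4.1 hp)
    exact mem_vn.2 (rank_pair_lt h2 ((ZFSet.rank_lt_of_mem ha).trans (mem_vn.1 h3)) (mem_vn.1 hb))
  · refine ⟨fun a => ZFSet.pair a (app (F γ) a), fun p hp => ?_⟩
    obtain ⟨a, ha, b, hb, rfl⟩ := ZFSet.mem_prod.1 (h2.1 hp)
    exact ⟨a, ha, congrArg _ (app_eq hp (h2.2 _ ha))⟩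

/-- A represented function on `κ` whose values are in the model belongs to the model. -/
theorem exists_ultFun {F : Fn κ} (hF : F ∈ S.Fs)
    (h : ∀ᶠ γ in S.ev, ZFSet.IsFunc (vr 0 γ) (vn 1 γ) (F γ)) :
    S.col F ∈ S.Mod 1 ∧ ZFSet.IsFunc (kset κ) (S.Mod 1) (S.col F) := by
  refine ⟨(col_mem_Mod hF).2 (ev_subset_prod_mem_vn h), ?_⟩
  have := (isFunc_col (vr_mem_Fs 0) (vn_mem_Fs 1) hF).2 h
  rwa [col_vr_zero] at this

/-- Every element of the larger model is the shifted value of a function in the smaller one. -/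
theorem exists_shVal_eq {W : Fn κ} (hW : W ∈ S.Fs) (h : ∀ᶠ γ in S.ev, W γ ∈ vn 2 γ) :
    ∃ F ∈ S.Fs, (∀ᶠ γ in S.ev, ZFSet.IsFunc (vr 0 γ) (vn 1 γ) (F γ)) ∧
      ∀ᶠ γ in S.ev, shVal F γ = W γ := by
  obtain ⟨n, ζ, rfl⟩ := hW
  -- The function is `α ↦ W(α, γ 0, γ 1, …)`; shifted and evaluated at `γ 0` it returns `W(γ 0, γ 1,
  -- …)`.
  obtain ⟨ξ, hξ⟩ := S.lam (n + 1) ζ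
  have hL : S.T (n + 1 + 1) ξ ∈ S.Fs := ⟨n + 1, ξ, rfl⟩
  have hpair : ∀ γ x y, ZFSet.pair x y ∈ S.T (n + 1 + 1) ξ γ ↔
      ∃ α < γ 0, oz α = x ∧ S.T (n + 1) ζ (seqCons α γ) = y := fun γ x y => by
    rw [hξ]
    exact mem_rangeBelow_pair (f := fun α => S.T (n + 1) ζ (seqCons α γ))
  -- Some of these values may lie outside `V_(γ 1)`. Replacing them by `∅` does not affect the
  -- argument that matters, where the value is in `V_(γ 2)` after the shift.
  have hF : (fun γ => opTotal (vr 0 γ) (S.T (n + 1 + 1) ξ γ) (vn 1 γ)) ∈ S.Fs :=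
    op_mem_Fs (op_mem_preds (by simp [basicOps])) (vr_mem_Fs 0) hL (vn_mem_Fs 1) fun γ =>
      (ZFSet.rank_mono ZFSet.sep_subset).trans_lt (rank_prod_lt isSuccLimit_ord' (rank_oz_lt _)
        (rank_Fn_lt (S := S) (vn_mem_Fs 1) γ))
  have hmem : ∀ x f v a b : ZFSet.{u}, ZFSet.pair a b ∈ opTotal x f v ↔ (a ∈ x ∧ b ∈ v) ∧
      (ZFSet.pair a b ∈ f ∨ b = ∅ ∧ ¬ ∃ y' ∈ v, ZFSet.pair a y' ∈ f) := fun x f v a b => by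
    rw [opTotal, ZFSet.mem_sep, ZFSet.pair_mem_prod]
    refine and_congr_right fun _ => ⟨?_, fun h => ⟨a, b, rfl, h⟩⟩
    rintro ⟨a', b', h1, h2⟩
    obtain ⟨rfl, rfl⟩ := ZFSet.pair_inj.1 h1
    exact h2
  have hfun : ∀ᶠ γ in S.ev, ZFSet.IsFunc (vr 0 γ) (vn 1 γ)
      (opTotal (vr 0 γ) (S.T (n + 1 + 1) ξ γ) (vn 1 γ)) := by
    filter_upwards [ev_const_mem_vn' (by simpa using hκ.out.isRegular.ord_pos : (∅ : ZFSet.{u}).rank < κ.ord) 1] with γ h0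
    refine ⟨ZFSet.sep_subset, fun a ha => ?_⟩
    simp only [hmem, hpair]
    by_cases h1 : ∃ y' ∈ vn 1 γ, ∃ α < γ 0, oz α = a ∧ S.T (n + 1) ζ (seqCons α γ) = y'
    · obtain ⟨y, hy, α, hα, rfl, rfl⟩ := h1
      refine ⟨_, ⟨⟨ha, hy⟩, Or.inl ⟨α, hα, rfl, rfl⟩⟩, ?_⟩
      rintro y ⟨-, ⟨α', -, h2, rfl⟩ | ⟨-, h2⟩⟩
      · rw [oz_injective h2]
      · exact absurd ⟨_, hy, α, hα, rfl, rfl⟩ h2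
    · refine ⟨∅, ⟨⟨ha, h0⟩, Or.inr ⟨rfl, h1⟩⟩, ?_⟩
      rintro y ⟨⟨-, hy⟩, h2 | h2⟩
      · exact absurd ⟨y, hy, h2⟩ h1
      · exact h2.1
  refine ⟨_, hF, hfun, ?_⟩
  filter_upwards [h, ev_pair_shVal hfun, ev_lt Nat.zero_lt_one] with γ h1 h2 h3
  symm
  rw [← h2]
  show _ ∈ opTotal (sh (vr 0) γ) (sh (S.T (n + 1 + 1) ξ) γ) (sh (vn 1) γ)
  rw [hmem, sh_vr, sh_vn]
  refine ⟨⟨oz_mem_oz.2 h3, h1⟩, Or.inl ((hpair _ _ _).2 ⟨γ 0, h3, rfl, ?_⟩)⟩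
  congr 1
  funext i
  rcases i with _ | i
  · rfl
  · simp [seqCons, seqAppend, add_comm]

theorem exists_emb_Mod : ∃ j : S.Mod 1 ↪ₑ[LSet] S.Mod 2,
    ∀ F ∈ S.Fs, ∀ x : S.Mod 1, S.col F = x → (j x : ZFSet.{u}) = S.col (sh F) := by
  have := exists_emb (S := S) (vn_mem_Fs 1)
  rwa [sh_vn] at this

/-- The class of `f` is sent to `j(f)(κ)`. Agreement sets are evaluated pointwise, and every element
of `Mod 2` has this form, so the transitive set `Mod 2` is the collapse of the ultrapower. -/
theorem isUltrapowerMap_of_emb (j : S.Mod 1 → S.Mod 2)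
    (hj : ∀ F ∈ S.Fs, ∀ x : S.Mod 1, S.col F = x → (j x : ZFSet.{u}) = S.col (sh F)) :
    IsUltrapowerMap (S.Mod 1) κ S.Ult (S.Mod 2) j := by
  refine ⟨isTransitive_Mod 2, ?_⟩
  choose F hF h1 h2 using fun f : UltFun (S.Mod 1) κ => mem_Mod.1 f.2.1
  have hf : ∀ f, ZFSet.IsFunc (kset κ) (S.Mod 1) (S.col (F f)) := fun f => (h2 f).symm ▸ f.2.2
  have hev := fun f => ev_isFunc (hF f) (hf f) fun _ h => h
  refine ⟨fun f => ⟨S.col (shVal (F f)), col_shVal_mem (hF f) (hev f)⟩, ?_, ?_, ?_, ?_⟩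
  · rintro ⟨y, hy⟩
    obtain ⟨W, hW, h, rfl⟩ := mem_Mod.1 hy
    obtain ⟨G, hG, h3, h4⟩ := exists_shVal_eq hW h
    have h5 := exists_ultFun hG h3
    refine ⟨⟨S.col G, h5⟩, Subtype.ext ?_⟩
    exact (col_shVal_congr (hF _) hG (h2 _)).trans (col_congr h4)
  · intro f g
    rw [Subtype.ext_iff, ← h2 f, ← h2 g]
    exact agreeSet_mem_Ult (R := (· = ·)) (fun _ hF _ hG => col_eq_col hF hG) (by simp [basicOps])
      (hF f) (hF g) (hf f) (hf g)
  · intro f g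
    rw [← h2 f, ← h2 g]
    exact agreeSet_mem_Ult (R := (· ∈ ·)) (fun _ hF _ hG => col_mem_col hF hG) (by simp [basicOps])
      (hF f) (hF g) (hf f) (hf g)
  · intro x
    obtain ⟨G, hG, h3, h4⟩ := mem_Mod.1 x.2
    have hC : (fun γ => opConst (vr 0 γ) (G γ) ∅) ∈ S.Fs :=
      op_mem_Fs (G := opConst) (op_mem_preds (by simp [basicOps])) (vr_mem_Fs 0) hG
        const_empty_mem fun γ => rank_prod_lt isSuccLimit_ord' (rank_oz_lt _) (by
          rw [ZFSet.rank_singleton]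
          exact isSuccLimit_ord'.succ_lt (rank_Fn_lt hG γ))
    have hconst : ∀ a b c d : ZFSet.{u}, ZFSet.pair a b ∈ opConst c d ∅ ↔ a ∈ c ∧ b = d := by
      simp [opConst]
    have h5 : ∀ᶠ γ in S.ev, ZFSet.IsFunc (vr 0 γ) (vn 1 γ) (opConst (vr 0 γ) (G γ) ∅) :=
      h3.mono fun γ h => ⟨fun p hp => by
        obtain ⟨a, ha, b, hb, rfl⟩ := ZFSet.mem_prod.1 hp
        exact ZFSet.pair_mem_prod.2 ⟨ha, ZFSet.mem_singleton.1 hb ▸ h⟩, fun a ha =>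
        ⟨G γ, (hconst _ _ _ _).2 ⟨ha, rfl⟩, fun y hy => ((hconst _ _ _ _).1 hy).2⟩⟩
    have h6 := exists_ultFun hC h5
    have h7 : S.col (fun γ => opConst (vr 0 γ) (G γ) ∅) = ZFSet.prod (kset κ) {(x : ZFSet.{u})} := by
      have h8 : ∀ (ξ : κ.ord.ToType) (y), ZFSet.pair (oz ξ) y ∈ S.col (fun γ => opConst (vr 0 γ) (G γ) ∅) ↔ y = x := by
        intro ξ y
        rw [pair_oz_mem_iff hC h6.2 (fun _ h => h), ← h4]
        rw [col_congr (G := G) ((ev_pair_val h5 ξ).and (ev_oz_mem_vr ξ) |>.mono fun γ h =>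
          ((h.1 _).1 ((hconst _ _ _ _).2 ⟨h.2, rfl⟩)).symm)]
      ext p
      constructor
      · intro hp
        obtain ⟨a, ha, b, hb, rfl⟩ := ZFSet.mem_prod.1 (h6.2.1 hp)
        obtain ⟨ξ, rfl⟩ := exists_oz_of_mem ha
        exact ZFSet.pair_mem_prod.2 ⟨ha, ZFSet.mem_singleton.2 ((h8 _ _).1 hp)⟩
      · intro hp
        obtain ⟨a, ha, b, hb, rfl⟩ := ZFSet.mem_prod.1 hp
        obtain ⟨ξ, rfl⟩ := exists_oz_of_mem ha
        exact (h8 _ _).2 (ZFSet.mem_singleton.1 hb)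
    refine ⟨⟨_, h6⟩, h7, Subtype.ext ?_⟩
    rw [hj G hG x h4]
    -- The shift of a constant function is constant with the shifted value, so its value at `κ` is
    -- `j x`.
    refine ((col_shVal_congr (hF _) hC (h2 _)).trans (col_congr ?_)).symm
    filter_upwards [ev_pair_shVal h5, ev_vr_mem_vr Nat.zero_lt_one] with γ h8 h9
    refine ((h8 _).1 ?_).symm
    show _ ∈ opConst (sh (vr 0) γ) (sh G γ) ∅
    rw [hconst, sh_vr]
    exact ⟨h9, rfl⟩

/-- An element of `Mod 2` is in `Mod 1` exactly if its representing function eventually has rank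
below `γ 1`, and `rank_col_lt_iff` turns this into a bound on the rank of the collapse. -/
theorem Mod_eq_rankInitial : S.Mod 1 = rankInitial (S.Mod 2) (S.col (vr 1)) := by
  ext x
  rw [rankInitial, ZFSet.mem_sep, mem_Mod]
  constructor
  · rintro ⟨F, hF, h, rfl⟩
    refine ⟨(col_mem_Mod hF).2 ((h.and (ev_lt Nat.one_lt_two)).mono fun γ ⟨h1, h2⟩ => mem_vn.2
      ((mem_vn.1 h1).trans (rank_oz_lt_rank_oz.2 h2))), ?_⟩
    exact (rank_col_lt_iff hF (vr_mem_Fs 1)).2 (h.mono fun γ h => mem_vn.1 h)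
  · rintro ⟨hx, hr⟩
    obtain ⟨F, hF, -, rfl⟩ := mem_Mod.1 hx
    exact ⟨F, hF, ((rank_col_lt_iff hF (vr_mem_Fs 1)).1 hr).mono fun γ h => mem_vn.2 h, rfl⟩

end System

end SetModels

end

/-! ### The main theorem -/

theorem mainTheorem4 (κ : Cardinal.{u}) (hκ : SetModels.IsRamsey κ)
    (A : ZFSet.{u}) (hA : A ⊆ SetModels.kset κ) :
    ∃ (M : ZFSet.{u}) (hM : SetModels.IsWeakModel κ M) (U N : ZFSet.{u})
      (j : M ↪ₑ[SetModels.LSet] N),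
      A ∈ M ∧ SetModels.IsSpecial ω κ M ∧
      SetModels.IsMUltrafilter M κ U ∧ SetModels.WeaklyAmenable M κ U ∧
      SetModels.OmegaOneIntersecting U ∧
      SetModels.IsUltrapowerMap M κ U N j ∧
      M = SetModels.rankInitial N (j ⟨SetModels.kset κ, hM.kset_mem⟩) ∧
      M ⊨ SetModels.ZFC ∧ M ∈ N := by
  have : Fact κ.IsInaccessible := ⟨hκ.isInaccessible⟩
  obtain ⟨S⟩ := hκ.exists_system (SetModels.preds A) (SetModels.countable_preds A)
  obtain ⟨j, hj⟩ := SetModels.System.exists_emb_Mod (S := S)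
  refine ⟨S.Mod 1, SetModels.System.isWeakModel_Mod, S.Ult, S.Mod 2, j,
    SetModels.System.mem_Mod_of_subset_kset hA, SetModels.System.isSpecial_Mod,
    SetModels.System.isMUltrafilter_Ult, SetModels.System.weaklyAmenable_Ult,
    SetModels.System.omegaOneIntersecting_Ult,
    SetModels.System.isUltrapowerMap_of_emb j hj, ?_,
    SetModels.System.models_Mod (SetModels.V_models_ZFC this.out),
    SetModels.System.Mod_mem_Mod Nat.one_lt_two⟩
  -- As `κ` is the collapse of the first indiscernible, `j(κ)` is the collapse of the second.
  rw [hj (SetModels.vr 0) (SetModels.System.vr_mem_Fs 0) _ SetModels.System.col_vr_zero,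
    SetModels.System.sh_vr]
  exact SetModels.System.Mod_eq_rankInitial
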